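/- Fix $d\in\mathbb N$. For a fixed window $g\in\mathcal S(\mathbb R^d)\setminus\{0\}$ let $V_gf(x,\eta)=\langle f,M_\eta T_xg\rangle$, where $M_\eta T_xg(t)=e^{2\pi i\eta\cdot t}g(t-x)$, be the short-time Fourier transform of $f\in\mathcal S'(\mathbb R^d)$, where $\langle\cdot,\cdot\rangle$ extends $\langle f,h\rangle=\int f\,\overline h\,dt$. For $1\le p,q\le\infty$ let $$\|f\|_{M^{p,q}}=\Big(\int_{\mathbb R^d}\Big(\int_{\mathbb R^d}|V_gf(x,\eta)|^p\,dx\Big)^{q/p}d\eta\Big)^{1/q}$$ (with essential suprema if $p=\infty$ or $q=\infty$), let $M^{p,q}(\mathbb R^d)=\{f\in\mathcal S'(\mathbb R^d):\|f\|_{M^{p,q}}<\infty\}$, and let $\tilde M^{p,q}(\mathbb R^d)$ be the closure of $\mathcal S(\mathbb R^d)$ in $M^{p,q}(\mathbb R^d)$. Let $\Phi:\mathbb R^{2d}\to\mathbb R$ satisfy (i) $\Phi\in C^\infty(\mathbb R^{2d})$; (ii) for every multi-index $\alpha$ with $|\alpha|\ge 2$ there is $C_\alpha$ with $|\partial_z^\alpha\Phi(z)|\le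 C_\alpha$ for all $z=(x,\eta)\in\mathbb R^{2d}$; (iii) there is $\delta>0$ with $|\det\partial^2_{x,\eta}\Phi(x,\eta)|\ge\delta$ for all $(x,\eta)\in\mathbb R^{2d}$. Let $N\in\mathbb N$ with $N>d$, and let $\sigma:\mathbb R^{2d}\to\mathbb C$ be measurable such that for every multi-index $\alpha$ with $|\alpha|\le 2N$ the distributional derivative $\partial_z^\alpha\sigma$ is a function with $|\partial^\alpha_z\sigma(z)|\le C_\alpha$ for a.e. $z\in\mathbb R^{2d}$. Suppose in addition that $$\sup_{x,x',\eta\in\mathbb R^d}|\nabla_x\Phi(x,\eta)-\nabla_x\Phi(x',\eta)|<\infty .$$ Let $T$ be the Fourier integral operator $$Tf(x)=\int_{\mathbb R^d}e^{2\pi i\Phi(x,\eta)}\sigma(x,\eta)\hat f(\eta)\,d\eta,\qquad f\in\mathcal S(\mathbb R^d),\qquad \hat f(\eta)=\int_{\mathbb R^d}f(t)e^{-2\pi it\cdot\eta}\,dt .$$ Then $T$ extends to a bounded linear operator on $M^{p,q}(\mathbb R^d)$ for all $1\le p,q<\infty$; and if $1\le p,q\le\infty$ and $p=\infty$ or $q=\infty$,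 then $T$ extends to a bounded linear operator on $\tilde M^{p,q}(\mathbb R^d)$. -/

import Mathlib

open MeasureTheory
open scoped SchwartzMap FourierTransform ENNReal NNReal ContDiff LineDeriv Gradient

noncomputable section

namespace FourierIntegral

/-- The Euclidean space `ℝ^d`. -/
abbrev Eu (d : ℕ) : Type := EuclideanSpace ℝ (Fin d)

/-! ### Time-frequency shifts and the short-time Fourier transform -/

/-- The character `t ↦ e^{2πi η·t}`. -/
def character {d : ℕ} (η : Eu d) (t : Eu d) : ℂ :=
  Complex.exp (2 * Real.pi * Complex.I * (inner ℝ η t : ℝ))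

/-- `u ↦ e^{cu}`, `c` purely imaginary, has temperate growth on the real line. -/
theorem hasTemperateGrowth_exp_mul_I (c : ℂ) (hc : c.re = 0) :
    Function.HasTemperateGrowth (fun u : ℝ => Complex.exp (c * (u : ℂ))) := by
  have key : ∀ n : ℕ, iteratedDeriv n (fun u : ℝ => Complex.exp (c * (u : ℂ))) =
      fun u : ℝ => c ^ n * Complex.exp (c * (u : ℂ)) := by
    intro n
    induction n with
    | zero => simp
    | succ n ih =>
      rw [iteratedDeriv_succ, ih]
      funext u
      have h1 : HasDerivAt (fun u : ℝ => c * (u : ℂ)) c u := by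
        simpa using (Complex.ofRealCLM.hasDerivAt (x := u)).const_mul c
      have h2 := (h1.cexp).const_mul (c ^ n)
      rw [h2.deriv]
      ring
  refine ⟨?_, fun n => ⟨0, ‖c‖ ^ n, fun u => ?_⟩⟩
  · exact Complex.contDiff_exp.comp (contDiff_const.mul Complex.ofRealCLM.contDiff)
  · rw [norm_iteratedFDeriv_eq_norm_iteratedDeriv, key n]
    simp [Complex.norm_exp, hc]

theorem hasTemperateGrowth_character {d : ℕ} (η : Eu d) :
    Function.HasTemperateGrowth (character η) :=
  (hasTemperateGrowth_exp_mul_I (2 * Real.pi * Complex.I) (by simp)).comp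
    (Function.hasTemperateGrowth_inner_right η)

/-- The time-frequency shift `M_η T_x g`, i.e. `t ↦ e^{2πi η·t} g(t - x)`, of a Schwartz function. -/
def timeFreqShift {d : ℕ} (g : 𝓢(Eu d, ℂ)) (x η : Eu d) : 𝓢(Eu d, ℂ) :=
  SchwartzMap.smulLeftCLM ℂ (character η) (SchwartzMap.compSubConstCLM ℂ x g)

theorem timeFreqShift_apply {d : ℕ} (g : 𝓢(Eu d, ℂ)) (x η t : Eu d) :
    timeFreqShift g x η t = character η t * g (t - x) := by
  simp [timeFreqShift, SchwartzMap.smulLeftCLM_apply_apply (hasTemperateGrowth_character η)]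

/-- Complex conjugation of Schwartz functions. -/
def conj {d : ℕ} (φ : 𝓢(Eu d, ℂ)) : 𝓢(Eu d, ℂ) :=
  SchwartzMap.postcompCLM (𝕜 := ℝ) (Complex.conjCLE : ℂ →L[ℝ] ℂ) φ

theorem conj_apply {d : ℕ} (φ : 𝓢(Eu d, ℂ)) (t : Eu d) :
    conj φ t = (starRingEnd ℂ) (φ t) := by
  simp [conj]

/-- The short-time Fourier transform `V_g f(x,η) = ⟨f, M_η T_x g⟩` of a tempered distribution `f`,
where `⟨·,·⟩` is the sesquilinear pairing extending `∫ f(t) conj(g(t)) dt`. -/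
def stft {d : ℕ} (g : 𝓢(Eu d, ℂ)) (f : 𝓢'(Eu d, ℂ)) (x η : Eu d) : ℂ :=
  f (conj (timeFreqShift g x η))

/-! ### Modulation spaces -/

/-- The modulation space norm
`‖f‖_{M^{p,q}} = ‖V_g f‖_{L^{p,q}} = (∫ (∫ |V_g f(x,η)|^p dx)^{q/p} dη)^{1/q}`
(essential suprema when `p = ∞` or `q = ∞`), with values in `[0,∞]`. -/
def modNorm {d : ℕ} (g : 𝓢(Eu d, ℂ)) (p q : ℝ≥0∞) (f : 𝓢'(Eu d, ℂ)) : ℝ≥0∞ :=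
  eLpNorm (fun η : Eu d => eLpNorm (fun x : Eu d => stft g f x η) p volume) q volume

/-- The modulation space `M^{p,q}(ℝ^d)`: the tempered distributions with finite norm. -/
def modSpace {d : ℕ} (g : 𝓢(Eu d, ℂ)) (p q : ℝ≥0∞) : Set 𝓢'(Eu d, ℂ) :=
  {f | modNorm g p q f < ⊤}

/-- The closure of the Schwartz class in `M^{p,q}(ℝ^d)`, with respect to the norm of
`M^{p,q}(ℝ^d)`. -/
def modSpaceClosure {d : ℕ} (g : 𝓢(Eu d, ℂ)) (p q : ℝ≥0∞) : Set 𝓢'(Eu d, ℂ) :=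
  {f | f ∈ modSpace g p q ∧
    ∀ ε : ℝ≥0∞, 0 < ε → ∃ φ : 𝓢(Eu d, ℂ), modNorm g p q (f - (φ : 𝓢'(Eu d, ℂ))) < ε}

/-! ### Phases, symbols and Fourier integral operators -/

/-- The mixed Hessian `∂²_{x,η} Φ(z)`, the matrix with entries `∂²Φ/∂x_i∂η_j`. -/
def mixedHessian {d : ℕ} (Φ : Eu d × Eu d → ℝ) (z : Eu d × Eu d) : Matrix (Fin d) (Fin d) ℝ :=
  Matrix.of fun i j => iteratedFDeriv ℝ 2 Φ z
    ![(EuclideanSpace.single i 1, 0), (0, EuclideanSpace.single j 1)]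

/-- The standing conditions on a real phase: smoothness, boundedness of all derivatives of order
at least two, and nondegeneracy of the mixed Hessian. -/
structure IsPhase {d : ℕ} (Φ : Eu d × Eu d → ℝ) : Prop where
  smooth : ContDiff ℝ ∞ Φ
  bounded_deriv : ∀ n : ℕ, 2 ≤ n → ∃ C : ℝ, ∀ z, ‖iteratedFDeriv ℝ n Φ z‖ ≤ C
  nondegenerate : ∃ δ : ℝ, 0 < δ ∧ ∀ z, δ ≤ |(mixedHessian Φ z).det|

instance instIsAddHaarMeasureProdEu {d : ℕ} :
    (volume : Measure (Eu d × Eu d)).IsAddHaarMeasure :=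
  inferInstanceAs
    ((volume : Measure (Eu d)).prod (volume : Measure (Eu d))).IsAddHaarMeasure

/-- The symbol `σ` and all its distributional derivatives of order at most `K` are (represented by)
essentially bounded functions. Here `∂^{m}` is the iterated distributional derivative in the
directions `m 0, …, m (n-1)`. By multilinearity in `m` it is the same to ask this of the
partial derivatives `∂^α`, `|α| ≤ K`. -/
def IsSymbol {d : ℕ} (K : ℕ) (σ : Eu d × Eu d → ℂ) : Prop :=
  ∃ hσ : MemLp σ ⊤ volume, ∀ n : ℕ, n ≤ K → ∀ m : Fin n → Eu d × Eu d,
    ∃ τ : Lp ℂ ⊤ (volume : Measure (Eu d × Eu d)),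
      ∂^{m} (Lp.toTemperedDistribution (hσ.toLp σ)) = Lp.toTemperedDistribution τ

/-- The function `Tf(x) = ∫ e^{2πi Φ(x,η)} σ(x,η) f̂(η) dη`, for Schwartz `f`, where
`f̂(η) = ∫ f(t) e^{-2πi t·η} dt`. -/
def fio {d : ℕ} (Φ : Eu d × Eu d → ℝ) (σ : Eu d × Eu d → ℂ) (f : 𝓢(Eu d, ℂ)) (x : Eu d) : ℂ :=
  ∫ η : Eu d, Complex.exp (2 * Real.pi * Complex.I * (Φ (x, η) : ℂ)) * σ (x, η) * 𝓕 f η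

/-- The tempered distribution `u` is the function `F`, that is `u(φ) = ∫ F φ` (with absolutely
convergent integrals) for all Schwartz functions `φ`. -/
def IsFunction {d : ℕ} (u : 𝓢'(Eu d, ℂ)) (F : Eu d → ℂ) : Prop :=
  ∀ φ : 𝓢(Eu d, ℂ), Integrable (fun x => F x * φ x) volume ∧ u φ = ∫ x, F x * φ x

/-- The Fourier integral operator with phase `Φ` and symbol `σ`, given on Schwartz functions by the
absolutely convergent integral `fio Φ σ`, extends to a bounded operator on `X`, where
`X` is a space of tempered distributions with the norm `N`: there is a linear operator `A` with
domain exactly `X` (so `X` is a linear subspace) that maps `X` into `X`, is bounded in the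
norm `N`, and agrees on the Schwartz class (which is contained in `X`) with `fio Φ σ`. -/
def ExtendsBoundedly {d : ℕ} (Φ : Eu d × Eu d → ℝ) (σ : Eu d × Eu d → ℂ)
    (X : Set 𝓢'(Eu d, ℂ)) (N : 𝓢'(Eu d, ℂ) → ℝ≥0∞) : Prop :=
  ∃ A : 𝓢'(Eu d, ℂ) →ₗ.[ℂ] 𝓢'(Eu d, ℂ),
    (A.domain : Set 𝓢'(Eu d, ℂ)) = X ∧
    (∀ f : A.domain, A f ∈ X) ∧
    (∃ C : ℝ≥0, ∀ f : A.domain, N (A f) ≤ C * N (f : 𝓢'(Eu d, ℂ))) ∧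
    ∀ φ : 𝓢(Eu d, ℂ), ∃ hφ : (φ : 𝓢'(Eu d, ℂ)) ∈ A.domain, IsFunction (A ⟨φ, hφ⟩) (fio Φ σ φ)

end FourierIntegral

end

open FourierIntegral

/-! By the inversion formula for the short-time Fourier transform, a function is a superposition of
the time-frequency shifts π(x,ξ)g with coefficients V_g f(x,ξ), up to the factor 1/∫|g|². Hence T is
governed by the phase-space kernel k(x',ξ';x,ξ) = ⟨Tπ(x,ξ)g, π(x',ξ')g⟩, and boundedness on M^{p,q}
reduces to boundedness on L^{p,q} of a positive operator dominating |k|.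

The kernel pairs σ with e^{2πiΦ} times an amplitude concentrated at (x',ξ) and modulated by -(ξ',x).
The second order Taylor remainder of Φ at (x',ξ) has derivatives that grow at most linearly away
from that point, uniformly in it, so its exponential can be absorbed in the Schwartz amplitude. What
is left is a linear phase with frequency (∇_xΦ(x',ξ) - ξ', ∇_ηΦ(x',ξ) - x). Integrating by parts 2N
times, with the derivatives landing on σ or on the amplitude, bounds |k| by a multiple of
(1+|∇_xΦ(x',ξ) - ξ'|)^{-N} (1+|∇_ηΦ(x',ξ) - x|)^{-N}: this is `exists_fioKernel_bound`.

The first factor still couples ξ, ξ' with x'. Since ∇_xΦ(·,ξ) has uniformly bounded range, x' may be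
replaced there by 0. The kernel then has the form a(ξ',ξ) b_ξ(x',x), to which Minkowski and Schur
apply (`mixedNorm_kernel_le`). Two of the Schur integrals are plain integrals of (1+|v|)^{-N},
finite because N > d. The other two require ξ ↦ ∇_xΦ(0,ξ) and x' ↦ ∇_ηΦ(x',ξ) to be globally
expanding, which follows from the determinant bound by a quantitative form of Hadamard's theorem,
`norm_sub_le_of_fderiv_equiv`.

The extension is defined on f directly, by integrating V_g f against the kernel (`fioExtension`).
Absolute convergence for every test function is `dominatingOp_lt_top`, and agreement with T on the
Schwartz class is Fubini together with the inversion formula. For the closure of the Schwartz class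
one also needs Tφ to lie in it. As σ has limited regularity, Tφ need not be Schwartz; but it is a
bounded function lying in M^{1,1}, and Riemann sums of its inversion formula are Schwartz functions
converging to it in every M^{p,q} (`mem_modSpaceClosure_of_integrable_stft`). -/

noncomputable section

namespace FourierIntegral

/-! ### A quantitative Hadamard theorem via covering maps -/

section GlobalInverse

/-- A continuous open map which is injective on balls of a uniform radius and covers balls of a
uniform radius is a covering map. -/
theorem isCoveringMap_of_uniform {V : Type*} [NormedAddCommGroup V] {F : V → V}
    (hcont : Continuous F) (hopen : IsOpenMap F)
    {R ρ : ℝ} (hρ : 0 < ρ) (hinj : ∀ x, Set.InjOn F (Metric.ball x R))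
    (hsurj : ∀ x, Metric.ball (F x) ρ ⊆ F '' Metric.ball x (R / 2)) : IsCoveringMap F := by
  intro y
  -- If `F e` is within `ρ` of `y`, then `y` is within `ρ` of `F e`, so the covering hypothesis at
  -- `e` produces a fibre point near `e`. Thus the half-radius balls at the fibre points exhaust the
  -- preimage.
  have hexh : F ⁻¹' Metric.ball y ρ ⊆
      ⋃ x : F ⁻¹' {y}, Metric.ball (x : V) (R / 2) ∩ F ⁻¹' Metric.ball y ρ := by
    intro e he
    have he' : y ∈ Metric.ball (F e) ρ := by
      rw [Metric.mem_ball, dist_comm]; exact he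
    obtain ⟨x, hx, hxy⟩ := hsurj e he'
    refine Set.mem_iUnion.2 ⟨⟨x, hxy⟩, ?_, he⟩
    rw [Metric.mem_ball, dist_comm]; exact hx
  rcases isEmpty_or_nonempty (F ⁻¹' {y}) with hemp | hne
  · refine IsEvenlyCovered.of_preimage_eq_empty _ (Metric.ball_mem_nhds y hρ) ?_
    rw [← Set.subset_empty_iff]
    refine hexh.trans ?_
    rw [Set.iUnion_of_empty]
  let ι := {x : V // F x = y}
  let _ : TopologicalSpace ι := ⊥
  have : DiscreteTopology ι := ⟨rfl⟩
  have : Nonempty ι := hne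
  have hsub : ∀ x : ι, ∀ {a b : V}, a ∈ Metric.ball (x : V) (R / 2) →
      b ∈ Metric.ball (x : V) (R / 2) → F a = F b → a = b := by
    intro x a b ha hb hab
    have hR : 0 < R / 2 := Metric.pos_of_mem_ball ha
    have hle : Metric.ball (x : V) (R / 2) ⊆ Metric.ball (x : V) R :=
      Metric.ball_subset_ball (by linarith)
    exact hinj x (hle ha) (hle hb) hab
  have hsurj' : ∀ x : ι, Set.SurjOn F
      (Metric.ball (x : V) (R / 2) ∩ F ⁻¹' Metric.ball y ρ) (Metric.ball y ρ) := by
    intro x v hv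
    have hv' : v ∈ Metric.ball (F x) ρ := by rw [x.2]; exact hv
    obtain ⟨e, he, rfl⟩ := hsurj x hv'
    exact ⟨e, ⟨he, hv⟩, rfl⟩
  let t : Bundle.Trivialization ι F := Metric.isOpen_ball.trivializationDiscrete
    (fun x : ι => Metric.ball (x : V) (R / 2) ∩ F ⁻¹' Metric.ball y ρ) (Metric.ball y ρ)
    (by
      intro x W hW
      constructor
      · intro hWo
        exact (hWo.preimage hcont).inter
          (Metric.isOpen_ball.inter (Metric.isOpen_ball.preimage hcont))
      · intro hWo
        have : W = F '' (F ⁻¹' W ∩ (Metric.ball (x : V) (R / 2) ∩ F ⁻¹' Metric.ball y ρ)) := by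
          ext w
          constructor
          · intro hw
            obtain ⟨e, he, rfl⟩ := hsurj' x (hW hw)
            exact ⟨e, ⟨hw, he⟩, rfl⟩
          · rintro ⟨e, he, rfl⟩
            exact he.1
        rw [this]
        exact hopen _ hWo)
    (fun x a ha b hb hab => hsub x ha.1 hb.1 hab)
    hsurj'
    (by
      intro x₁ x₂ hne
      -- Balls of radius `R / 2` that meet have centres less than `R` apart, and `F` is injective on
      -- balls of radius `R`.
      rw [Function.onFun, Set.disjoint_left]
      intro e h1 h2
      apply hne
      apply Subtype.ext
      have hR : 0 < R / 2 := Metric.pos_of_mem_ball h1.1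
      refine hinj x₁ (Metric.mem_ball_self (by linarith)) ?_ (x₁.2.trans x₂.2.symm)
      have h1' := Metric.mem_ball.1 h1.1
      have h2' := Metric.mem_ball.1 h2.1
      rw [Metric.mem_ball]
      have := dist_triangle_left (x₂ : V) x₁ e
      linarith)
    hexh
  exact (IsEvenlyCovered.of_trivialization (t := t)
    (Metric.mem_ball_self hρ)).to_isEvenlyCovered_preimage

/-- A continuous open map which is uniformly locally expanding and covers balls of a
uniform radius is globally expanding. -/
theorem norm_sub_le_of_uniform {V : Type*} [NormedAddCommGroup V] [NormedSpace ℝ V] {F : V → V}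
    (hcont : Continuous F) (hopen : IsOpenMap F)
    {R ρ K : ℝ} (hR : 0 < R) (hρ : 0 < ρ)
    (hanti : ∀ x, ∀ a ∈ Metric.ball x R, ∀ b ∈ Metric.ball x R, ‖a - b‖ ≤ K * ‖F a - F b‖)
    (hsurj : ∀ x, Metric.ball (F x) ρ ⊆ F '' Metric.ball x (R / 2)) (a b : V) :
    ‖a - b‖ ≤ K * ‖F a - F b‖ := by
  have hinj : ∀ x, Set.InjOn F (Metric.ball x R) := by
    intro x a ha b hb hab
    have := hanti x a ha b hb
    rw [hab, sub_self, norm_zero, mul_zero] at this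
    exact sub_eq_zero.1 (norm_le_zero_iff.1 this)
  have hcov := isCoveringMap_of_uniform hcont hopen hρ hinj hsurj
  -- `V` is simply connected, so the identity lifts through the covering `F` to a continuous section
  -- `G`. Uniqueness of lifts then makes `G` a two-sided inverse.
  obtain ⟨G, ⟨hG0, hFG⟩, -⟩ := hcov.existsUnique_continuousMap_lifts
    (ContinuousMap.id V) (F 0) 0 rfl
  have hFG' : ∀ y, F (G y) = y := fun y => congrFun hFG y
  have hGF : G ∘ F = id := by
    refine hcov.eq_of_comp_eq (G.continuous.comp hcont) continuous_id ?_ 0 (by simpa using hG0)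
    funext x
    simp [hFG']
  have hGF' : ∀ x, G (F x) = x := fun x => congrFun hGF x
  have hK : ∀ y, ∃ ε > 0, ∀ u ∈ Metric.ball y ε, ‖G u - G y‖ ≤ K * ‖u - y‖ := by
    intro y
    obtain ⟨ε, hε, h⟩ := Metric.continuous_iff.1 G.continuous y R hR
    refine ⟨ε, hε, fun u hu => ?_⟩
    have := hanti (G y) (G u) (h u hu) (G y) (Metric.mem_ball_self hR)
    rwa [hFG', hFG'] at this
  have hmain : ∀ u v, ‖G u - G v‖ ≤ K * ‖u - v‖ := by
    intro u v
    let f : ℝ → V := fun t => G (v + t • (u - v))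
    have hf : Continuous f := G.continuous.comp (by fun_prop)
    -- The bound `hK` holds on a radius depending on the point, so it is propagated along the
    -- segment by a continuation argument on a closed subset of `[0,1]`.
    have hclosed : IsClosed ({t | ‖f t - G v‖ ≤ K * ‖u - v‖ * t} ∩ Set.Icc 0 1) :=
      (isClosed_le (by fun_prop) (by fun_prop)).inter isClosed_Icc
    have key := hclosed.Icc_subset_of_forall_exists_gt (by simp [f]) (by
      rintro t ⟨ht, ht0, ht1⟩ y hy
      obtain ⟨ε, hε, h⟩ := hK (v + t • (u - v))
      obtain ⟨s, hs0, hs1⟩ : ∃ s, 0 < s ∧ s * (1 + ‖u - v‖) < ε :=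
        ⟨ε / (2 * (1 + ‖u - v‖)), by positivity, by
          have : 0 < 1 + ‖u - v‖ := by positivity
          field_simp
          linarith⟩
      have hty : t < y := hy
      refine ⟨min y (t + s), ?_, lt_min hty (by linarith), min_le_left _ _⟩
      set z := min y (t + s)
      have hz1 : t < z := lt_min hty (by linarith)
      have hz2 : z - t ≤ s := by linarith [min_le_right y (t + s)]
      have hzt : (v + z • (u - v)) - (v + t • (u - v)) = (z - t) • (u - v) := by
        rw [sub_smul]; abel
      have hn : ‖(v + z • (u - v)) - (v + t • (u - v))‖ = (z - t) * ‖u - v‖ := by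
        rw [hzt, norm_smul, Real.norm_of_nonneg (by linarith)]
      have hmem : v + z • (u - v) ∈ Metric.ball (v + t • (u - v)) ε := by
        rw [Metric.mem_ball, dist_eq_norm, hn]
        nlinarith [norm_nonneg (u - v)]
      have h1 := h _ hmem
      rw [hn] at h1
      calc ‖f z - G v‖ = ‖(f z - f t) + (f t - G v)‖ := by congr 1; abel
        _ ≤ ‖f z - f t‖ + ‖f t - G v‖ := norm_add_le _ _
        _ ≤ K * ((z - t) * ‖u - v‖) + K * ‖u - v‖ * t := add_le_add h1 ht
        _ = K * ‖u - v‖ * z := by ring)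
    have := key (Set.right_mem_Icc.2 zero_le_one)
    simpa [f] using this
  simpa [hGF'] using hmain (F a) (F b)

/-- **Hadamard's global inverse function theorem**, quantitative form: a differentiable map with
Lipschitz derivative and uniformly bounded inverse derivative is globally expanding. -/
theorem norm_sub_le_of_fderiv_equiv {V : Type*} [NormedAddCommGroup V] [NormedSpace ℝ V]
    [CompleteSpace V] {F : V → V} {F' : V → V ≃L[ℝ] V}
    (hF : ∀ x, HasFDerivAt F (F' x : V →L[ℝ] V) x) {M Lc : ℝ} (hM : 0 < M) (hLc : 0 < Lc)
    (hinv : ∀ x, ‖((F' x).symm : V →L[ℝ] V)‖ ≤ M)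
    (hlip : ∀ x y, ‖(F' x : V →L[ℝ] V) - (F' y : V →L[ℝ] V)‖ ≤ Lc * ‖x - y‖) (a b : V) :
    ‖a - b‖ ≤ 2 * M * ‖F a - F b‖ := by
  rcases subsingleton_or_nontrivial V with hV | hV
  · rw [Subsingleton.elim a b]; simp
  have hcont : Continuous F := continuous_iff_continuousAt.2 fun x => (hF x).continuousAt
  have hcont' : Continuous fun x => (F' x : V →L[ℝ] V) := by
    have : LipschitzWith (Real.toNNReal Lc) fun x => (F' x : V →L[ℝ] V) :=
      LipschitzWith.of_dist_le_mul fun x y => by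
        rw [dist_eq_norm, dist_eq_norm, Real.coe_toNNReal _ hLc.le]; exact hlip x y
    exact this.continuous
  have hstrict : ∀ x, HasStrictFDerivAt F (F' x : V →L[ℝ] V) x := fun x =>
    hasStrictFDerivAt_of_hasFDerivAt_of_continuousAt (Filter.Eventually.of_forall hF)
      hcont'.continuousAt
  have hopen : IsOpenMap F := isOpenMap_iff_nhds_le.2 fun x =>
    ((hstrict x).map_nhds_eq_of_equiv).ge
  -- On a ball of radius 1/(2 M Lc) the derivative moves by at most 1/(2M), half of its least
  -- expansion 1/M. The loss is half, so `F` is expanding there with constant 2M.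
  set c : ℝ≥0 := NNReal.mk (1 / (2 * M)) (by positivity) with hc
  have hR : 0 < 1 / (2 * M * Lc) := by positivity
  have happ : ∀ x, ApproximatesLinearOn F (F' x : V →L[ℝ] V)
      (Metric.ball x (1 / (2 * M * Lc))) c := by
    intro x u hu v hv
    refine (convex_ball x _).norm_image_sub_le_of_norm_hasFDerivWithin_le' (f := F)
      (f' := fun y => (F' y : V →L[ℝ] V)) (fun y _ => (hF y).hasFDerivWithinAt) ?_ hv hu
    intro y hy
    refine (hlip y x).trans ?_
    rw [Metric.mem_ball, dist_eq_norm] at hy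
    calc Lc * ‖y - x‖ ≤ Lc * (1 / (2 * M * Lc)) := by gcongr
      _ = 1 / (2 * M) := by field_simp
  -- A closed ball of radius `R/4`, which fits inside the `R/2` ball, has an image containing a ball
  -- of radius (1/M - 1/(2M)) R/4; this is the chosen `ρ`.
  refine norm_sub_le_of_uniform (R := 1 / (2 * M * Lc)) (ρ := 1 / (2 * M) * (1 / (2 * M * Lc) / 4))
    hcont hopen hR (by positivity) ?_ ?_ a b
  · intro x u hu v hv
    have h1 : ‖F u - F v - (F' x) (u - v)‖ ≤ 1 / (2 * M) * ‖u - v‖ := happ x u hu v hv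
    have h2 : ‖u - v‖ ≤ M * ‖(F' x) (u - v)‖ := by
      calc ‖u - v‖ = ‖((F' x).symm : V →L[ℝ] V) ((F' x) (u - v))‖ := by simp
        _ ≤ _ := (ContinuousLinearMap.le_opNorm _ _).trans (by gcongr; exact hinv x)
    have h3 : ‖(F' x) (u - v)‖ ≤ ‖F u - F v‖ + 1 / (2 * M) * ‖u - v‖ := by
      have := norm_sub_norm_le ((F' x) (u - v)) (F u - F v)
      rw [norm_sub_rev ((F' x) (u - v)) (F u - F v)] at this
      linarith
    have h4 : M * ‖(F' x) (u - v)‖ ≤ M * (‖F u - F v‖ + 1 / (2 * M) * ‖u - v‖) := by gcongr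
    have h5 : M * (‖F u - F v‖ + 1 / (2 * M) * ‖u - v‖) =
        M * ‖F u - F v‖ + ‖u - v‖ / 2 := by field_simp
    linarith
  · intro x y hy
    have hs : Metric.closedBall x (1 / (2 * M * Lc) / 4) ⊆ Metric.ball x (1 / (2 * M * Lc)) :=
      Metric.closedBall_subset_ball (by linarith)
    have hb := (happ x).surjOn_closedBall_of_nonlinearRightInverse
      (F' x).toNonlinearRightInverse (by positivity) hs
    have hN : 0 < ‖((F' x).symm : V →L[ℝ] V)‖ := (F' x).norm_symm_pos
    have hle : 1 / (2 * M) * (1 / (2 * M * Lc) / 4) ≤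
        (((F' x).toNonlinearRightInverse.nnnorm : ℝ)⁻¹ - c) * (1 / (2 * M * Lc) / 4) := by
      gcongr
      have h1 : M⁻¹ ≤ ‖((F' x).symm : V →L[ℝ] V)‖⁻¹ := inv_anti₀ hN (hinv x)
      have h2 : (((F' x).toNonlinearRightInverse.nnnorm : ℝ)⁻¹) =
        ‖((F' x).symm : V →L[ℝ] V)‖⁻¹ := rfl
      have h3 : (c : ℝ) = M⁻¹ / 2 := by rw [hc, NNReal.coe_mk]; field_simp
      have h4 : 1 / (2 * M) = M⁻¹ / 2 := by field_simp
      rw [h2, h3, h4]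
      linarith
    obtain ⟨e, he, hey⟩ := hb (Metric.closedBall_subset_closedBall hle
      (Metric.ball_subset_closedBall hy))
    exact ⟨e, Metric.closedBall_subset_ball (by linarith) he, hey⟩

/-- A matrix with bounded entries and determinant bounded away from zero has a bounded inverse. -/
theorem abs_inv_apply_le_of_det {d : ℕ} {A : Matrix (Fin d) (Fin d) ℝ} {C δ : ℝ} (hC : 1 ≤ C)
    (hδ : 0 < δ) (hA : ∀ i j, |A i j| ≤ C) (hdet : δ ≤ |A.det|) (i j : Fin d) :
    |A⁻¹ i j| ≤ δ⁻¹ * (d.factorial * C ^ d) := by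
  rw [Matrix.inv_def, Matrix.smul_apply, smul_eq_mul, abs_mul, Ring.inverse_eq_inv', abs_inv]
  -- An adjugate entry is the determinant of `A` with one row replaced by a unit vector; `1 ≤ C`
  -- keeps that row within the entry bound.
  have h1 : |A.adjugate i j| ≤ d.factorial * C ^ d := by
    rw [Matrix.adjugate_apply]
    have := Matrix.det_le (A := A.updateRow j (Pi.single i 1))
      (abv := IsAbsoluteValue.toAbsoluteValue (abs : ℝ → ℝ)) (x := C) (by
      intro k l
      change |_| ≤ C
      rw [Matrix.updateRow_apply]
      split_ifs
      · rw [Pi.single_apply]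
        split_ifs <;> simp <;> linarith
      · exact hA k l)
    simpa using this
  gcongr

end GlobalInverse

/-! ### Mixed norms, Minkowski's inequality and Schur's test -/

section MixedNorms

variable {α β γ δ : Type*} [MeasurableSpace α] [MeasurableSpace β] [MeasurableSpace γ]
  [MeasurableSpace δ]

theorem eLpNorm_ennreal_eq_lintegral {μ : Measure α} {p : ℝ≥0∞} (hp0 : p ≠ 0) (hp : p ≠ ⊤)
    (f : α → ℝ≥0∞) : eLpNorm f p μ = (∫⁻ x, f x ^ p.toReal ∂μ) ^ (1 / p.toReal) := by
  rw [eLpNorm_eq_lintegral_rpow_enorm_toReal hp0 hp]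
  simp

theorem eLpNorm_mono_ennreal {μ : Measure α} {p : ℝ≥0∞} {f g : α → ℝ≥0∞} (h : ∀ x, f x ≤ g x) :
    eLpNorm f p μ ≤ eLpNorm g p μ :=
  eLpNorm_mono_enorm fun x => by simpa using h x

theorem eLpNorm_top_le_iff {μ : Measure α} {f : α → ℝ≥0∞} {c : ℝ≥0∞} :
    eLpNorm f ⊤ μ ≤ c ↔ ∀ᵐ x ∂μ, f x ≤ c := by
  rw [eLpNorm_exponent_top]
  constructor
  · intro h
    filter_upwards [ae_le_eLpNormEssSup (f := f) (μ := μ)] with x hx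
    exact (by simpa using hx : f x ≤ _).trans h
  · intro h
    exact eLpNormEssSup_le_of_ae_enorm_bound (by simpa using h)

/-- Jensen's inequality for the power function with respect to a weight. -/
theorem lintegral_mul_rpow_le {μ : Measure α} {w f : α → ℝ≥0∞} (hw : AEMeasurable w μ)
    (hf : AEMeasurable f μ) {r : ℝ} (hr : 1 ≤ r) :
    (∫⁻ x, w x * f x ∂μ) ^ r ≤ (∫⁻ x, w x ∂μ) ^ (r - 1) * ∫⁻ x, w x * f x ^ r ∂μ := by
  rcases hr.eq_or_lt with rfl | hr
  · simp
  have hr0 : 0 < r := by linarith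
  set r' : ℝ := r.conjExponent
  have hc : r.HolderConjugate r' := Real.HolderConjugate.conjExponent hr
  have h := ENNReal.lintegral_mul_le_Lp_mul_Lq μ hc.symm (f := fun x => w x ^ (1 / r'))
    (g := fun x => w x ^ (1 / r) * f x) (hw.pow_const _) ((hw.pow_const _).mul hf)
  have h1 : ∀ x, w x ^ (1 / r') * (w x ^ (1 / r) * f x) = w x * f x := by
    intro x
    rw [← mul_assoc, ← ENNReal.rpow_add_of_nonneg _ _ hc.symm.one_div_nonneg hc.one_div_nonneg]
    rw [one_div, one_div, add_comm, hc.inv_add_inv_eq_one, ENNReal.rpow_one]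
  have h2 : ∀ x, (w x ^ (1 / r')) ^ r' = w x := by
    intro x
    rw [← ENNReal.rpow_mul, one_div_mul_cancel hc.symm.ne_zero, ENNReal.rpow_one]
  have h3 : ∀ x, (w x ^ (1 / r) * f x) ^ r = w x * f x ^ r := by
    intro x
    rw [ENNReal.mul_rpow_of_nonneg _ _ hr0.le, ← ENNReal.rpow_mul,
      one_div_mul_cancel hr0.ne', ENNReal.rpow_one]
  simp only [Pi.mul_apply, h1, h2, h3] at h
  calc (∫⁻ x, w x * f x ∂μ) ^ r
      ≤ ((∫⁻ x, w x ∂μ) ^ (1 / r') * (∫⁻ x, w x * f x ^ r ∂μ) ^ (1 / r)) ^ r :=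
        ENNReal.rpow_le_rpow h hr0.le
    _ = _ := by
        rw [ENNReal.mul_rpow_of_nonneg _ _ hr0.le, ← ENNReal.rpow_mul, ← ENNReal.rpow_mul,
          one_div_mul_cancel hr0.ne', ENNReal.rpow_one]
        congr 2
        rw [one_div_mul_eq_div, div_eq_iff hc.symm.ne_zero, hc.sub_one_mul_conj]

/-- For `p = ∞` the sublevel set at `c` consists of the `y` whose slice of `{c < F}` is null, and
the measure of slices is measurable. For finite nonzero `p` this is measurability of an integral
with a parameter. -/
theorem measurable_eLpNorm_right {μ : Measure α} [SFinite μ] {F : α → β → ℝ≥0∞}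
    (hF : Measurable (Function.uncurry F)) (p : ℝ≥0∞) :
    Measurable fun y => eLpNorm (fun x => F x y) p μ := by
  have hF' : Measurable (Function.uncurry fun y x => F x y) := hF.comp measurable_swap
  rcases eq_or_ne p 0 with rfl | hp0
  · simp
  rcases eq_or_ne p ⊤ with rfl | hp
  · refine measurable_of_Iic fun c => ?_
    have : (fun y => eLpNorm (fun x => F x y) ⊤ μ) ⁻¹' Set.Iic c =
        {y | μ (Prod.mk y ⁻¹' {z : β × α | c < F z.2 z.1}) = 0} := by
      ext y
      rw [Set.mem_preimage, Set.mem_Iic, eLpNorm_top_le_iff, ae_iff]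
      simp
    rw [this]
    exact (measurable_measure_prodMk_left (measurableSet_lt measurable_const hF'))
      (measurableSet_singleton 0)
  · simp_rw [eLpNorm_ennreal_eq_lintegral hp0 hp]
    exact (Measurable.lintegral_prod_right (hF'.pow_const _)).pow_const _

/-- **Minkowski's integral inequality.** -/
theorem eLpNorm_lintegral_le {μ : Measure α} {ν : Measure β} [SFinite μ] [SFinite ν]
    {h : α → β → ℝ≥0∞} (hh : Measurable (Function.uncurry h)) {p : ℝ≥0∞} (hp : 1 ≤ p) :
    eLpNorm (fun x => ∫⁻ y, h x y ∂ν) p μ ≤ ∫⁻ y, eLpNorm (fun x => h x y) p μ ∂ν := by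
  have hh' : Measurable (Function.uncurry fun y x => h x y) := hh.comp measurable_swap
  have hmeas : Measurable fun y => eLpNorm (fun x => h x y) p μ := measurable_eLpNorm_right hh p
  set m : β → ℝ≥0∞ := fun y => eLpNorm (fun x => h x y) p μ with hm
  rcases eq_or_ne p ⊤ with rfl | hpt
  · rw [eLpNorm_top_le_iff]
    have h1 : ∀ᵐ y ∂ν, ∀ᵐ x ∂μ, h x y ≤ m y :=
      Filter.Eventually.of_forall fun y => eLpNorm_top_le_iff.1 le_rfl
    have h2 : ∀ᵐ x ∂μ, ∀ᵐ y ∂ν, h x y ≤ m y := by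
      refine (Measure.ae_ae_comm (p := fun x y => h x y ≤ m y) ?_).2 h1
      exact measurableSet_le hh (hmeas.comp measurable_snd)
    filter_upwards [h2] with x hx
    exact lintegral_mono_ae hx
  have hp0 : p ≠ 0 := (zero_lt_one.trans_le hp).ne'
  set r := p.toReal with hrdef
  have hr1 : 1 ≤ r := by
    rw [hrdef, ← ENNReal.toReal_one]
    exact ENNReal.toReal_mono hpt hp
  have hr0 : 0 < r := by linarith
  rcases eq_or_ne (∫⁻ y, m y ∂ν) ⊤ with htop | htop
  · rw [htop]; exact le_top
  have hmtop : ∀ᵐ y ∂ν, m y < ⊤ := ae_lt_top hmeas htop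
  have hmpow : ∀ y, ∫⁻ x, h x y ^ r ∂μ = m y ^ r := by
    intro y
    rw [hm]
    simp only
    rw [eLpNorm_ennreal_eq_lintegral hp0 hpt, ← ENNReal.rpow_mul, one_div_mul_cancel hr0.ne',
      ENNReal.rpow_one]
  -- `h` is `m y` times its normalisation. Division in `[0,∞]` is harmless: `m` is finite almost
  -- everywhere, and where `m y = 0` the slice of `h` vanishes almost everywhere.
  have hle : ∀ᵐ x ∂μ, ∀ᵐ y ∂ν, h x y ≤ m y * (h x y / m y) := by
    refine (Measure.ae_ae_comm (p := fun x y => h x y ≤ m y * (h x y / m y)) ?_).2 ?_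
    · exact measurableSet_le hh ((hmeas.comp measurable_snd).mul
        (hh.div (hmeas.comp measurable_snd)))
    · filter_upwards [hmtop] with y hy
      rcases eq_or_ne (m y) 0 with h0 | h0
      · have := hmpow y
        rw [h0, ENNReal.zero_rpow_of_pos hr0, lintegral_eq_zero_iff (by
          exact (hh'.comp measurable_prodMk_left).pow_const r)] at this
        filter_upwards [this] with x hx
        have hx0 : h x y = 0 := by
          have : h x y ^ r = 0 := hx
          rwa [ENNReal.rpow_eq_zero_iff_of_pos hr0] at this
        rw [hx0]; exact zero_le
      · exact Filter.Eventually.of_forall fun x => (ENNReal.mul_div_cancel h0 hy.ne).ge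
  rw [eLpNorm_ennreal_eq_lintegral hp0 hpt]
  -- Jensen with weight `m`; after Tonelli there remain the integrals of the `r`-th powers of the
  -- normalised slices, each at most 1.
  have key : ∫⁻ x, (∫⁻ y, h x y ∂ν) ^ r ∂μ ≤ (∫⁻ y, m y ∂ν) ^ r := by
    calc ∫⁻ x, (∫⁻ y, h x y ∂ν) ^ r ∂μ
        ≤ ∫⁻ x, (∫⁻ y, m y ∂ν) ^ (r - 1) * ∫⁻ y, m y * (h x y / m y) ^ r ∂ν ∂μ := by
          refine lintegral_mono_ae ?_
          filter_upwards [hle] with x hx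
          refine (ENNReal.rpow_le_rpow (lintegral_mono_ae hx) hr0.le).trans ?_
          exact lintegral_mul_rpow_le hmeas.aemeasurable
            ((hh.comp measurable_prodMk_left).div hmeas).aemeasurable hr1
      _ = (∫⁻ y, m y ∂ν) ^ (r - 1) * ∫⁻ y, m y * ∫⁻ x, (h x y / m y) ^ r ∂μ ∂ν := by
          have hjm : Measurable (Function.uncurry fun x y => m y * (h x y / m y) ^ r) :=
            (hmeas.comp measurable_snd).mul ((hh.div (hmeas.comp measurable_snd)).pow_const r)
          rw [lintegral_const_mul _ (Measurable.lintegral_prod_right hjm),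
            lintegral_lintegral_swap hjm.aemeasurable]
          congr 1
          refine lintegral_congr fun y => ?_
          rw [lintegral_const_mul]
          exact ((hh'.comp measurable_prodMk_left).div_const _).pow_const r
      _ ≤ (∫⁻ y, m y ∂ν) ^ (r - 1) * ∫⁻ y, m y ∂ν := by
          gcongr with y
          have : ∫⁻ x, (h x y / m y) ^ r ∂μ ≤ 1 := by
            simp_rw [ENNReal.div_rpow_of_nonneg _ _ hr0.le, ENNReal.div_eq_inv_mul]
            have hhy : Measurable fun x => h x y ^ r := hh.of_uncurry_right.pow_const r
            rw [lintegral_const_mul _ hhy, hmpow]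
            exact ENNReal.inv_mul_le_one _
          calc m y * ∫⁻ x, (h x y / m y) ^ r ∂μ ≤ m y * 1 := by gcongr
            _ = m y := mul_one _
      _ = (∫⁻ y, m y ∂ν) ^ r := by
          conv_lhs => rw [← ENNReal.rpow_one (∫⁻ y, m y ∂ν), ← ENNReal.rpow_mul,
            ← ENNReal.rpow_add_of_nonneg _ _ (by linarith) zero_le_one]
          congr 1; ring
  calc (∫⁻ x, (∫⁻ y, h x y ∂ν) ^ r ∂μ) ^ (1 / r) ≤ ((∫⁻ y, m y ∂ν) ^ r) ^ (1 / r) :=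
        ENNReal.rpow_le_rpow key (by positivity)
    _ = ∫⁻ y, m y ∂ν := by
        rw [← ENNReal.rpow_mul, mul_one_div_cancel hr0.ne', ENNReal.rpow_one]

/-- **Schur's test.** -/
theorem eLpNorm_lintegral_kernel_le {μ : Measure α} {ν : Measure β} [SFinite μ] [SFinite ν]
    {k : α → β → ℝ≥0∞} (hk : Measurable (Function.uncurry k)) {f : β → ℝ≥0∞} (hf : Measurable f)
    {C : ℝ≥0∞} (h1 : ∀ x, ∫⁻ y, k x y ∂ν ≤ C) (h2 : ∀ y, ∫⁻ x, k x y ∂μ ≤ C)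
    {p : ℝ≥0∞} (hp : 1 ≤ p) :
    eLpNorm (fun x => ∫⁻ y, k x y * f y ∂ν) p μ ≤ C * eLpNorm f p ν := by
  rcases eq_or_ne p ⊤ with rfl | hpt
  · rw [eLpNorm_top_le_iff]
    refine Filter.Eventually.of_forall fun x => ?_
    have hfle : ∀ᵐ y ∂ν, f y ≤ eLpNorm f ⊤ ν := eLpNorm_top_le_iff.1 le_rfl
    calc ∫⁻ y, k x y * f y ∂ν ≤ ∫⁻ y, k x y * eLpNorm f ⊤ ν ∂ν := by
          refine lintegral_mono_ae ?_
          filter_upwards [hfle] with y hy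
          gcongr
      _ = (∫⁻ y, k x y ∂ν) * eLpNorm f ⊤ ν :=
          lintegral_mul_const _ (hk.comp measurable_prodMk_left)
      _ ≤ _ := by gcongr; exact h1 x
  have hp0 : p ≠ 0 := (zero_lt_one.trans_le hp).ne'
  have hr1 : 1 ≤ p.toReal := by
    rw [← ENNReal.toReal_one]
    exact ENNReal.toReal_mono hpt hp
  rw [eLpNorm_ennreal_eq_lintegral hp0 hpt, eLpNorm_ennreal_eq_lintegral hp0 hpt]
  set r := p.toReal
  have hr0 : 0 < r := by linarith
  have hjm : Measurable (Function.uncurry fun x y => k x y * f y ^ r) :=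
    hk.mul ((hf.comp measurable_snd).pow_const r)
  -- Jensen with weight `k x ·` costs `C ^ (r - 1)` by the row bound; after Tonelli the column bound
  -- supplies the last factor `C`.
  have key : ∫⁻ x, (∫⁻ y, k x y * f y ∂ν) ^ r ∂μ ≤ C ^ r * ∫⁻ y, f y ^ r ∂ν := by
    calc ∫⁻ x, (∫⁻ y, k x y * f y ∂ν) ^ r ∂μ
        ≤ ∫⁻ x, C ^ (r - 1) * ∫⁻ y, k x y * f y ^ r ∂ν ∂μ := by
          refine lintegral_mono fun x => ?_
          refine (lintegral_mul_rpow_le (hk.comp measurable_prodMk_left).aemeasurable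
            hf.aemeasurable hr1).trans ?_
          exact mul_le_mul_left (ENNReal.rpow_le_rpow (h1 x) (by linarith)) _
      _ = C ^ (r - 1) * ∫⁻ y, (∫⁻ x, k x y ∂μ) * f y ^ r ∂ν := by
          rw [lintegral_const_mul _ (Measurable.lintegral_prod_right hjm),
            lintegral_lintegral_swap hjm.aemeasurable]
          congr 1
          refine lintegral_congr fun y => ?_
          rw [lintegral_mul_const]
          exact hk.comp measurable_prodMk_right
      _ ≤ C ^ (r - 1) * (C * ∫⁻ y, f y ^ r ∂ν) := by
          gcongr
          rw [← lintegral_const_mul _ (hf.pow_const r)]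
          refine lintegral_mono fun y => ?_
          gcongr
          exact h2 y
      _ = C ^ r * ∫⁻ y, f y ^ r ∂ν := by
          rw [← mul_assoc]
          congr 1
          conv_lhs => rw [← ENNReal.rpow_one C, ← ENNReal.rpow_mul,
            ← ENNReal.rpow_add_of_nonneg _ _ (by linarith) zero_le_one]
          congr 1; ring
  calc _ ≤ (C ^ r * ∫⁻ y, f y ^ r ∂ν) ^ (1 / r) := ENNReal.rpow_le_rpow key (by positivity)
    _ = _ := by
      rw [ENNReal.mul_rpow_of_nonneg _ _ (by positivity), ← ENNReal.rpow_mul,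
        mul_one_div_cancel hr0.ne', ENNReal.rpow_one]

/-- The mixed norm `(∫ (∫ F(x,y)^p dx)^{q/p} dy)^{1/q}`. -/
def mixedNorm (μ : Measure α) (ν : Measure β) (p q : ℝ≥0∞) (F : α → β → ℝ≥0∞) : ℝ≥0∞ :=
  eLpNorm (fun y => eLpNorm (fun x => F x y) p μ) q ν

theorem mixedNorm_mono {μ : Measure α} {ν : Measure β} {p q : ℝ≥0∞} {F G : α → β → ℝ≥0∞}
    (h : ∀ x y, F x y ≤ G x y) : mixedNorm μ ν p q F ≤ mixedNorm μ ν p q G :=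
  eLpNorm_mono_ennreal fun y => eLpNorm_mono_ennreal fun x => h x y

/-- Schur's test for mixed norms. -/
theorem mixedNorm_kernel_le {μ : Measure α} {ν : Measure β} {μ' : Measure γ} {ν' : Measure δ}
    [SFinite μ] [SFinite ν] [SFinite μ'] [SFinite ν']
    {a : δ → β → ℝ≥0∞} (ha : Measurable (Function.uncurry a))
    {b : β → γ → α → ℝ≥0∞} (hb : Measurable fun z : β × γ × α => b z.1 z.2.1 z.2.2)
    {F : α → β → ℝ≥0∞} (hF : Measurable (Function.uncurry F)) {Ca Cb : ℝ≥0∞}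
    (ha1 : ∀ η', ∫⁻ η, a η' η ∂ν ≤ Ca) (ha2 : ∀ η, ∫⁻ η', a η' η ∂ν' ≤ Ca)
    (hb1 : ∀ η x', ∫⁻ x, b η x' x ∂μ ≤ Cb) (hb2 : ∀ η x, ∫⁻ x', b η x' x ∂μ' ≤ Cb)
    {p q : ℝ≥0∞} (hp : 1 ≤ p) (hq : 1 ≤ q) :
    mixedNorm μ' ν' p q (fun x' η' => ∫⁻ η, a η' η * ∫⁻ x, b η x' x * F x η ∂μ ∂ν) ≤
      Ca * Cb * mixedNorm μ ν p q F := by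
  have hN : Measurable fun η => eLpNorm (fun x => F x η) p μ := measurable_eLpNorm_right hF p
  have hbF : Measurable fun z : (γ × β) × α => b z.1.2 z.1.1 z.2 * F z.2 z.1.2 :=
    (hb.comp (f := fun z : (γ × β) × α => (z.1.2, z.1.1, z.2)) (by fun_prop)).mul
      (hF.comp (f := fun z : (γ × β) × α => (z.2, z.1.2)) (by fun_prop))
  have hB : Measurable fun z : γ × β => ∫⁻ x, b z.2 z.1 x * F x z.2 ∂μ :=
    Measurable.lintegral_prod_right (f := fun (z : γ × β) x => b z.2 z.1 x * F x z.2) hbF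
  -- Because `b` depends on `η`, Minkowski first pulls the `η`-integral out of the norm in `x'`.
  -- Schur then acts in `x` for each `η`, leaving a scalar Schur test in `η`.
  have step : ∀ η', eLpNorm (fun x' => ∫⁻ η, a η' η * ∫⁻ x, b η x' x * F x η ∂μ ∂ν) p μ' ≤
      ∫⁻ η, (a η' η * Cb) * eLpNorm (fun x => F x η) p μ ∂ν := by
    intro η'
    have ha' : Measurable fun η => a η' η := ha.comp measurable_prodMk_left
    refine (eLpNorm_lintegral_le (h := fun x' η => a η' η * ∫⁻ x, b η x' x * F x η ∂μ)
      ((ha'.comp measurable_snd).mul hB) hp).trans ?_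
    refine lintegral_mono fun η => ?_
    have hbη : Measurable (Function.uncurry fun x' x => b η x' x) :=
      hb.comp (f := fun z : γ × α => (η, z.1, z.2)) (by fun_prop)
    have hFη : Measurable fun x => F x η := hF.comp measurable_prodMk_right
    have heq : (fun x' => a η' η * ∫⁻ x, b η x' x * F x η ∂μ) =
        fun x' => ∫⁻ x, (a η' η * b η x' x) * F x η ∂μ := by
      funext x'
      rw [← lintegral_const_mul]
      · simp_rw [mul_assoc]
      · exact (hbη.comp measurable_prodMk_left).mul hFη
    rw [heq]
    refine eLpNorm_lintegral_kernel_le (k := fun x' x => a η' η * b η x' x)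
      (hbη.const_mul (a η' η)) hFη ?_ ?_ hp
    · intro x'
      rw [lintegral_const_mul _ (hbη.of_uncurry_left (x := x'))]
      gcongr
      exact hb1 η x'
    · intro x
      rw [lintegral_const_mul _ (hbη.of_uncurry_right (y := x))]
      gcongr
      exact hb2 η x
  unfold mixedNorm
  refine (eLpNorm_mono_ennreal step).trans ?_
  refine eLpNorm_lintegral_kernel_le (k := fun η' η => a η' η * Cb) (ha.mul_const _) hN ?_ ?_ hq
  · intro η'
    rw [lintegral_mul_const _ (ha.of_uncurry_left (x := η'))]
    gcongr
    exact ha1 η'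
  · intro η
    rw [lintegral_mul_const _ (ha.of_uncurry_right (y := η))]
    gcongr
    exact ha2 η

/-- Minkowski's integral inequality for mixed norms. -/
theorem mixedNorm_lintegral_le {μ : Measure α} {ν : Measure β} {κ : Measure γ}
    [SFinite μ] [SFinite ν] [SFinite κ] {h : α → β → γ → ℝ≥0∞}
    (hh : Measurable fun z : α × β × γ => h z.1 z.2.1 z.2.2)
    {p q : ℝ≥0∞} (hp : 1 ≤ p) (hq : 1 ≤ q) :
    mixedNorm μ ν p q (fun x y => ∫⁻ t, h x y t ∂κ) ≤
      ∫⁻ t, mixedNorm μ ν p q (fun x y => h x y t) ∂κ := by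
  unfold mixedNorm
  have h1 : ∀ y, eLpNorm (fun x => ∫⁻ t, h x y t ∂κ) p μ ≤
      ∫⁻ t, eLpNorm (fun x => h x y t) p μ ∂κ := fun y =>
    eLpNorm_lintegral_le (h := fun x t => h x y t)
      (hh.comp (f := fun z : α × γ => (z.1, y, z.2)) (by fun_prop)) hp
  refine (eLpNorm_mono_ennreal h1).trans ?_
  refine eLpNorm_lintegral_le (h := fun y t => eLpNorm (fun x => h x y t) p μ) ?_ hq
  exact measurable_eLpNorm_right (F := fun x (z : β × γ) => h x z.1 z.2) hh p

end MixedNorms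

/-! ### Oscillating factors, Taylor remainders and integration by parts -/

section Oscillatory

/-- The oscillating factor `e^{2πi Λ}`. -/
def osc {E : Type*} (Λ : E → ℝ) (z : E) : ℂ := Complex.exp (2 * Real.pi * Complex.I * (Λ z : ℂ))

@[simp]
theorem norm_osc {E : Type*} (Λ : E → ℝ) (z : E) : ‖osc Λ z‖ = 1 := by
  simp [osc, Complex.norm_exp]

theorem continuous_osc {E : Type*} [TopologicalSpace E] {Λ : E → ℝ} (h : Continuous Λ) : Continuous (osc Λ) := by
  unfold osc; fun_prop

variable {E : Type*} [NormedAddCommGroup E] [NormedSpace ℝ E]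

/-- The seminorm `max_{k,n ≤ M} sup_x ‖x‖^k ‖D^n f(x)‖` on the Schwartz space. -/
def schwartzNorm (M : ℕ) : Seminorm ℂ 𝓢(E, ℂ) :=
  (Finset.Iic (M, M)).sup (schwartzSeminormFamily ℂ E ℂ)

theorem one_add_pow_mul_le_schwartzNorm {M k n : ℕ} (hk : k ≤ M) (hn : n ≤ M) (f : 𝓢(E, ℂ))
    (x : E) : (1 + ‖x‖) ^ k * ‖iteratedFDeriv ℝ n f x‖ ≤ 2 ^ M * schwartzNorm M f :=
  SchwartzMap.one_add_le_sup_seminorm_apply (𝕜 := ℂ) (m := (M, M)) hk hn f x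

theorem schwartzNorm_mono {M M' : ℕ} (h : M ≤ M') (f : 𝓢(E, ℂ)) :
    schwartzNorm M f ≤ schwartzNorm M' f := by
  have : schwartzNorm (E := E) M ≤ schwartzNorm M' :=
    Finset.sup_mono (Finset.Iic_subset_Iic.2 ⟨h, h⟩)
  exact this f

theorem schwartzNorm_nonneg (M : ℕ) (f : 𝓢(E, ℂ)) : 0 ≤ schwartzNorm M f := apply_nonneg _ _

theorem seminorm_le_schwartzNorm {M k n : ℕ} (hk : k ≤ M) (hn : n ≤ M) (f : 𝓢(E, ℂ)) :
    SchwartzMap.seminorm ℂ k n f ≤ schwartzNorm M f := by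
  have : schwartzSeminormFamily ℂ E ℂ (k, n) ≤ schwartzNorm (E := E) M :=
    Finset.le_sup (f := schwartzSeminormFamily ℂ E ℂ) (Finset.mem_Iic.2 ⟨hk, hn⟩)
  exact this f

theorem schwartzNorm_le {M : ℕ} {f : 𝓢(E, ℂ)} {C : ℝ} (hC : 0 ≤ C)
    (h : ∀ k ≤ M, ∀ n ≤ M, ∀ x, ‖x‖ ^ k * ‖iteratedFDeriv ℝ n f x‖ ≤ C) : schwartzNorm M f ≤ C := by
  refine Seminorm.finset_sup_apply_le hC fun i hi => ?_
  obtain ⟨h1, h2⟩ := Finset.mem_Iic.1 hi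
  exact SchwartzMap.seminorm_le_bound ℂ i.1 i.2 f hC (h _ h1 _ h2)

theorem continuous_schwartzNorm (M : ℕ) : Continuous (schwartzNorm (E := E) M) := by
  refine Seminorm.continuous (r := 1) ?_
  have hw := schwartz_withSeminorms ℂ E ℂ
  exact hw.mem_nhds_iff _ _ |>.2 ⟨Finset.Iic (M, M), 1, one_pos, subset_rfl⟩

theorem iteratedDeriv_exp_mul_I (c : ℂ) (n : ℕ) :
    iteratedDeriv n (fun u : ℝ => Complex.exp (c * (u : ℂ))) =
      fun u : ℝ => c ^ n * Complex.exp (c * (u : ℂ)) := by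
  induction n with
  | zero => simp
  | succ n ih =>
    rw [iteratedDeriv_succ, ih]
    funext u
    have h1 : HasDerivAt (fun u : ℝ => c * (u : ℂ)) c u := by
      simpa using (Complex.ofRealCLM.hasDerivAt (x := u)).const_mul c
    rw [((h1.cexp).const_mul (c ^ n)).deriv]
    ring

theorem contDiff_osc {Λ : E → ℝ} (h : ContDiff ℝ ∞ Λ) : ContDiff ℝ ∞ (osc Λ) :=
  Complex.contDiff_exp.comp (contDiff_const.mul (Complex.ofRealCLM.contDiff.comp h))

/-- Faà di Bruno's bound, where all derivatives of `u ↦ e^{2πiu}` up to order `n` are at most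
`(2π)^n`. -/
theorem norm_iteratedFDeriv_osc_le {Λ : E → ℝ} (h : ContDiff ℝ ∞ Λ) {n : ℕ} {z : E} {D : ℝ}
    (hD : ∀ i, 1 ≤ i → i ≤ n → ‖iteratedFDeriv ℝ i Λ z‖ ≤ D ^ i) :
    ‖iteratedFDeriv ℝ n (osc Λ) z‖ ≤ n.factorial * (2 * Real.pi) ^ n * D ^ n := by
  refine norm_iteratedFDeriv_comp_le (N := ∞)
    (g := fun u : ℝ => Complex.exp (2 * Real.pi * Complex.I * (u : ℂ))) (f := Λ) ?_ h
    (by exact_mod_cast le_top) z ?_ hD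
  · exact Complex.contDiff_exp.comp (contDiff_const.mul Complex.ofRealCLM.contDiff)
  · intro i hi
    rw [norm_iteratedFDeriv_eq_norm_iteratedDeriv, iteratedDeriv_exp_mul_I]
    have h1 : (1 : ℝ) ≤ 2 * Real.pi := by linarith [Real.pi_gt_three]
    have h2 : ‖Complex.exp (2 * Real.pi * Complex.I * (Λ z : ℂ))‖ = 1 := norm_osc Λ z
    have h3 : ‖(2 * Real.pi * Complex.I : ℂ)‖ = 2 * Real.pi := by
      simp [abs_of_pos Real.pi_pos]
    rw [norm_mul, h2, mul_one, norm_pow, h3]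
    exact pow_le_pow_right₀ h1 hi

theorem hasTemperateGrowth_osc {Λ : E → ℝ} (h : ContDiff ℝ ∞ Λ) {B : ℕ → ℝ}
    (hB : ∀ n, 1 ≤ n → ∀ z, ‖iteratedFDeriv ℝ n Λ z‖ ≤ B n * (1 + ‖z‖)) :
    Function.HasTemperateGrowth (osc Λ) := by
  refine ⟨contDiff_osc h, fun n => ?_⟩
  set b : ℝ := 1 + ∑ i ∈ Finset.range (n + 1), |B i| with hb
  have hb1 : 1 ≤ b := by
    have : 0 ≤ ∑ i ∈ Finset.range (n + 1), |B i| := Finset.sum_nonneg fun _ _ => abs_nonneg _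
    linarith
  refine ⟨n, n.factorial * (2 * Real.pi) ^ n * b ^ n, fun z => ?_⟩
  have := norm_iteratedFDeriv_osc_le (n := n) (z := z) h (D := b * (1 + ‖z‖)) (by
    intro i hi hin
    have h1 : 1 ≤ b * (1 + ‖z‖) := by nlinarith [norm_nonneg z]
    have hBi : B i ≤ b := by
      have := Finset.single_le_sum (f := fun i => |B i|) (fun _ _ => abs_nonneg _)
        (Finset.mem_range.2 (Nat.lt_succ_of_le hin))
      have h2 := le_abs_self (B i)
      linarith
    calc _ ≤ B i * (1 + ‖z‖) := hB i hi z
      _ ≤ b * (1 + ‖z‖) := by gcongr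
      _ ≤ (b * (1 + ‖z‖)) ^ i := le_self_pow₀ h1 (by omega))
  rwa [mul_pow b, ← mul_assoc] at this

theorem hasTemperateGrowth_osc_clm (ℓ : E →L[ℝ] ℝ) :
    Function.HasTemperateGrowth (osc fun z => ℓ z) :=
  (hasTemperateGrowth_exp_mul_I (2 * Real.pi * Complex.I) (by simp)).comp ℓ.hasTemperateGrowth

/-- The `n`-fold derivative of a Schwartz function in a fixed direction. -/
abbrev dirDeriv (u : E) (n : ℕ) (φ : 𝓢(E, ℂ)) : 𝓢(E, ℂ) := ∂^{fun _ : Fin n => u} φ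

theorem dirDeriv_succ (u : E) (n : ℕ) (φ : 𝓢(E, ℂ)) :
    dirDeriv u (n + 1) φ = dirDeriv u n (∂_{u} φ) :=
  LineDeriv.iteratedLineDerivOp_succ_right _ _

/-- The product rule produces the factor `ℓ u`; solved for that factor it is the integration by
parts identity behind all the decay estimates. -/
theorem lineDeriv_osc_smul (ℓ : E →L[ℝ] ℝ) (u : E) (ψ : 𝓢(E, ℂ)) :
    ∂_{u} (SchwartzMap.smulLeftCLM ℂ (osc fun z => ℓ z) ψ) =
      SchwartzMap.smulLeftCLM ℂ (osc fun z => ℓ z) (∂_{u} ψ) +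
        (2 * Real.pi * Complex.I * (ℓ u : ℂ)) •
          SchwartzMap.smulLeftCLM ℂ (osc fun z => ℓ z) ψ := by
  ext z
  have h1 : HasFDerivAt (osc fun z => ℓ z) (osc (fun z => ℓ z) z •
      ((2 * Real.pi * Complex.I) • (Complex.ofRealCLM.comp ℓ))) z := by
    have := ((Complex.ofRealCLM.comp ℓ).hasFDerivAt (x := z)).const_mul (2 * Real.pi * Complex.I)
    exact this.cexp
  have h2 : HasFDerivAt (fun z => osc (fun z => ℓ z) z * ψ z) _ z := h1.mul (ψ.hasFDerivAt z)
  have h3 : (⇑(SchwartzMap.smulLeftCLM ℂ (osc fun z => ℓ z) ψ)) =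
      fun z => osc (fun z => ℓ z) z * ψ z := by
    rw [SchwartzMap.smulLeftCLM_apply (hasTemperateGrowth_osc_clm ℓ)]
    rfl
  rw [SchwartzMap.lineDerivOp_apply_eq_fderiv, h3]
  rw [HasFDerivAt.fderiv h2]
  simp [SchwartzMap.smulLeftCLM_apply_apply (hasTemperateGrowth_osc_clm ℓ),
    SchwartzMap.lineDerivOp_apply_eq_fderiv]
  ring

/-- Integration by parts against a functional all of whose derivatives up to order `K` in the
direction `u` are bounded in the `L¹` norm. -/
theorem pow_mul_norm_le_of_dirDeriv [MeasurableSpace E] {μ : Measure E} {L : 𝓢(E, ℂ) →ₗ[ℂ] ℂ}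
    {u : E} {C : ℝ} {K : ℕ} (hC : 0 ≤ C)
    (hL : ∀ k ≤ K, ∀ φ, ‖L (dirDeriv u k φ)‖ ≤ C * ∫ z, ‖φ z‖ ∂μ) (ℓ : E →L[ℝ] ℝ) (n : ℕ) :
    ∀ k, n + k ≤ K → ∀ (ψ : 𝓢(E, ℂ)) (D : ℝ), (∀ j ≤ n, ∫ z, ‖dirDeriv u j ψ z‖ ∂μ ≤ D) →
      |ℓ u| ^ n * ‖L (dirDeriv u k (SchwartzMap.smulLeftCLM ℂ (osc fun z => ℓ z) ψ))‖ ≤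
        C * 2 ^ n * D := by
  induction n with
  | zero =>
    intro k hk ψ D hD
    have h0 := hD 0 le_rfl
    simp only [dirDeriv, LineDeriv.iteratedLineDerivOp_fin_zero] at h0
    rw [pow_zero, one_mul, pow_zero, mul_one]
    refine (hL k (by omega) _).trans ?_
    gcongr
    refine le_of_eq_of_le ?_ h0
    congr 1
    funext z
    rw [SchwartzMap.smulLeftCLM_apply_apply (hasTemperateGrowth_osc_clm ℓ), norm_smul, norm_osc,
      one_mul]
  | succ n ih =>
    intro k hk ψ D hD
    set e := SchwartzMap.smulLeftCLM ℂ (osc fun z => ℓ z) with he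
    -- One power of `ℓ u` is traded for a derivative, either of the whole product, which `L` absorbs
    -- as `k` grows, or of `ψ` alone. Two terms in each of `n` rounds give `2 ^ n`; the surplus `2π
    -- ≥ 1` is dropped.
    have key : (2 * Real.pi * Complex.I * (ℓ u : ℂ)) • dirDeriv u k (e ψ) =
        dirDeriv u (k + 1) (e ψ) - dirDeriv u k (e (∂_{u} ψ)) := by
      rw [dirDeriv_succ, lineDeriv_osc_smul]
      simp only [dirDeriv, LineDeriv.iteratedLineDerivOp_add,
        LineDeriv.iteratedLineDerivOp_smul]
      abel
    have h1 := ih (k + 1) (by omega) ψ D fun j hj => hD j (by omega)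
    have h2 := ih k (by omega) (∂_{u} ψ) D fun j hj => by
      have := hD (j + 1) (by omega)
      rwa [dirDeriv_succ] at this
    have h3 : 2 * Real.pi * |ℓ u| * ‖L (dirDeriv u k (e ψ))‖ ≤
        ‖L (dirDeriv u (k + 1) (e ψ))‖ + ‖L (dirDeriv u k (e (∂_{u} ψ)))‖ := by
      have h4 := congrArg L key
      rw [map_smul, map_sub] at h4
      have h5 := congrArg norm h4
      rw [norm_smul] at h5
      have h6 : ‖(2 * Real.pi * Complex.I * (ℓ u : ℂ))‖ = 2 * Real.pi * |ℓ u| := by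
        simp [abs_of_pos Real.pi_pos]
      rw [h6] at h5
      rw [h5]
      exact norm_sub_le _ _
    have hpi : (1 : ℝ) ≤ 2 * Real.pi := by linarith [Real.pi_gt_three]
    have h7 : |ℓ u| * ‖L (dirDeriv u k (e ψ))‖ ≤
        ‖L (dirDeriv u (k + 1) (e ψ))‖ + ‖L (dirDeriv u k (e (∂_{u} ψ)))‖ := by
      refine le_trans ?_ h3
      have : 0 ≤ |ℓ u| * ‖L (dirDeriv u k (e ψ))‖ := by positivity
      nlinarith
    calc |ℓ u| ^ (n + 1) * ‖L (dirDeriv u k (e ψ))‖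
        = |ℓ u| ^ n * (|ℓ u| * ‖L (dirDeriv u k (e ψ))‖) := by ring
      _ ≤ |ℓ u| ^ n * (‖L (dirDeriv u (k + 1) (e ψ))‖ + ‖L (dirDeriv u k (e (∂_{u} ψ)))‖) := by
          gcongr
      _ ≤ C * 2 ^ n * D + C * 2 ^ n * D := by rw [mul_add]; exact add_le_add h1 h2
      _ = C * 2 ^ (n + 1) * D := by ring

/-- The second order Taylor remainder `Φ(z + z₀) - Φ(z₀) - DΦ(z₀) z`. -/
def taylorRemainder (Φ : E → ℝ) (z₀ z : E) : ℝ := Φ (z + z₀) - Φ z₀ - fderiv ℝ Φ z₀ z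

theorem contDiff_taylorRemainder {Φ : E → ℝ} (h : ContDiff ℝ ∞ Φ) (z₀ : E) :
    ContDiff ℝ ∞ (taylorRemainder Φ z₀) := by
  unfold taylorRemainder
  exact ((h.comp (contDiff_id.add contDiff_const)).sub contDiff_const).sub
    (fderiv ℝ Φ z₀).contDiff

theorem fderiv_taylorRemainder {Φ : E → ℝ} (h : ContDiff ℝ ∞ Φ) (z₀ : E) :
    fderiv ℝ (taylorRemainder Φ z₀) = fun z => fderiv ℝ Φ (z + z₀) - fderiv ℝ Φ z₀ := by
  funext z
  have hd : Differentiable ℝ Φ := h.differentiable (by simp)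
  have h1 : HasFDerivAt (fun z => Φ (z + z₀)) (fderiv ℝ Φ (z + z₀)) z :=
    (hasFDerivAt_comp_add_right z₀).2 (hd (z + z₀)).hasFDerivAt
  exact ((h1.sub_const (Φ z₀)).sub (fderiv ℝ Φ z₀).hasFDerivAt).fderiv

theorem norm_fderiv_sub_le {Φ : E → ℝ} (h : ContDiff ℝ ∞ Φ) {B : ℝ}
    (hB : ∀ z, ‖iteratedFDeriv ℝ 2 Φ z‖ ≤ B) (z w : E) :
    ‖fderiv ℝ Φ z - fderiv ℝ Φ w‖ ≤ B * ‖z - w‖ := by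
  have hd : Differentiable ℝ (fderiv ℝ Φ) :=
    (h.fderiv_right (m := ∞) (by simp)).differentiable (by simp)
  refine convex_univ.norm_image_sub_le_of_norm_fderiv_le (𝕜 := ℝ) (fun x _ => hd x)
    (fun x _ => ?_) (Set.mem_univ w) (Set.mem_univ z)
  rw [← norm_iteratedFDeriv_one, norm_iteratedFDeriv_fderiv]
  exact hB x

/-- The first derivative of the remainder is DΦ(z + z₀) - DΦ(z₀), controlled by the second
derivatives of `Φ`; the higher ones are translates of those of `Φ`. Nothing depends on `z₀`,
although DΦ itself may be unbounded. -/
theorem norm_iteratedFDeriv_taylorRemainder_le {Φ : E → ℝ} (h : ContDiff ℝ ∞ Φ) {B : ℝ} {n : ℕ}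
    (hB : ∀ i, 2 ≤ i → i ≤ n + 2 → ∀ z, ‖iteratedFDeriv ℝ i Φ z‖ ≤ B) (z₀ z : E) (i : ℕ)
    (hi : 1 ≤ i) (hin : i ≤ n) :
    ‖iteratedFDeriv ℝ i (taylorRemainder Φ z₀) z‖ ≤ B * (1 + ‖z‖) := by
  have hB0 : 0 ≤ B := (norm_nonneg _).trans (hB 2 le_rfl (by omega) 0)
  rcases Nat.exists_eq_add_of_le' hi with ⟨j, rfl⟩
  rw [← norm_iteratedFDeriv_fderiv, fderiv_taylorRemainder h]
  rcases j with _ | j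
  · rw [norm_iteratedFDeriv_zero]
    refine (norm_fderiv_sub_le h (hB 2 le_rfl (by omega)) _ _).trans ?_
    rw [add_sub_cancel_right]
    gcongr
    linarith
  · have h1 : fderiv ℝ (fun z => fderiv ℝ Φ (z + z₀) - fderiv ℝ Φ z₀) =
        fun z => fderiv ℝ (fderiv ℝ Φ) (z + z₀) := by
      funext z
      rw [fderiv_sub_const, fderiv_comp_add_right]
    rw [← norm_iteratedFDeriv_fderiv, h1, iteratedFDeriv_comp_add_right,
      norm_iteratedFDeriv_fderiv, norm_iteratedFDeriv_fderiv]
    refine (hB _ (by omega) (by omega) _).trans ?_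
    nlinarith [norm_nonneg z]

theorem hasTemperateGrowth_osc_taylorRemainder {Φ : E → ℝ} (h : ContDiff ℝ ∞ Φ)
    (hB : ∀ n : ℕ, 2 ≤ n → ∃ C : ℝ, ∀ z, ‖iteratedFDeriv ℝ n Φ z‖ ≤ C) (z₀ : E) :
    Function.HasTemperateGrowth (osc (taylorRemainder Φ z₀)) := by
  have hex : ∀ n, ∃ C : ℝ, ∀ i, 2 ≤ i → i ≤ n + 2 → ∀ z, ‖iteratedFDeriv ℝ i Φ z‖ ≤ C := by
    intro n
    choose! C hC using hB
    refine ⟨∑ i ∈ Finset.range (n + 3), |C i|, fun i h2 hi z => (hC i h2 z).trans ?_⟩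
    exact (le_abs_self _).trans (Finset.single_le_sum (f := fun i => |C i|)
      (fun _ _ => abs_nonneg _) (Finset.mem_range.2 (by omega)))
  choose B hB' using hex
  exact hasTemperateGrowth_osc (contDiff_taylorRemainder h z₀) (B := B) fun n hn z =>
    norm_iteratedFDeriv_taylorRemainder_le h (hB' n) z₀ z n hn le_rfl

/-- Uniform bounds for the derivatives of `e^{2πi R} Θ`, where `R` is a Taylor remainder. -/
theorem exists_norm_iteratedFDeriv_osc_mul_le {Φ : E → ℝ} (h : ContDiff ℝ ∞ Φ)
    (hB : ∀ n : ℕ, 2 ≤ n → ∃ C : ℝ, ∀ z, ‖iteratedFDeriv ℝ n Φ z‖ ≤ C) (K r : ℕ) :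
    ∃ C : ℝ, 0 ≤ C ∧ ∃ M : ℕ, ∀ (z₀ : E) (Θ : 𝓢(E, ℂ)) (n : ℕ), n ≤ K → ∀ z,
      ‖iteratedFDeriv ℝ n
        (SchwartzMap.smulLeftCLM ℂ (osc (taylorRemainder Φ z₀)) Θ) z‖ ≤
        C * schwartzNorm M Θ * ((1 + ‖z‖) ^ r)⁻¹ := by
  obtain ⟨B, hB1, hB'⟩ : ∃ B : ℝ, 1 ≤ B ∧
      ∀ i, 2 ≤ i → i ≤ K + 2 → ∀ z, ‖iteratedFDeriv ℝ i Φ z‖ ≤ B := by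
    choose! C hC using hB
    refine ⟨1 + ∑ i ∈ Finset.range (K + 3), |C i|, ?_, fun i h2 hi z => (hC i h2 z).trans ?_⟩
    · have : 0 ≤ ∑ i ∈ Finset.range (K + 3), |C i| := Finset.sum_nonneg fun _ _ => abs_nonneg _
      linarith
    · have := (le_abs_self _).trans (Finset.single_le_sum (f := fun i => |C i|)
        (fun _ _ => abs_nonneg _) (Finset.mem_range.2 (by omega : i < K + 3)))
      linarith
  -- `K` powers of `1 + ‖z‖` offset the growth of the derivatives of the oscillating factor, and `r`
  -- more give the decay.
  set M := K + r
  set A : ℝ := K.factorial * (2 * Real.pi) ^ K * B ^ K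
  have hpi : (1 : ℝ) ≤ 2 * Real.pi := by linarith [Real.pi_gt_three]
  refine ⟨2 ^ K * A * 2 ^ M, by positivity, M, fun z₀ Θ n hn z => ?_⟩
  have htg := hasTemperateGrowth_osc_taylorRemainder h hB z₀
  have hosc : ∀ i ≤ n, ‖iteratedFDeriv ℝ i (osc (taylorRemainder Φ z₀)) z‖ ≤
      A * (1 + ‖z‖) ^ K := by
    intro i hi
    have h1 := norm_iteratedFDeriv_osc_le (n := i) (z := z) (contDiff_taylorRemainder h z₀)
      (D := B * (1 + ‖z‖)) (by
        intro j hj hji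
        refine (norm_iteratedFDeriv_taylorRemainder_le (n := K) h hB' z₀ z j hj (by omega)).trans ?_
        exact le_self_pow₀ (by nlinarith [norm_nonneg z]) (by omega))
    refine h1.trans ?_
    rw [mul_pow B, ← mul_assoc]
    have hiK : i ≤ K := hi.trans hn
    have : (1 : ℝ) ≤ 1 + ‖z‖ := by linarith [norm_nonneg z]
    simp only [A]
    gcongr
  have hΘ : ∀ i ≤ n, (1 + ‖z‖) ^ K * ‖iteratedFDeriv ℝ i Θ z‖ ≤
      2 ^ M * schwartzNorm M Θ * ((1 + ‖z‖) ^ r)⁻¹ := by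
    intro i hi
    have h1 := one_add_pow_mul_le_schwartzNorm (M := M) (k := K + r) (n := i) le_rfl
      (by omega) Θ z
    rw [le_mul_inv_iff₀ (by positivity)]
    calc _ = (1 + ‖z‖) ^ (K + r) * ‖iteratedFDeriv ℝ i Θ z‖ := by rw [pow_add]; ring
      _ ≤ _ := h1
  rw [SchwartzMap.smulLeftCLM_apply htg]
  have hmul := norm_iteratedFDeriv_mul_le (𝕜 := ℝ) (N := ∞) htg.1 (Θ.smooth ⊤) z (n := n)
    (by exact_mod_cast le_top)
  refine (show ‖iteratedFDeriv ℝ n (fun x => osc (taylorRemainder Φ z₀) x • Θ x) z‖ ≤ _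
    from hmul).trans ?_
  calc _ ≤ ∑ i ∈ Finset.range (n + 1), (n.choose i : ℝ) *
        (A * (2 ^ M * schwartzNorm M Θ * ((1 + ‖z‖) ^ r)⁻¹)) := by
        refine Finset.sum_le_sum fun i hi => ?_
        rw [mul_assoc]
        refine mul_le_mul_of_nonneg_left ?_ (by positivity)
        have hi' : i ≤ n := by simpa [Nat.lt_succ_iff] using hi
        calc _ ≤ A * (1 + ‖z‖) ^ K * ‖iteratedFDeriv ℝ (n - i) Θ z‖ := by
              gcongr; exact hosc i hi'
          _ = A * ((1 + ‖z‖) ^ K * ‖iteratedFDeriv ℝ (n - i) Θ z‖) := by ring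
          _ ≤ _ := mul_le_mul_of_nonneg_left (hΘ (n - i) (by omega)) (by positivity)
    _ = 2 ^ n * (A * (2 ^ M * schwartzNorm M Θ * ((1 + ‖z‖) ^ r)⁻¹)) := by
        rw [← Finset.sum_mul]
        norm_cast
        rw [Nat.sum_range_choose]
    _ ≤ 2 ^ K * (A * (2 ^ M * schwartzNorm M Θ * ((1 + ‖z‖) ^ r)⁻¹)) := by
        have := schwartzNorm_nonneg M Θ
        gcongr
        norm_num
    _ = _ := by ring

end Oscillatory

/-! ### Decay of oscillatory integrals, uniformly in the base point -/

section OscillatoryIntegral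

variable {E : Type*} [NormedAddCommGroup E] [NormedSpace ℝ E] [FiniteDimensional ℝ E]
  [MeasurableSpace E] [BorelSpace E]

/-- The Schwartz function `e^{2πi(Φ(z) - ℓ(z))} Θ(z - z₀)`, up to a unimodular constant. -/
def wavePacket (Φ : E → ℝ) (ℓ : E →L[ℝ] ℝ) (z₀ : E) (Θ : 𝓢(E, ℂ)) : 𝓢(E, ℂ) :=
  SchwartzMap.smulLeftCLM ℂ (osc fun z => (fderiv ℝ Φ z₀ - ℓ) z)
    (SchwartzMap.compSubConstCLM ℂ z₀
      (SchwartzMap.smulLeftCLM ℂ (osc (taylorRemainder Φ z₀)) Θ))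

-- The phase `Φ - ℓ` splits into a constant, the linear form DΦ(z₀) - ℓ and the Taylor remainder at
-- `z - z₀`. The linear form is the frequency used in integration by parts; the remainder becomes
-- part of the amplitude.
omit [FiniteDimensional ℝ E] [MeasurableSpace E] [BorelSpace E] in
theorem osc_sub_mul_eq_wavePacket {Φ : E → ℝ} (h : ContDiff ℝ ∞ Φ)
    (hB : ∀ n : ℕ, 2 ≤ n → ∃ C : ℝ, ∀ z, ‖iteratedFDeriv ℝ n Φ z‖ ≤ C)
    (ℓ : E →L[ℝ] ℝ) (z₀ : E) (Θ : 𝓢(E, ℂ)) (z : E) :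
    osc (fun z => Φ z - ℓ z) z * Θ (z - z₀) =
      osc (fun _ : E => Φ z₀ - fderiv ℝ Φ z₀ z₀) z₀ * wavePacket Φ ℓ z₀ Θ z := by
  rw [wavePacket, SchwartzMap.smulLeftCLM_apply_apply (hasTemperateGrowth_osc_clm _),
    SchwartzMap.compSubConstCLM_apply,
    SchwartzMap.smulLeftCLM_apply_apply (hasTemperateGrowth_osc_taylorRemainder h hB z₀),
    smul_eq_mul, smul_eq_mul, ← mul_assoc, ← mul_assoc]
  congr 1
  simp only [osc, ← Complex.exp_add, taylorRemainder, map_sub, sub_apply,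
    sub_add_cancel]
  congr 1
  push_cast
  ring

/-- Translation invariance of the measure removes `z₀`, and `dim E + 1` powers of decay make the
majorant integrable. -/
theorem exists_integral_dirDeriv_le {μ : Measure E} [μ.IsAddHaarMeasure] {Φ : E → ℝ}
    (h : ContDiff ℝ ∞ Φ)
    (hB : ∀ n : ℕ, 2 ≤ n → ∃ C : ℝ, ∀ z, ‖iteratedFDeriv ℝ n Φ z‖ ≤ C) (K : ℕ) :
    ∃ C : ℝ, 0 ≤ C ∧ ∃ M : ℕ, ∀ (z₀ : E) (Θ : 𝓢(E, ℂ)) (u : E) (n : ℕ), ‖u‖ ≤ 1 → n ≤ K →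
      ∫ z, ‖dirDeriv u n (SchwartzMap.compSubConstCLM ℂ z₀
        (SchwartzMap.smulLeftCLM ℂ (osc (taylorRemainder Φ z₀)) Θ)) z‖ ∂μ ≤
        C * schwartzNorm M Θ := by
  set r := Module.finrank ℝ E + 1
  obtain ⟨C, hC, M, hM⟩ := exists_norm_iteratedFDeriv_osc_mul_le h hB K r
  have hint : Integrable (fun x : E => ((1 + ‖x‖) ^ r)⁻¹) μ := by
    have := integrable_one_add_norm (E := E) (μ := μ) (r := r) (by simp [r])
    refine this.congr (Filter.Eventually.of_forall fun x => ?_)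
    simp only
    rw [Real.rpow_neg (by positivity), Real.rpow_natCast]
  refine ⟨C * ∫ x : E, ((1 + ‖x‖) ^ r)⁻¹ ∂μ, by positivity, M, fun z₀ Θ u n hu hn => ?_⟩
  set ψ := SchwartzMap.smulLeftCLM ℂ (osc (taylorRemainder Φ z₀)) Θ with hψ
  have hpt : ∀ z, ‖dirDeriv u n (SchwartzMap.compSubConstCLM ℂ z₀ ψ) z‖ ≤
      C * schwartzNorm M Θ * ((1 + ‖z - z₀‖) ^ r)⁻¹ := by
    intro z
    rw [dirDeriv, SchwartzMap.iteratedLineDerivOp_eq_iteratedFDeriv]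
    have h1 : (⇑(SchwartzMap.compSubConstCLM ℂ z₀ ψ)) = fun z => ψ (z - z₀) := by
      funext z; exact SchwartzMap.compSubConstCLM_apply _ _ _
    rw [h1, iteratedFDeriv_comp_sub]
    refine (ContinuousMultilinearMap.le_opNorm _ _).trans ?_
    have h2 : ∏ _i : Fin n, ‖u‖ ≤ 1 := Finset.prod_le_one (fun _ _ => norm_nonneg _) fun _ _ => hu
    calc _ ≤ ‖iteratedFDeriv ℝ n ψ (z - z₀)‖ * 1 := by gcongr
      _ ≤ _ := by rw [mul_one]; exact hM z₀ Θ n hn _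
  calc _ ≤ ∫ z, C * schwartzNorm M Θ * ((1 + ‖z - z₀‖) ^ r)⁻¹ ∂μ := by
        refine integral_mono (SchwartzMap.integrable _).norm ?_ hpt
        exact (hint.comp_sub_right z₀).const_mul _
    _ = _ := by
        rw [integral_const_mul, integral_sub_right_eq_self (fun z : E => ((1 + ‖z‖) ^ r)⁻¹) z₀]
        ring

/-- Decay of oscillatory integrals against symbol-like functionals, uniformly in the base point. -/
theorem exists_oscillatory_bound {μ : Measure E} [μ.IsAddHaarMeasure] {Φ : E → ℝ}
    (h : ContDiff ℝ ∞ Φ)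
    (hB : ∀ n : ℕ, 2 ≤ n → ∃ C : ℝ, ∀ z, ‖iteratedFDeriv ℝ n Φ z‖ ≤ C) {K : ℕ}
    {L : 𝓢(E, ℂ) →ₗ[ℂ] ℂ} {s : Set E} {C₀ : ℝ} (hC₀ : 0 ≤ C₀) (hs : ∀ u ∈ s, ‖u‖ ≤ 1)
    (hL : ∀ u ∈ s, ∀ k ≤ K, ∀ φ, ‖L (dirDeriv u k φ)‖ ≤ C₀ * ∫ z, ‖φ z‖ ∂μ) :
    ∃ C : ℝ, 0 ≤ C ∧ ∃ M : ℕ, ∀ (z₀ : E) (ℓ : E →L[ℝ] ℝ) (Θ : 𝓢(E, ℂ)), ∀ u ∈ s,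
      (1 + |(fderiv ℝ Φ z₀ - ℓ) u|) ^ K * ‖L (wavePacket Φ ℓ z₀ Θ)‖ ≤ C * schwartzNorm M Θ := by
  obtain ⟨C, hC, M, hM⟩ := exists_integral_dirDeriv_le (μ := μ) h hB K
  refine ⟨2 ^ K * (C₀ * C + C₀ * 2 ^ K * C), by positivity, M, fun z₀ ℓ Θ u hu => ?_⟩
  have key : ∀ n ≤ K, |(fderiv ℝ Φ z₀ - ℓ) u| ^ n * ‖L (wavePacket Φ ℓ z₀ Θ)‖ ≤
      C₀ * 2 ^ n * (C * schwartzNorm M Θ) := by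
    intro n hn
    have := pow_mul_norm_le_of_dirDeriv hC₀ (hL u hu) (fderiv ℝ Φ z₀ - ℓ) n 0 (by omega) _ _
      fun j hj => hM z₀ Θ u j (hs u hu) (by omega)
    simpa only [dirDeriv, LineDeriv.iteratedLineDerivOp_fin_zero, wavePacket] using this
  have h0 := key 0 (Nat.zero_le _)
  have hK := key K le_rfl
  rw [pow_zero, one_mul, pow_zero, mul_one] at h0
  set a := |(fderiv ℝ Φ z₀ - ℓ) u|
  have ha : 0 ≤ a := abs_nonneg _
  -- Only the exponents 0 and `K` are needed to recover the full weight.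
  have h1 : (1 + a) ^ K ≤ 2 ^ K * (1 + a ^ K) := by
    calc (1 + a) ^ K ≤ (2 * max 1 a) ^ K := by
          gcongr
          have := le_max_left 1 a
          have := le_max_right 1 a
          linarith
      _ = 2 ^ K * (max 1 a) ^ K := mul_pow _ _ _
      _ ≤ _ := by
          gcongr
          rcases le_total a 1 with h | h
          · rw [max_eq_left h, one_pow]; have := pow_nonneg ha K; linarith
          · rw [max_eq_right h]; linarith
  calc _ ≤ 2 ^ K * (1 + a ^ K) * ‖L (wavePacket Φ ℓ z₀ Θ)‖ := by gcongr
    _ = 2 ^ K * (‖L (wavePacket Φ ℓ z₀ Θ)‖ + a ^ K * ‖L (wavePacket Φ ℓ z₀ Θ)‖) := by ring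
    _ ≤ 2 ^ K * (C₀ * (C * schwartzNorm M Θ) + C₀ * 2 ^ K * (C * schwartzNorm M Θ)) := by
        gcongr
    _ = _ := by ring

end OscillatoryIntegral

/-! ### Symbols as functionals on the Schwartz space -/

section Symbols

variable {d : ℕ}

theorem dirDeriv_temperedDistribution_apply {E : Type*} [NormedAddCommGroup E] [NormedSpace ℝ E]
    (u : E) (n : ℕ) (T : 𝓢'(E, ℂ)) (φ : 𝓢(E, ℂ)) :
    (∂^{fun _ : Fin n => u} T) φ = (-1) ^ n * T (dirDeriv u n φ) := by
  induction n generalizing φ with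
  | zero => simp [dirDeriv]
  | succ n ih =>
    rw [LineDeriv.iteratedLineDerivOp_succ_left, TemperedDistribution.lineDerivOp_apply_apply,
      dirDeriv_succ, map_neg]
    have := ih (∂_{u} φ)
    rw [show Fin.tail (fun _ : Fin (n + 1) => u) = fun _ : Fin n => u from rfl, this]
    ring

theorem norm_integral_mul_le_of_memLp_top {E : Type*} [MeasurableSpace E] {μ : Measure E}
    {τ : E → ℂ} (hτ : MemLp τ ⊤ μ) {φ : E → ℂ} (hφ : Integrable φ μ) :
    ‖∫ z, φ z * τ z ∂μ‖ ≤ (eLpNorm τ ⊤ μ).toReal * ∫ z, ‖φ z‖ ∂μ := by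
  rw [← integral_const_mul]
  refine norm_integral_le_of_norm_le (hφ.norm.const_mul _) ?_
  have hle := ae_le_eLpNormEssSup (f := τ) (μ := μ)
  filter_upwards [hle] with z hz
  rw [norm_mul, mul_comm]
  gcongr
  rw [← toReal_enorm]
  exact ENNReal.toReal_mono hτ.2.ne (by rwa [eLpNorm_exponent_top])

/-- The functional `φ ↦ ∫ σ φ` on the Schwartz space. -/
def symbolFunctional {σ : Eu d × Eu d → ℂ} (hσ : MemLp σ ⊤ (volume : Measure (Eu d × Eu d))) :
    𝓢(Eu d × Eu d, ℂ) →ₗ[ℂ] ℂ :=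
  (Lp.toTemperedDistribution (hσ.toLp σ)).toLinearMap

theorem symbolFunctional_apply {σ : Eu d × Eu d → ℂ}
    (hσ : MemLp σ ⊤ (volume : Measure (Eu d × Eu d))) (φ : 𝓢(Eu d × Eu d, ℂ)) :
    symbolFunctional hσ φ = ∫ z, σ z * φ z := by
  change Lp.toTemperedDistribution (hσ.toLp σ) φ = _
  rw [Lp.toTemperedDistribution_apply]
  refine integral_congr_ae ?_
  filter_upwards [hσ.coeFn_toLp] with z hz
  rw [hz, smul_eq_mul, mul_comm]

/-- Moving the derivatives onto the symbol leaves a pairing with an L^∞ function, so `φ` enters only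
through its L¹ norm. The constant depends on the direction, whence the finite set `s`. -/
theorem IsSymbol.exists_symbolFunctional_bound {K : ℕ} {σ : Eu d × Eu d → ℂ} (h : IsSymbol K σ)
    (hσ : MemLp σ ⊤ (volume : Measure (Eu d × Eu d))) {s : Set (Eu d × Eu d)} (hs : s.Finite) :
    ∃ C : ℝ, 0 ≤ C ∧ ∀ u ∈ s, ∀ k ≤ K, ∀ φ,
      ‖symbolFunctional hσ (dirDeriv u k φ)‖ ≤ C * ∫ z, ‖φ z‖ := by
  obtain ⟨hσ', h⟩ := h
  have h1 : ∀ u : Eu d × Eu d, ∀ k ≤ K, ∃ C : ℝ, 0 ≤ C ∧ ∀ φ,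
      ‖symbolFunctional hσ (dirDeriv u k φ)‖ ≤ C * ∫ z, ‖φ z‖ := by
    intro u k hk
    obtain ⟨τ, hτ⟩ := h k hk fun _ => u
    refine ⟨(eLpNorm τ ⊤ volume).toReal, by positivity, fun φ => ?_⟩
    have h2 := dirDeriv_temperedDistribution_apply u k
      (Lp.toTemperedDistribution (hσ'.toLp σ)) φ
    rw [hτ, Lp.toTemperedDistribution_apply] at h2
    have h3 := congrArg norm h2
    rw [norm_mul, norm_pow, norm_neg, norm_one, one_pow, one_mul] at h3
    change ‖Lp.toTemperedDistribution (hσ'.toLp σ) (dirDeriv u k φ)‖ ≤ _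
    rw [← h3]
    exact norm_integral_mul_le_of_memLp_top (Lp.memLp τ) φ.integrable
  choose! C hC0 hC using h1
  obtain ⟨B, hB⟩ := (hs.image fun u => ∑ k ∈ Finset.range (K + 1), C u k).bddAbove
  refine ⟨max B 0, le_max_right _ _, fun u hu k hk φ => (hC u k hk φ).trans ?_⟩
  have h4 : C u k ≤ ∑ k ∈ Finset.range (K + 1), C u k :=
    Finset.single_le_sum (f := C u) (fun i hi => hC0 u i (by simpa [Nat.lt_succ_iff] using hi))
      (Finset.mem_range.2 (by omega))
  have h5 := h4.trans (hB (Set.mem_image_of_mem _ hu))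
  have : 0 ≤ ∫ z, ‖φ z‖ := integral_nonneg fun _ => norm_nonneg _
  gcongr
  exact h5.trans (le_max_left _ _)

theorem norm_le_sum_abs {d : ℕ} (v : Eu d) : ‖v‖ ≤ ∑ j, |v j| := by
  have h3 := (EuclideanSpace.basisFun (Fin d) ℝ).sum_repr v
  calc ‖v‖ = ‖∑ j, v j • (EuclideanSpace.basisFun (Fin d) ℝ) j‖ := by
        conv_lhs => rw [← h3]
        simp
    _ ≤ ∑ j, ‖v j • (EuclideanSpace.basisFun (Fin d) ℝ) j‖ := norm_sum_le _ _
    _ = ∑ j, |v j| := by simp [norm_smul]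

/-- The norm of `v` is at most `d` times its largest coordinate, so the bound for that coordinate
suffices; `h0` covers `d = 0`, where there is no coordinate. -/
theorem one_add_norm_pow_mul_le {v : Eu d} {K : ℕ} {x B : ℝ} (hx : 0 ≤ x) (h0 : x ≤ B)
    (h : ∀ i, (1 + |v i|) ^ K * x ≤ B) : (1 + ‖v‖) ^ K * x ≤ (1 + d) ^ K * B := by
  have hB : 0 ≤ B := hx.trans h0
  rcases isEmpty_or_nonempty (Fin d) with hd | hd
  · have : v = 0 := Subsingleton.elim _ _
    rw [this, norm_zero, add_zero, one_pow, one_mul]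
    have h1 : (1 : ℝ) ≤ (1 + d) ^ K := one_le_pow₀ (by simp)
    nlinarith
  · obtain ⟨i, hi⟩ := Finite.exists_max fun i => |v i|
    have h1 : ‖v‖ ≤ d * |v i| := by
      refine (norm_le_sum_abs v).trans ((Finset.sum_le_sum fun j _ => hi j).trans ?_)
      simp
    have h2 : 1 + ‖v‖ ≤ (1 + d) * (1 + |v i|) := by
      have : (0 : ℝ) ≤ d := Nat.cast_nonneg d
      nlinarith [abs_nonneg (v i)]
    calc (1 + ‖v‖) ^ K * x ≤ ((1 + d) * (1 + |v i|)) ^ K * x := by gcongr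
      _ = (1 + d) ^ K * ((1 + |v i|) ^ K * x) := by rw [mul_pow]; ring
      _ ≤ _ := by gcongr; exact h i

end Symbols

/-! ### Tensor products of Schwartz functions -/

section Tensor

theorem norm_iteratedFDeriv_comp_clm_le {E F G : Type*} [NormedAddCommGroup E] [NormedSpace ℝ E]
    [NormedAddCommGroup F] [NormedSpace ℝ F] [NormedAddCommGroup G] [NormedSpace ℝ G]
    {f : F → G} (hf : ContDiff ℝ ∞ f) (A : E →L[ℝ] F) (hA : ‖A‖ ≤ 1) (n : ℕ) (x : E) :
    ‖iteratedFDeriv ℝ n (fun y => f (A y)) x‖ ≤ ‖iteratedFDeriv ℝ n f (A x)‖ := by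
  have := A.iteratedFDeriv_comp_right hf x (i := n) (by exact_mod_cast le_top)
  rw [show (fun y => f (A y)) = f ∘ A from rfl, this]
  refine (ContinuousMultilinearMap.norm_compContinuousLinearMap_le _ _).trans ?_
  have h1 : ∏ _i : Fin n, ‖A‖ ≤ 1 := Finset.prod_le_one (fun _ _ => norm_nonneg _) fun _ _ => hA
  calc _ ≤ ‖iteratedFDeriv ℝ n f (A x)‖ * 1 := by gcongr
    _ = _ := mul_one _

variable {E F : Type*} [NormedAddCommGroup E] [NormedSpace ℝ E]
  [NormedAddCommGroup F] [NormedSpace ℝ F]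

/-- Leibniz, with `‖z‖ ≤ (1 + ‖z.1‖)(1 + ‖z.2‖)` sharing the weight between the factors. The bound
is explicit because the kernel estimate must depend on its window only through `schwartzNorm M h`.
-/
theorem tensor_decay (h : 𝓢(E, ℂ)) (k : 𝓢(F, ℂ)) {M a n : ℕ} (ha : a ≤ M) (hn : n ≤ M)
    (z : E × F) :
    ‖z‖ ^ a * ‖iteratedFDeriv ℝ n (fun z : E × F => h z.1 * k z.2) z‖ ≤
      2 ^ M * (2 ^ M * schwartzNorm M h) * (2 ^ M * schwartzNorm M k) := by
  have h1 : ∀ i, ‖iteratedFDeriv ℝ i (fun z : E × F => h z.1) z‖ ≤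
      ‖iteratedFDeriv ℝ i h z.1‖ := fun i =>
    norm_iteratedFDeriv_comp_clm_le (h.smooth ⊤) (ContinuousLinearMap.fst ℝ E F)
      (ContinuousLinearMap.norm_fst_le ..) i z
  have h2 : ∀ i, ‖iteratedFDeriv ℝ i (fun z : E × F => k z.2) z‖ ≤
      ‖iteratedFDeriv ℝ i k z.2‖ := fun i =>
    norm_iteratedFDeriv_comp_clm_le (k.smooth ⊤) (ContinuousLinearMap.snd ℝ E F)
      (ContinuousLinearMap.norm_snd_le ..) i z
  have hz : ‖z‖ ^ a ≤ (1 + ‖z.1‖) ^ a * (1 + ‖z.2‖) ^ a := by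
    rw [← mul_pow]
    gcongr
    rw [Prod.norm_def]
    refine max_le ?_ ?_ <;> nlinarith [norm_nonneg z.1, norm_nonneg z.2]
  have hmul := norm_iteratedFDeriv_mul_le (𝕜 := ℝ) (N := ∞)
    ((h.smooth ⊤).comp contDiff_fst : ContDiff ℝ ∞ fun z : E × F => h z.1)
    ((k.smooth ⊤).comp contDiff_snd : ContDiff ℝ ∞ fun z : E × F => k z.2) z (n := n)
    (by exact_mod_cast le_top)
  have hh := schwartzNorm_nonneg M h
  have hk := schwartzNorm_nonneg M k
  calc _ ≤ (1 + ‖z.1‖) ^ a * (1 + ‖z.2‖) ^ a * ∑ i ∈ Finset.range (n + 1), (n.choose i : ℝ) *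
        ‖iteratedFDeriv ℝ i h z.1‖ * ‖iteratedFDeriv ℝ (n - i) k z.2‖ := by
        gcongr
        refine hmul.trans (Finset.sum_le_sum fun i _ => ?_)
        gcongr
        · exact h1 i
        · exact h2 (n - i)
    _ = ∑ i ∈ Finset.range (n + 1), (n.choose i : ℝ) *
        (((1 + ‖z.1‖) ^ a * ‖iteratedFDeriv ℝ i h z.1‖) *
          ((1 + ‖z.2‖) ^ a * ‖iteratedFDeriv ℝ (n - i) k z.2‖)) := by
        rw [Finset.mul_sum]
        refine Finset.sum_congr rfl fun i _ => by ring
    _ ≤ ∑ i ∈ Finset.range (n + 1), (n.choose i : ℝ) *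
        ((2 ^ M * schwartzNorm M h) * (2 ^ M * schwartzNorm M k)) := by
        refine Finset.sum_le_sum fun i hi => ?_
        have hi' : i ≤ n := by simpa [Nat.lt_succ_iff] using hi
        refine mul_le_mul_of_nonneg_left (mul_le_mul ?_ ?_ (by positivity) (by positivity))
          (by positivity)
        · exact one_add_pow_mul_le_schwartzNorm ha (by omega) h _
        · exact one_add_pow_mul_le_schwartzNorm ha (by omega) k _
    _ = 2 ^ n * ((2 ^ M * schwartzNorm M h) * (2 ^ M * schwartzNorm M k)) := by
        rw [← Finset.sum_mul]
        norm_cast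
        rw [Nat.sum_range_choose]
    _ ≤ 2 ^ M * ((2 ^ M * schwartzNorm M h) * (2 ^ M * schwartzNorm M k)) := by
        gcongr
        norm_num
    _ = _ := by ring

/-- The tensor product of two Schwartz functions. -/
def tensor (h : 𝓢(E, ℂ)) (k : 𝓢(F, ℂ)) : 𝓢(E × F, ℂ) where
  toFun z := h z.1 * k z.2
  smooth' := ((h.smooth ⊤).comp contDiff_fst).mul ((k.smooth ⊤).comp contDiff_snd)
  decay' a n := ⟨_, tensor_decay h k (le_max_left a n) (le_max_right a n)⟩

theorem tensor_apply (h : 𝓢(E, ℂ)) (k : 𝓢(F, ℂ)) (z : E × F) :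
    tensor h k z = h z.1 * k z.2 := rfl

theorem schwartzNorm_tensor_le (M : ℕ) (h : 𝓢(E, ℂ)) (k : 𝓢(F, ℂ)) :
    schwartzNorm M (tensor h k) ≤
      2 ^ M * (2 ^ M * schwartzNorm M h) * (2 ^ M * schwartzNorm M k) := by
  have hh := schwartzNorm_nonneg M h
  have hk := schwartzNorm_nonneg M k
  exact schwartzNorm_le (by positivity) fun a ha n hn z => tensor_decay h k ha hn z

end Tensor

/-! ### The kernel of the operator in phase space -/

section Kernel

variable {d : ℕ}

theorem schwartzNorm_conj_le (M : ℕ) (h : 𝓢(Eu d, ℂ)) :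
    schwartzNorm M (conj h) ≤ schwartzNorm M h := by
  refine schwartzNorm_le (schwartzNorm_nonneg M h) fun k hk n hn x => ?_
  have h1 : (⇑(conj h)) = Complex.conjLIE ∘ h := by
    funext t; rw [conj_apply]; rfl
  rw [h1, LinearIsometryEquiv.norm_iteratedFDeriv_comp_left]
  exact (SchwartzMap.le_seminorm ℂ k n h x).trans (seminorm_le_schwartzNorm hk hn h)

theorem norm_character (η t : Eu d) : ‖character η t‖ = 1 := by
  simp [character, Complex.norm_exp]

theorem fourier_timeFreqShift (g : 𝓢(Eu d, ℂ)) (x ξ η : Eu d) :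
    𝓕 (timeFreqShift g x ξ) η = character (-x) (η - ξ) * 𝓕 g (η - ξ) := by
  rw [SchwartzMap.fourier_coe, SchwartzMap.fourier_coe, Real.fourier_eq', Real.fourier_eq']
  conv_rhs => rw [← integral_sub_right_eq_self _ x, ← integral_const_mul]
  refine integral_congr_ae (Filter.Eventually.of_forall fun t => ?_)
  simp only [smul_eq_mul, timeFreqShift_apply, character]
  rw [← mul_assoc, ← mul_assoc, ← Complex.exp_add, ← Complex.exp_add]
  congr 2
  simp only [inner_sub_left, inner_sub_right, inner_neg_left]
  rw [real_inner_comm ξ t, real_inner_comm ξ x]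
  push_cast
  ring

/-- The pairing `∫ T(π(z)g) ψ` of the Fourier integral operator applied to a time-frequency shift
of `g` with the test function `ψ`. -/
def fioKernel (Φ : Eu d × Eu d → ℝ) (σ : Eu d × Eu d → ℂ) (g : 𝓢(Eu d, ℂ)) (x ξ : Eu d)
    (ψ : 𝓢(Eu d, ℂ)) : ℂ :=
  ∫ w : Eu d × Eu d, σ w * (osc Φ w * (ψ w.1 * 𝓕 (timeFreqShift g x ξ) w.2))

/-- The partial gradient of `Φ` in the first variable. -/
def gradFst (Φ : Eu d × Eu d → ℝ) (z : Eu d × Eu d) : Eu d :=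
  WithLp.toLp 2 fun i => fderiv ℝ Φ z (EuclideanSpace.single i 1, 0)

/-- The partial gradient of `Φ` in the second variable. -/
def gradSnd (Φ : Eu d × Eu d → ℝ) (z : Eu d × Eu d) : Eu d :=
  WithLp.toLp 2 fun i => fderiv ℝ Φ z (0, EuclideanSpace.single i 1)

/-- The linear form `(t, η) ↦ a·t + b·η`. -/
def linForm (a b : Eu d) : Eu d × Eu d →L[ℝ] ℝ :=
  (innerSL ℝ a).coprod (innerSL ℝ b)

theorem linForm_apply (a b : Eu d) (z : Eu d × Eu d) :
    linForm a b z = inner ℝ a z.1 + inner ℝ b z.2 := by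
  simp [linForm]

/-- The translation of the test function by `x'` and of the Fourier transform of the atom by `ξ`
place the amplitude at `(x', ξ)`. The remaining modulations contribute the linear form with
coefficients `ξ'` and `x`, up to unimodular constants. -/
theorem fioKernel_conj_timeFreqShift {Φ : Eu d × Eu d → ℝ} (hΦ : IsPhase Φ) {σ : Eu d × Eu d → ℂ}
    (hσ : MemLp σ ⊤ (volume : Measure (Eu d × Eu d))) (g h : 𝓢(Eu d, ℂ)) (x ξ x' ξ' : Eu d) :
    ‖fioKernel Φ σ g x ξ (conj (timeFreqShift h x' ξ'))‖ =
      ‖symbolFunctional hσ (wavePacket Φ (linForm ξ' x) (x', ξ) (tensor (conj h) (𝓕 g)))‖ := by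
  rw [symbolFunctional_apply, fioKernel]
  have key : ∀ w : Eu d × Eu d,
      σ w * (osc Φ w * (conj (timeFreqShift h x' ξ') w.1 * 𝓕 (timeFreqShift g x ξ) w.2)) =
      (character x ξ * osc (fun _ : Eu d × Eu d => Φ (x', ξ) - fderiv ℝ Φ (x', ξ) (x', ξ))
        (x', ξ)) *
        (σ w * wavePacket Φ (linForm ξ' x) (x', ξ) (tensor (conj h) (𝓕 g)) w) := by
    intro w
    have h1 := osc_sub_mul_eq_wavePacket hΦ.smooth hΦ.bounded_deriv (linForm ξ' x) (x', ξ)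
      (tensor (conj h) (𝓕 g)) w
    rw [show ∀ a b c e : ℂ, (a * b) * (c * e) = c * (a * (b * e)) by intros; ring, ← h1]
    congr 1
    rw [conj_apply, timeFreqShift_apply, fourier_timeFreqShift, tensor_apply, conj_apply, map_mul]
    have h2 : (starRingEnd ℂ) (character ξ' w.1) =
        Complex.exp (-(2 * Real.pi * Complex.I * (inner ℝ ξ' w.1 : ℝ))) := by
      rw [character, ← Complex.exp_conj]
      congr 1
      simp only [map_mul, map_ofNat, Complex.conj_ofReal, Complex.conj_I]
      ring
    have h3 : character x ξ * osc (fun z => Φ z - linForm ξ' x z) w =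
        osc Φ w * ((starRingEnd ℂ) (character ξ' w.1) * character (-x) (w.2 - ξ)) := by
      rw [h2]
      simp only [osc, character, ← Complex.exp_add, linForm_apply]
      congr 1
      simp only [inner_sub_right, inner_neg_left]
      push_cast
      ring
    simp only [Prod.fst_sub, Prod.snd_sub]
    calc _ = (osc Φ w * ((starRingEnd ℂ) (character ξ' w.1) * character (-x) (w.2 - ξ))) *
          ((starRingEnd ℂ) (h (w.1 - x')) * 𝓕 g (w.2 - ξ)) := by ring
      _ = _ := by rw [← h3]; ring
  simp_rw [key]
  rw [integral_const_mul, norm_mul, norm_mul, norm_character, norm_osc, one_mul, one_mul]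

/-- The kernel of the Fourier integral operator with respect to time-frequency shifts is
concentrated along the canonical transformation. -/
theorem exists_fioKernel_bound {Φ : Eu d × Eu d → ℝ} (hΦ : IsPhase Φ) {σ : Eu d × Eu d → ℂ}
    {N : ℕ} (hσ : IsSymbol (2 * N) σ) (g : 𝓢(Eu d, ℂ)) :
    ∃ C : ℝ, 0 ≤ C ∧ ∃ M : ℕ, ∀ (h : 𝓢(Eu d, ℂ)) (x ξ x' ξ' : Eu d),
      (1 + ‖gradFst Φ (x', ξ) - ξ'‖) ^ N * (1 + ‖gradSnd Φ (x', ξ) - x‖) ^ N *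
        ‖fioKernel Φ σ g x ξ (conj (timeFreqShift h x' ξ'))‖ ≤ C * schwartzNorm M h := by
  have hσ' : MemLp σ ⊤ (volume : Measure (Eu d × Eu d)) := hσ.1
  -- The coordinate directions detect the two partial gradients; the direction 0 supplies the bound
  -- without any weight.
  set s : Set (Eu d × Eu d) := insert 0 ((Set.range fun i : Fin d =>
    ((EuclideanSpace.single i 1, 0) : Eu d × Eu d)) ∪
    Set.range fun i : Fin d => ((0, EuclideanSpace.single i 1) : Eu d × Eu d)) with hs
  have hsfin : s.Finite := ((Set.finite_range _).union (Set.finite_range _)).insert _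
  have hsnorm : ∀ u ∈ s, ‖u‖ ≤ 1 := by
    rintro u (rfl | ⟨i, rfl⟩ | ⟨i, rfl⟩) <;> simp [Prod.norm_def]
  obtain ⟨C₀, hC₀, hL⟩ := hσ.exists_symbolFunctional_bound hσ' hsfin
  obtain ⟨C, hC, M, hM⟩ := exists_oscillatory_bound hΦ.smooth hΦ.bounded_deriv hC₀ hsnorm hL
  refine ⟨(1 + d) ^ (2 * N) * (C * (2 ^ M * 2 ^ M * (2 ^ M * schwartzNorm M (𝓕 g)))), ?_, M,
    fun h x ξ x' ξ' => ?_⟩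
  · have := schwartzNorm_nonneg M (𝓕 g)
    positivity
  rw [fioKernel_conj_timeFreqShift hΦ hσ']
  set Θ := tensor (conj h) (𝓕 g) with hΘ
  set X := ‖symbolFunctional hσ' (wavePacket Φ (linForm ξ' x) (x', ξ) Θ)‖ with hX
  have hX0 : 0 ≤ X := norm_nonneg _
  have hb := hM (x', ξ) (linForm ξ' x) Θ
  have h0 : X ≤ C * schwartzNorm M Θ := by
    have := hb 0 (Set.mem_insert _ _)
    rwa [map_zero, abs_zero, add_zero, one_pow, one_mul] at this
  have h1 : (1 + ‖gradFst Φ (x', ξ) - ξ'‖) ^ (2 * N) * X ≤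
      (1 + d) ^ (2 * N) * (C * schwartzNorm M Θ) := by
    refine one_add_norm_pow_mul_le hX0 h0 fun i => ?_
    have := hb (EuclideanSpace.single i 1, 0) (Or.inr (Or.inl ⟨i, rfl⟩))
    simpa [linForm_apply, gradFst, EuclideanSpace.inner_single_right] using this
  have h2 : (1 + ‖gradSnd Φ (x', ξ) - x‖) ^ (2 * N) * X ≤
      (1 + d) ^ (2 * N) * (C * schwartzNorm M Θ) := by
    refine one_add_norm_pow_mul_le hX0 h0 fun i => ?_
    have := hb (0, EuclideanSpace.single i 1) (Or.inr (Or.inr ⟨i, rfl⟩))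
    simpa [linForm_apply, gradSnd, EuclideanSpace.inner_single_right] using this
  have h3 : schwartzNorm M Θ ≤
      2 ^ M * (2 ^ M * schwartzNorm M h) * (2 ^ M * schwartzNorm M (𝓕 g)) := by
    refine (schwartzNorm_tensor_le M _ _).trans ?_
    have := schwartzNorm_nonneg M (𝓕 g)
    gcongr
    exact schwartzNorm_conj_le M h
  -- Each of the two estimates has `2 * N` powers of one distance only; the larger distance pays for
  -- both factors. This is why `2 * N` derivatives of the symbol give the exponent `N`.
  have h4 : (1 + ‖gradFst Φ (x', ξ) - ξ'‖) ^ N * (1 + ‖gradSnd Φ (x', ξ) - x‖) ^ N * X ≤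
      (1 + d) ^ (2 * N) * (C * schwartzNorm M Θ) := by
    set a := 1 + ‖gradFst Φ (x', ξ) - ξ'‖
    set b := 1 + ‖gradSnd Φ (x', ξ) - x‖
    have ha : 0 ≤ a := by positivity
    have hb : 0 ≤ b := by positivity
    rcases le_total a b with hab | hab
    · refine le_trans ?_ h2
      rw [two_mul, pow_add]
      gcongr
    · refine le_trans ?_ h1
      rw [two_mul, pow_add]
      gcongr
  calc _ ≤ _ := h4
    _ ≤ (1 + d) ^ (2 * N) * (C * (2 ^ M * (2 ^ M * schwartzNorm M h) *
        (2 ^ M * schwartzNorm M (𝓕 g)))) := by gcongr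
    _ = _ := by ring

end Kernel

/-! ### Global expansion of the partial gradients of the phase -/

section PhaseGeometry

variable {d : ℕ}

theorem norm_toEuclideanCLM_le {A : Matrix (Fin d) (Fin d) ℝ} {K : ℝ} (hK : 0 ≤ K)
    (hA : ∀ i j, |A i j| ≤ K) : ‖Matrix.toEuclideanCLM (n := Fin d) (𝕜 := ℝ) A‖ ≤ d * (d * K) := by
  refine ContinuousLinearMap.opNorm_le_bound _ (by positivity) fun v => ?_
  refine (norm_le_sum_abs _).trans ?_
  have h : ∀ i, |(Matrix.toEuclideanCLM (n := Fin d) (𝕜 := ℝ) A v) i| ≤ d * (K * ‖v‖) := by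
    intro i
    rw [Matrix.ofLp_toEuclideanCLM, Matrix.mulVec, dotProduct]
    refine (Finset.abs_sum_le_sum_abs _ _).trans ?_
    calc ∑ j, |A i j * v j| ≤ ∑ _j : Fin d, K * ‖v‖ := by
          refine Finset.sum_le_sum fun j _ => ?_
          rw [abs_mul]
          gcongr
          · exact hA i j
          · exact PiLp.norm_apply_le v j
      _ = _ := by simp
  calc _ ≤ ∑ _i : Fin d, (d : ℝ) * (K * ‖v‖) := Finset.sum_le_sum fun i _ => h i
    _ = _ := by simp; ring

/-- The Euclidean continuous linear equivalence given by an invertible matrix. -/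
def matrixEquiv (A : Matrix (Fin d) (Fin d) ℝ) (hA : IsUnit A.det) : Eu d ≃L[ℝ] Eu d :=
  ContinuousLinearEquiv.equivOfInverse (Matrix.toEuclideanCLM (n := Fin d) (𝕜 := ℝ) A)
    (Matrix.toEuclideanCLM (n := Fin d) (𝕜 := ℝ) A⁻¹)
    (fun v => by
      rw [← mul_apply_eq_comp, ← map_mul, Matrix.nonsing_inv_mul _ hA, map_one]; rfl)
    (fun v => by
      rw [← mul_apply_eq_comp, ← map_mul, Matrix.mul_nonsing_inv _ hA, map_one]; rfl)

theorem abs_fderiv_fderiv_le {E : Type*} [NormedAddCommGroup E] [NormedSpace ℝ E] {Φ : E → ℝ}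
    {B : ℝ} (hB : ∀ z, ‖iteratedFDeriv ℝ 2 Φ z‖ ≤ B) {u v : E} (hu : ‖u‖ ≤ 1) (hv : ‖v‖ ≤ 1)
    (z : E) : |fderiv ℝ (fderiv ℝ Φ) z u v| ≤ B := by
  have h1 : ‖fderiv ℝ (fderiv ℝ Φ) z‖ ≤ B := by
    rw [← norm_iteratedFDeriv_one, norm_iteratedFDeriv_fderiv]; exact hB z
  have hB0 : 0 ≤ B := (norm_nonneg _).trans (hB z)
  calc _ ≤ ‖fderiv ℝ (fderiv ℝ Φ) z‖ * ‖u‖ * ‖v‖ := ContinuousLinearMap.le_opNorm₂ _ _ _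
    _ ≤ B * 1 * 1 := by gcongr
    _ = B := by ring

theorem norm_fderiv_fderiv_sub_le {E : Type*} [NormedAddCommGroup E] [NormedSpace ℝ E] {Φ : E → ℝ}
    (h : ContDiff ℝ ∞ Φ) {B : ℝ} (hB : ∀ z, ‖iteratedFDeriv ℝ 3 Φ z‖ ≤ B) (z w : E) :
    ‖fderiv ℝ (fderiv ℝ Φ) z - fderiv ℝ (fderiv ℝ Φ) w‖ ≤ B * ‖z - w‖ := by
  have hd : Differentiable ℝ (fderiv ℝ (fderiv ℝ Φ)) :=
    ((h.fderiv_right (m := ∞) (by simp)).fderiv_right (m := ∞) (by simp)).differentiable (by simp)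
  refine convex_univ.norm_image_sub_le_of_norm_fderiv_le (𝕜 := ℝ) (G := E →L[ℝ] E →L[ℝ] ℝ)
    (f := fderiv ℝ (fderiv ℝ Φ)) (fun x _ => hd x)
    (fun x _ => ?_) (Set.mem_univ w) (Set.mem_univ z)
  rw [← norm_iteratedFDeriv_one, norm_iteratedFDeriv_fderiv, norm_iteratedFDeriv_fderiv]
  exact hB x

/-- Restricted to a `d`-dimensional affine subspace, `d` directional derivatives of `Φ` with
uniformly nondegenerate derivative matrix form a uniformly expanding map. -/
theorem exists_antilipschitz_fderiv {E : Type*} [NormedAddCommGroup E] [NormedSpace ℝ E]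
    {Φ : E → ℝ} (h : ContDiff ℝ ∞ Φ) (hB : ∀ n : ℕ, 2 ≤ n → ∃ C : ℝ, ∀ z, ‖iteratedFDeriv ℝ n Φ z‖ ≤ C)
    (ι : Eu d →L[ℝ] E) (hι : ‖ι‖ ≤ 1) {u : Fin d → E} (hu : ∀ i, ‖u i‖ ≤ 1)
    {δ : ℝ} (hδ : 0 < δ)
    (hdet : ∀ z, δ ≤ |(Matrix.of fun i j =>
      fderiv ℝ (fderiv ℝ Φ) z (ι (EuclideanSpace.single j 1)) (u i) :
        Matrix (Fin d) (Fin d) ℝ).det|) :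
    ∃ L : ℝ, 0 < L ∧ ∀ (z₀ : E) (a b : Eu d), ‖a - b‖ ≤
      L * ‖(WithLp.toLp 2 (fun i => fderiv ℝ Φ (z₀ + ι a) (u i)) : Eu d) -
        WithLp.toLp 2 (fun i => fderiv ℝ Φ (z₀ + ι b) (u i))‖ := by
  obtain ⟨B₂, hB₂⟩ := hB 2 le_rfl
  obtain ⟨B₃, hB₃⟩ := hB 3 (by norm_num)
  have hB₃0 : 0 ≤ B₃ := (norm_nonneg _).trans (hB₃ 0)
  set A : E → Matrix (Fin d) (Fin d) ℝ := fun z => Matrix.of fun i j =>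
      fderiv ℝ (fderiv ℝ Φ) z (ι (EuclideanSpace.single j 1)) (u i) with hA
  have hιj : ∀ j : Fin d, ‖ι (EuclideanSpace.single j 1)‖ ≤ 1 := fun j =>
    (ι.le_of_opNorm_le hι _).trans (by simp)
  have hAb : ∀ z i j, |A z i j| ≤ max 1 B₂ := fun z i j =>
    (abs_fderiv_fderiv_le hB₂ (hιj j) (hu i) z).trans (le_max_right _ _)
  have hunit : ∀ z, IsUnit (A z).det := fun z => by
    refine isUnit_iff_ne_zero.2 fun h0 => ?_
    have := hdet z
    rw [show (A z).det = 0 from h0, abs_zero] at this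
    linarith
  set K : ℝ := δ⁻¹ * (d.factorial * (max 1 B₂) ^ d)
  have hK : 0 ≤ K := by positivity
  -- `d * (d * K)` bounds the inverse Jacobian, whose entries are at most `K` by Cramer's rule. The
  -- added 1 ensures positivity and the factor 2 comes from `norm_sub_le_of_fderiv_equiv`.
  refine ⟨2 * (d * (d * K) + 1), by positivity, fun z₀ a b => ?_⟩
  have hdiff : ∀ x, HasFDerivAt (fun a : Eu d =>
      (WithLp.toLp 2 (fun i => fderiv ℝ Φ (z₀ + ι a) (u i)) : Eu d))
      (matrixEquiv (A (z₀ + ι x)) (hunit _) : Eu d →L[ℝ] Eu d) x := by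
    intro x
    rw [← hasFDerivWithinAt_univ, hasFDerivWithinAt_euclidean]
    intro i
    rw [hasFDerivWithinAt_univ]
    have hd : HasFDerivAt (fderiv ℝ Φ) (fderiv ℝ (fderiv ℝ Φ) (z₀ + ι x)) (z₀ + ι x) :=
      ((h.fderiv_right (m := ∞) (by simp)).differentiable (by simp) _).hasFDerivAt
    have h1 : HasFDerivAt (fun a => fderiv ℝ Φ (z₀ + ι a))
        ((fderiv ℝ (fderiv ℝ Φ) (z₀ + ι x)).comp ι) x :=
      hd.comp x (ι.hasFDerivAt.const_add z₀)
    have h2 := h1.clm_apply (hasFDerivAt_const (u i) x)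
    refine h2.congr_fderiv (ContinuousLinearMap.ext fun v => Eq.symm ?_)
    simp only [ContinuousLinearMap.comp_apply, add_apply,
      ContinuousLinearMap.flip_apply, zero_apply, map_zero, zero_add]
    change (Matrix.toEuclideanCLM (n := Fin d) (𝕜 := ℝ) (A (z₀ + ι x)) v) i = _
    rw [Matrix.ofLp_toEuclideanCLM, Matrix.mulVec, dotProduct]
    have hv : v = ∑ j, v j • EuclideanSpace.single j (1 : ℝ) := by
      conv_lhs => rw [← (EuclideanSpace.basisFun (Fin d) ℝ).sum_repr v]
      simp
    conv_rhs => rw [hv]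
    simp [map_sum, hA, mul_comm]
  refine norm_sub_le_of_fderiv_equiv hdiff (M := d * (d * K) + 1) (Lc := d * (d * B₃) + 1)
    (by positivity) (by positivity) (fun x => ?_) (fun x y => ?_) a b
  · refine (norm_toEuclideanCLM_le hK fun i j =>
      abs_inv_apply_le_of_det (le_max_left 1 B₂) hδ (hAb (z₀ + ι x)) (hdet _) i j).trans ?_
    linarith
  · have h1 : ((matrixEquiv (A (z₀ + ι x)) (hunit _) : Eu d →L[ℝ] Eu d) -
        (matrixEquiv (A (z₀ + ι y)) (hunit _) : Eu d →L[ℝ] Eu d)) =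
        Matrix.toEuclideanCLM (n := Fin d) (𝕜 := ℝ) (A (z₀ + ι x) - A (z₀ + ι y)) := by
      rw [map_sub]; rfl
    rw [h1]
    have h2 : ∀ i j, |(A (z₀ + ι x) - A (z₀ + ι y)) i j| ≤ B₃ * ‖x - y‖ := by
      intro i j
      have h3 := norm_fderiv_fderiv_sub_le h hB₃ (z₀ + ι x) (z₀ + ι y)
      have h4 : ‖z₀ + ι x - (z₀ + ι y)‖ ≤ ‖x - y‖ := by
        rw [add_sub_add_left_eq_sub, ← map_sub]
        exact (ι.le_of_opNorm_le hι _).trans (by simp)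
      calc |(A (z₀ + ι x) - A (z₀ + ι y)) i j|
          = ‖(fderiv ℝ (fderiv ℝ Φ) (z₀ + ι x) - fderiv ℝ (fderiv ℝ Φ) (z₀ + ι y))
              (ι (EuclideanSpace.single j 1)) (u i)‖ := by simp [hA]
        _ ≤ ‖fderiv ℝ (fderiv ℝ Φ) (z₀ + ι x) - fderiv ℝ (fderiv ℝ Φ) (z₀ + ι y)‖ *
            ‖ι (EuclideanSpace.single j 1)‖ * ‖u i‖ := ContinuousLinearMap.le_opNorm₂ _ _ _
        _ ≤ (B₃ * ‖z₀ + ι x - (z₀ + ι y)‖) * 1 * 1 := by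
          gcongr
          exacts [hιj j, hu i]
        _ ≤ (B₃ * ‖x - y‖) * 1 * 1 := by gcongr
        _ = _ := by ring
    refine (norm_toEuclideanCLM_le (by positivity) h2).trans ?_
    nlinarith [norm_nonneg (x - y)]

theorem exists_antilipschitz_gradFst {Φ : Eu d × Eu d → ℝ} (hΦ : IsPhase Φ) :
    ∃ L : ℝ, 0 < L ∧ ∀ x a b : Eu d, ‖a - b‖ ≤ L * ‖gradFst Φ (x, a) - gradFst Φ (x, b)‖ := by
  obtain ⟨δ, hδ, hdet⟩ := hΦ.nondegenerate
  obtain ⟨L, hL, h⟩ := exists_antilipschitz_fderiv hΦ.smooth hΦ.bounded_deriv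
    (ContinuousLinearMap.inr ℝ (Eu d) (Eu d)) (ContinuousLinearMap.norm_inr_le_one ..)
    (u := fun i => (EuclideanSpace.single i 1, 0)) (fun i => by simp [Prod.norm_def]) hδ
    (fun z => by
      convert hdet z using 3
      ext i j
      -- The Jacobian has its `η` slot first and `mixedHessian` its `x` slot first; symmetry of the
      -- second derivative identifies them.
      have hs := (hΦ.smooth.contDiffAt (x := z)).isSymmSndFDerivAt
        (by simpa using WithTop.coe_le_coe.2 (le_top (a := (2 : ℕ∞))))
      simp only [Matrix.of_apply, mixedHessian, iteratedFDeriv_two_apply]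
      exact hs _ _)
  refine ⟨L, hL, fun x a b => ?_⟩
  simpa [gradFst] using h (x, 0) a b

theorem exists_antilipschitz_gradSnd {Φ : Eu d × Eu d → ℝ} (hΦ : IsPhase Φ) :
    ∃ L : ℝ, 0 < L ∧ ∀ ξ a b : Eu d, ‖a - b‖ ≤ L * ‖gradSnd Φ (a, ξ) - gradSnd Φ (b, ξ)‖ := by
  obtain ⟨δ, hδ, hdet⟩ := hΦ.nondegenerate
  obtain ⟨L, hL, h⟩ := exists_antilipschitz_fderiv hΦ.smooth hΦ.bounded_deriv
    (ContinuousLinearMap.inl ℝ (Eu d) (Eu d)) (ContinuousLinearMap.norm_inl_le_one ..)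
    (u := fun i => (0, EuclideanSpace.single i 1)) (fun i => by simp [Prod.norm_def]) hδ
    (fun z => by
      -- Here the rows are indexed by the `η` directions, so the Jacobian is the transpose of the
      -- mixed Hessian.
      rw [← Matrix.det_transpose]
      convert hdet z using 3
      ext i j
      simp only [Matrix.of_apply, Matrix.transpose_apply, mixedHessian, iteratedFDeriv_two_apply]
      rfl)
  refine ⟨L, hL, fun ξ a b => ?_⟩
  simpa [gradSnd] using h (0, ξ) a b

/-- Serves to move the output point of the dominating operator at bounded cost. -/
theorem exists_lipschitz_gradSnd {Φ : Eu d × Eu d → ℝ} (hΦ : IsPhase Φ) :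
    ∃ L : ℝ, 0 < L ∧ ∀ ξ a b : Eu d, ‖gradSnd Φ (a, ξ) - gradSnd Φ (b, ξ)‖ ≤ L * ‖a - b‖ := by
  obtain ⟨B, hB⟩ := hΦ.bounded_deriv 2 le_rfl
  have hB0 : 0 ≤ B := (norm_nonneg _).trans (hB 0)
  refine ⟨d * B + 1, by positivity, fun ξ a b => ?_⟩
  refine (norm_le_sum_abs _).trans ?_
  have h : ∀ i, |(gradSnd Φ (a, ξ) - gradSnd Φ (b, ξ)) i| ≤ B * ‖a - b‖ := by
    intro i
    have h1 := norm_fderiv_sub_le hΦ.smooth hB (a, ξ) (b, ξ)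
    rw [show ((a, ξ) : Eu d × Eu d) - (b, ξ) = (a - b, 0) by simp, Prod.norm_def] at h1
    simp only [norm_zero, norm_nonneg, sup_of_le_left] at h1
    calc _ = ‖(fderiv ℝ Φ (a, ξ) - fderiv ℝ Φ (b, ξ)) (0, EuclideanSpace.single i 1)‖ := by
          simp [gradSnd]
      _ ≤ ‖fderiv ℝ Φ (a, ξ) - fderiv ℝ Φ (b, ξ)‖ * ‖((0 : Eu d), EuclideanSpace.single i (1 : ℝ))‖ :=
          ContinuousLinearMap.le_opNorm _ _
      _ ≤ B * ‖a - b‖ * 1 := by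
          gcongr
          simp [Prod.norm_def]
      _ = _ := mul_one _
  calc _ ≤ ∑ _i : Fin d, B * ‖a - b‖ := Finset.sum_le_sum fun i _ => h i
    _ = d * B * ‖a - b‖ := by simp; ring
    _ ≤ _ := by gcongr; linarith

theorem continuous_gradFst {Φ : Eu d × Eu d → ℝ} (h : ContDiff ℝ ∞ Φ) : Continuous (gradFst Φ) := by
  have := h.continuous_fderiv (by simp)
  unfold gradFst
  fun_prop

theorem continuous_gradSnd {Φ : Eu d × Eu d → ℝ} (h : ContDiff ℝ ∞ Φ) : Continuous (gradSnd Φ) := by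
  have := h.continuous_fderiv (by simp)
  unfold gradSnd
  fun_prop

theorem gradient_eq_gradFst {Φ : Eu d × Eu d → ℝ} (h : ContDiff ℝ ∞ Φ) (x η : Eu d) :
    ∇ (fun y : Eu d => Φ (y, η)) x = gradFst Φ (x, η) := by
  have h1 : HasFDerivAt Φ (fderiv ℝ Φ (x, η)) (x, η) :=
    (h.differentiable (by simp) _).hasFDerivAt
  have h2 : HasFDerivAt (fun y : Eu d => Φ (y, η))
      ((fderiv ℝ Φ (x, η)).comp (ContinuousLinearMap.inl ℝ (Eu d) (Eu d))) x :=
    h1.comp x (hasFDerivAt_prodMk_left x η)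
  ext i
  have h3 : (∇ (fun y : Eu d => Φ (y, η)) x) i =
      inner ℝ (∇ (fun y : Eu d => Φ (y, η)) x) (EuclideanSpace.single i (1 : ℝ)) := by
    rw [EuclideanSpace.inner_single_right]; simp
  rw [h3, gradient, InnerProductSpace.toDual_symm_apply, h2.fderiv]
  simp [gradFst]

end PhaseGeometry

/-! ### Polynomial weights and their integrals along expanding maps -/

section Weights

variable {d : ℕ}

/-- The weight `(1 + |v|)^{-N}`. -/
def weight (N : ℕ) (v : Eu d) : ℝ≥0∞ := ENNReal.ofReal (((1 + ‖v‖) ^ N)⁻¹)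

theorem continuous_weight (N : ℕ) : Continuous (weight (d := d) N) := by
  unfold weight
  refine ENNReal.continuous_ofReal.comp (Continuous.inv₀ (by fun_prop) fun v => ?_)
  positivity

theorem weight_le_one (N : ℕ) (v : Eu d) : weight N v ≤ 1 := by
  rw [weight, ENNReal.ofReal_le_one]
  exact inv_le_one_of_one_le₀ (one_le_pow₀ (by linarith [norm_nonneg v]))

theorem weight_le_mul {N : ℕ} {v w : Eu d} {R : ℝ} (hR : 0 ≤ R)
    (h : 1 + ‖w‖ ≤ R * (1 + ‖v‖)) : weight N v ≤ ENNReal.ofReal (R ^ N) * weight N w := by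
  rw [weight, weight, ← ENNReal.ofReal_mul (by positivity)]
  refine ENNReal.ofReal_le_ofReal ?_
  rw [← div_eq_mul_inv, inv_eq_one_div, div_le_div_iff₀ (by positivity) (by positivity), one_mul,
    ← mul_pow]
  gcongr

theorem lintegral_weight_lt_top {N : ℕ} (hN : d < N) : ∫⁻ v : Eu d, weight N v < ⊤ := by
  have := finite_integral_one_add_norm (E := Eu d) (μ := volume) (r := N) (by simpa using hN)
  simpa [weight, Real.rpow_neg_natCast, zpow_neg] using this

theorem lintegral_weight_sub (N : ℕ) (a : Eu d) :
    ∫⁻ v : Eu d, weight N (a - v) = ∫⁻ v : Eu d, weight N v :=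
  lintegral_sub_left_eq_self (fun v => weight N v) a

/-- Neither a change of variables nor surjectivity is needed. With `v₀` minimising `‖F v - y‖` up to
1, expansion gives `‖v₀ - v‖ ≤ L (2 ‖F v - y‖ + 1)`, so the weight at `F v - y` is dominated by a
multiple of the weight at `v₀ - v`. -/
theorem lintegral_weight_le_of_antilipschitz (N : ℕ) {F : Eu d → Eu d} {L : ℝ} (hL : 0 < L)
    (hF : ∀ a b, ‖a - b‖ ≤ L * ‖F a - F b‖) (y : Eu d) :
    ∫⁻ v, weight N (F v - y) ≤ ENNReal.ofReal ((1 + 2 * L) ^ N) * ∫⁻ v : Eu d, weight N v := by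
  obtain ⟨v₀, hv₀⟩ : ∃ v₀, ∀ v, ‖F v₀ - y‖ ≤ ‖F v - y‖ + 1 := by
    obtain ⟨v₀, hv₀⟩ := exists_lt_of_ciInf_lt (f := fun v => ‖F v - y‖)
      (lt_add_one (⨅ v, ‖F v - y‖))
    refine ⟨v₀, fun v => hv₀.le.trans ?_⟩
    gcongr
    exact ciInf_le ⟨0, by rintro _ ⟨v, rfl⟩; positivity⟩ v
  calc _ ≤ ∫⁻ v, ENNReal.ofReal ((1 + 2 * L) ^ N) * weight N (v₀ - v) := by
        refine lintegral_mono fun v => weight_le_mul (by positivity) ?_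
        have h1 : ‖F v₀ - F v‖ ≤ ‖F v₀ - y‖ + ‖F v - y‖ := by
          rw [← sub_sub_sub_cancel_right _ _ y]; exact norm_sub_le _ _
        have h2 := hF v₀ v
        have h3 := hv₀ v
        nlinarith [norm_nonneg (F v - y)]
    _ = _ := by
        have hm : Measurable fun v => weight N (v₀ - v) :=
          ((continuous_weight N).comp (continuous_sub_left v₀)).measurable
        rw [lintegral_const_mul _ hm, lintegral_weight_sub]

end Weights

/-! ### Joint continuity of translation on the Schwartz space -/

section Translation

variable {E : Type*} [NormedAddCommGroup E] [NormedSpace ℝ E]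

theorem tendsto_of_schwartzNorm {α : Type*} {l : Filter α} {u : α → 𝓢(E, ℂ)} {φ : 𝓢(E, ℂ)}
    (h : ∀ M, Filter.Tendsto (fun a => schwartzNorm M (u a - φ)) l (nhds 0)) :
    Filter.Tendsto u l (nhds φ) := by
  rw [(schwartz_withSeminorms ℂ E ℂ).tendsto_nhds]
  rintro ⟨k, n⟩ ε hε
  filter_upwards [(h (max k n)).eventually_lt_const hε] with a ha
  exact (seminorm_le_schwartzNorm (le_max_left k n) (le_max_right k n) _).trans_lt ha

theorem iteratedFDeriv_compSubConst (f : 𝓢(E, ℂ)) (n : ℕ) (a x : E) :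
    iteratedFDeriv ℝ n (SchwartzMap.compSubConstCLM ℂ a f) x = iteratedFDeriv ℝ n f (x - a) := by
  rw [← iteratedFDeriv_comp_sub]
  congr 1

theorem schwartzNorm_translate_le (M : ℕ) (f : 𝓢(E, ℂ)) (a : E) :
    schwartzNorm M (SchwartzMap.compSubConstCLM ℂ a f) ≤
      (1 + ‖a‖) ^ M * (2 ^ M * schwartzNorm M f) := by
  have h0 := schwartzNorm_nonneg M f
  refine schwartzNorm_le (by positivity) fun k hk n hn x => ?_
  rw [iteratedFDeriv_compSubConst]
  have h1 : ‖x‖ ≤ (1 + ‖a‖) * (1 + ‖x - a‖) := by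
    have : ‖x‖ ≤ ‖x - a‖ + ‖a‖ := by simpa using norm_add_le (x - a) a
    nlinarith [norm_nonneg a, norm_nonneg (x - a)]
  calc ‖x‖ ^ k * ‖iteratedFDeriv ℝ n f (x - a)‖
      ≤ ((1 + ‖a‖) * (1 + ‖x - a‖)) ^ k * ‖iteratedFDeriv ℝ n f (x - a)‖ := by gcongr
    _ = (1 + ‖a‖) ^ k * ((1 + ‖x - a‖) ^ k * ‖iteratedFDeriv ℝ n f (x - a)‖) := by
        rw [mul_pow]; ring
    _ ≤ (1 + ‖a‖) ^ M * (2 ^ M * schwartzNorm M f) := by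
        refine mul_le_mul (pow_le_pow_right₀ (by linarith [norm_nonneg a]) hk)
          (one_add_pow_mul_le_schwartzNorm hk hn f _) (by positivity) (by positivity)

/-- Mean value inequality on the segment from `x - b` to `x - a`. It costs one derivative, hence `M
+ 1`, and points `y` of the segment satisfy `1 + ‖x‖ ≤ (1 + ‖a‖ + ‖b‖)(1 + ‖y‖)`. -/
theorem schwartzNorm_translate_sub_le (M : ℕ) (f : 𝓢(E, ℂ)) (a b : E) :
    schwartzNorm M (SchwartzMap.compSubConstCLM ℂ a f - SchwartzMap.compSubConstCLM ℂ b f) ≤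
      (1 + ‖a‖ + ‖b‖) ^ M * (2 ^ (M + 1) * schwartzNorm (M + 1) f) * ‖a - b‖ := by
  have h0 := schwartzNorm_nonneg (M + 1) f
  refine schwartzNorm_le (by positivity) fun k hk n hn x => ?_
  have hs : iteratedFDeriv ℝ n (SchwartzMap.compSubConstCLM ℂ a f -
      SchwartzMap.compSubConstCLM ℂ b f : 𝓢(E, ℂ)) x =
      iteratedFDeriv ℝ n f (x - a) - iteratedFDeriv ℝ n f (x - b) := by
    rw [← iteratedFDeriv_compSubConst, ← iteratedFDeriv_compSubConst]
    have h1 : ContDiff ℝ n (SchwartzMap.compSubConstCLM ℂ a f) :=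
      (SchwartzMap.smooth _ ⊤).of_le (by exact_mod_cast le_top)
    have h2 : ContDiff ℝ n (SchwartzMap.compSubConstCLM ℂ b f) :=
      (SchwartzMap.smooth _ ⊤).of_le (by exact_mod_cast le_top)
    exact iteratedFDeriv_sub_apply h1.contDiffAt h2.contDiffAt
  rw [hs]
  have hd : Differentiable ℝ (iteratedFDeriv ℝ n f) :=
    (f.smooth ⊤).differentiable_iteratedFDeriv (by exact_mod_cast WithTop.coe_lt_top _)
  have hconv : Convex ℝ (segment ℝ (x - b) (x - a)) := convex_segment _ _
  have hmv := hconv.norm_image_sub_le_of_norm_fderiv_le (𝕜 := ℝ)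
    (C := ((1 + ‖a‖ + ‖b‖) ^ M * (2 ^ (M + 1) * schwartzNorm (M + 1) f)) / (1 + ‖x‖) ^ k)
    (fun y _ => hd y) (fun y hy => ?_) (left_mem_segment ℝ _ _) (right_mem_segment ℝ _ _)
  · rw [sub_sub_sub_cancel_left, norm_sub_rev b a] at hmv
    calc _ ≤ (1 + ‖x‖) ^ k * (((1 + ‖a‖ + ‖b‖) ^ M * (2 ^ (M + 1) * schwartzNorm (M + 1) f)) /
          (1 + ‖x‖) ^ k * ‖a - b‖) := by
          gcongr
          linarith
      _ = _ := by field_simp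
  · have hx : ‖x‖ ≤ ‖y‖ + (‖a‖ + ‖b‖) := by
      obtain ⟨s, t, hs, ht, hst, rfl⟩ := hy
      have h1 : x = (s • (x - b) + t • (x - a)) + (s • b + t • a) := by
        have : s • x + t • x = x := by rw [← add_smul, hst, one_smul]
        calc x = s • x + t • x := this.symm
          _ = _ := by module
      calc ‖x‖ = ‖(s • (x - b) + t • (x - a)) + (s • b + t • a)‖ := by rw [← h1]
        _ ≤ ‖s • (x - b) + t • (x - a)‖ + ‖s • b + t • a‖ := norm_add_le _ _
        _ ≤ ‖s • (x - b) + t • (x - a)‖ + (‖a‖ + ‖b‖) := by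
          gcongr
          refine (norm_add_le _ _).trans ?_
          rw [norm_smul, norm_smul, Real.norm_of_nonneg hs, Real.norm_of_nonneg ht]
          nlinarith [norm_nonneg a, norm_nonneg b]
    rw [le_div_iff₀ (by positivity), ← norm_iteratedFDeriv_one, norm_iteratedFDeriv_one,
      norm_fderiv_iteratedFDeriv, mul_comm]
    have h1 : 1 + ‖x‖ ≤ (1 + ‖a‖ + ‖b‖) * (1 + ‖y‖) := by
      nlinarith [norm_nonneg a, norm_nonneg b, norm_nonneg y]
    calc (1 + ‖x‖) ^ k * ‖iteratedFDeriv ℝ (n + 1) f y‖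
        ≤ ((1 + ‖a‖ + ‖b‖) * (1 + ‖y‖)) ^ k * ‖iteratedFDeriv ℝ (n + 1) f y‖ := by gcongr
      _ = (1 + ‖a‖ + ‖b‖) ^ k * ((1 + ‖y‖) ^ k * ‖iteratedFDeriv ℝ (n + 1) f y‖) := by
          rw [mul_pow]; ring
      _ ≤ _ := by
          refine mul_le_mul (pow_le_pow_right₀ (by linarith [norm_nonneg a, norm_nonneg b]) hk)
            (one_add_pow_mul_le_schwartzNorm (by omega) (by omega) f _) (by positivity)
            (by positivity)

/-- Both arguments vary because a modulation is later treated as the translation of a moving Fourier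
transform. -/
theorem continuous_translate :
    Continuous fun z : E × 𝓢(E, ℂ) => SchwartzMap.compSubConstCLM ℂ z.1 z.2 := by
  refine continuous_iff_continuousAt.2 fun z₀ => tendsto_of_schwartzNorm fun M => ?_
  have hc : Continuous fun z : E × 𝓢(E, ℂ) =>
      (1 + ‖z.1‖) ^ M * (2 ^ M * schwartzNorm M (z.2 - z₀.2)) +
      (1 + ‖z.1‖ + ‖z₀.1‖) ^ M * (2 ^ (M + 1) * schwartzNorm (M + 1) z₀.2) * ‖z.1 - z₀.1‖ := by
    have := continuous_schwartzNorm (E := E) M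
    fun_prop
  have h0 := hc.tendsto z₀
  simp only [sub_self, map_zero, mul_zero, norm_zero, add_zero] at h0
  refine squeeze_zero (fun z => schwartzNorm_nonneg _ _) (fun z => ?_) h0
  have h1 : SchwartzMap.compSubConstCLM ℂ z.1 z.2 - SchwartzMap.compSubConstCLM ℂ z₀.1 z₀.2 =
      SchwartzMap.compSubConstCLM ℂ z.1 (z.2 - z₀.2) +
      (SchwartzMap.compSubConstCLM ℂ z.1 z₀.2 - SchwartzMap.compSubConstCLM ℂ z₀.1 z₀.2) := by
    rw [map_sub]; abel
  rw [h1]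
  refine (map_add_le_add _ _ _).trans (add_le_add ?_ ?_)
  · exact schwartzNorm_translate_le _ _ _
  · exact schwartzNorm_translate_sub_le _ _ _ _

end Translation

/-! ### Continuity of time-frequency shifts and of the short-time Fourier transform -/

section TimeFrequency

variable {d : ℕ}

theorem character_zero_left (t : Eu d) : character 0 t = 1 := by simp [character]

theorem timeFreqShift_zero (g : 𝓢(Eu d, ℂ)) : timeFreqShift g 0 0 = g := by
  ext t; simp [timeFreqShift_apply, character_zero_left]

/-- On the Fourier side modulation is translation, so continuity of the shifts reduces to that of
translation. -/
theorem timeFreqShift_eq_fourierInv (g : 𝓢(Eu d, ℂ)) (x ξ : Eu d) :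
    timeFreqShift g x ξ =
      𝓕⁻ (SchwartzMap.compSubConstCLM ℂ ξ (𝓕 (SchwartzMap.compSubConstCLM ℂ x g))) := by
  have h1 : SchwartzMap.compSubConstCLM ℂ x g = timeFreqShift g x 0 := by
    ext t; simp [timeFreqShift_apply, character_zero_left]
  have h2 : 𝓕 (timeFreqShift g x ξ) =
      SchwartzMap.compSubConstCLM ℂ ξ (𝓕 (SchwartzMap.compSubConstCLM ℂ x g)) := by
    ext η
    rw [SchwartzMap.compSubConstCLM_apply, h1, fourier_timeFreqShift, fourier_timeFreqShift,
      sub_zero]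
  rw [← h2, FourierTransform.fourierInv_fourier_eq]

theorem continuous_timeFreqShift :
    Continuous fun z : (Eu d × Eu d) × 𝓢(Eu d, ℂ) => timeFreqShift z.2 z.1.1 z.1.2 := by
  simp_rw [timeFreqShift_eq_fourierInv]
  have h1 : Continuous fun z : (Eu d × Eu d) × 𝓢(Eu d, ℂ) =>
      SchwartzMap.compSubConstCLM ℂ z.1.1 z.2 :=
    continuous_translate.comp (by fun_prop : Continuous fun z : (Eu d × Eu d) × 𝓢(Eu d, ℂ) => (z.1.1, z.2))
  have h2 := (FourierTransform.continuous_fourier (E := 𝓢(Eu d, ℂ)) (F := 𝓢(Eu d, ℂ))).comp h1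
  exact (FourierTransform.continuous_fourierInv (E := 𝓢(Eu d, ℂ)) (F := 𝓢(Eu d, ℂ))).comp
    (continuous_translate.comp ((by fun_prop : Continuous fun z : (Eu d × Eu d) × 𝓢(Eu d, ℂ) => z.1.2).prodMk h2))

theorem continuous_timeFreqShift_left (g : 𝓢(Eu d, ℂ)) :
    Continuous fun z : Eu d × Eu d => timeFreqShift g z.1 z.2 := by
  have h : Continuous fun z : Eu d × Eu d => (z, g) := by fun_prop
  have h2 := (continuous_timeFreqShift (d := d)).comp h
  exact h2

theorem continuous_conj : Continuous (conj (d := d)) := by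
  unfold conj
  exact ContinuousLinearMap.continuous _

theorem continuous_stft (g : 𝓢(Eu d, ℂ)) (f : 𝓢'(Eu d, ℂ)) :
    Continuous fun z : Eu d × Eu d => stft g f z.1 z.2 :=
  (map_continuous f).comp (continuous_conj.comp (continuous_timeFreqShift_left g))

theorem stft_add (g : 𝓢(Eu d, ℂ)) (f f' : 𝓢'(Eu d, ℂ)) (x ξ : Eu d) :
    stft g (f + f') x ξ = stft g f x ξ + stft g f' x ξ := rfl

theorem stft_sub (g : 𝓢(Eu d, ℂ)) (f f' : 𝓢'(Eu d, ℂ)) (x ξ : Eu d) :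
    stft g (f - f') x ξ = stft g f x ξ - stft g f' x ξ := rfl

theorem stft_smul (g : 𝓢(Eu d, ℂ)) (c : ℂ) (f : 𝓢'(Eu d, ℂ)) (x ξ : Eu d) :
    stft g (c • f) x ξ = c * stft g f x ξ := rfl

theorem stft_coe (g φ : 𝓢(Eu d, ℂ)) (x ξ : Eu d) :
    stft g (φ : 𝓢'(Eu d, ℂ)) x ξ = ∫ t, φ t * (starRingEnd ℂ) (timeFreqShift g x ξ t) := by
  simp [stft, SchwartzMap.toTemperedDistributionCLM_apply_apply, conj_apply, mul_comm]

theorem stft_coe_fourier (g φ : 𝓢(Eu d, ℂ)) (x ξ : Eu d) :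
    stft g (φ : 𝓢'(Eu d, ℂ)) x ξ =
      ∫ η, 𝓕 φ η * (starRingEnd ℂ) (𝓕 (timeFreqShift g x ξ) η) := by
  rw [stft_coe]
  have := SchwartzMap.integral_inner_fourier_fourier (timeFreqShift g x ξ) φ
  simpa using this.symm

end TimeFrequency

/-! ### Decay and covariance of the short-time Fourier transform -/

section Decay

variable {d : ℕ}

theorem one_add_norm_pow_mul_norm_apply_le (M : ℕ) (φ : 𝓢(Eu d, ℂ)) (t : Eu d) :
    (1 + ‖t‖) ^ M * ‖φ t‖ ≤ 2 ^ M * schwartzNorm M φ := by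
  simpa using one_add_pow_mul_le_schwartzNorm (n := 0) le_rfl (Nat.zero_le M) φ t

/-- Integrals dominated by the product of a Schwartz function and a translate of another one decay
rapidly in the translation parameter. -/
theorem exists_translate_integral_bound (K : ℕ) (g : 𝓢(Eu d, ℂ)) :
    ∃ C : ℝ, 0 ≤ C ∧ ∃ M : ℕ, ∀ (φ : 𝓢(Eu d, ℂ)) (x : Eu d) (F : Eu d → ℂ),
      (∀ t, ‖F t‖ ≤ ‖φ t‖ * ‖g (t - x)‖) → (1 + ‖x‖) ^ K * ‖∫ t, F t‖ ≤ C * schwartzNorm M φ := by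
  have hint : Integrable (fun t : Eu d => (1 + ‖t‖) ^ (-((d + 1 : ℕ) : ℝ))) volume :=
    integrable_one_add_norm (by simp)
  set J := ∫ t : Eu d, (1 + ‖t‖) ^ (-((d + 1 : ℕ) : ℝ)) with hJ
  have hJ0 : 0 ≤ J := integral_nonneg fun t => by positivity
  have hg0 := schwartzNorm_nonneg K g
  refine ⟨2 ^ (K + (d + 1)) * (2 ^ K * schwartzNorm K g) * J, by positivity, K + (d + 1),
    fun φ x F hF => ?_⟩
  have hφ0 := schwartzNorm_nonneg (K + (d + 1)) φ
  have hb : ∀ t, ‖F t‖ ≤ (2 ^ (K + (d + 1)) * schwartzNorm (K + (d + 1)) φ *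
      (2 ^ K * schwartzNorm K g) / (1 + ‖x‖) ^ K) * (1 + ‖t‖) ^ (-((d + 1 : ℕ) : ℝ)) := by
    intro t
    have h1 := one_add_norm_pow_mul_norm_apply_le (K + (d + 1)) φ t
    have h2 := one_add_norm_pow_mul_norm_apply_le K g (t - x)
    -- The `K` powers of `1 + ‖x‖` are paid by both functions; the remaining `d + 1` powers on `φ`
    -- make the integral converge.
    have h3 : 1 + ‖x‖ ≤ (1 + ‖t‖) * (1 + ‖t - x‖) := by
      have : ‖x‖ ≤ ‖t‖ + ‖t - x‖ := by
        simpa using norm_sub_le t (t - x)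
      nlinarith [norm_nonneg t, norm_nonneg (t - x)]
    rw [Real.rpow_neg (by positivity), Real.rpow_natCast, ← div_eq_mul_inv, div_div,
      le_div_iff₀ (by positivity)]
    calc ‖F t‖ * ((1 + ‖x‖) ^ K * (1 + ‖t‖) ^ (d + 1))
        ≤ (‖φ t‖ * ‖g (t - x)‖) * (((1 + ‖t‖) * (1 + ‖t - x‖)) ^ K * (1 + ‖t‖) ^ (d + 1)) := by
          gcongr
          exact hF t
      _ = ((1 + ‖t‖) ^ (K + (d + 1)) * ‖φ t‖) * ((1 + ‖t - x‖) ^ K * ‖g (t - x)‖) := by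
          rw [mul_pow, pow_add]; ring
      _ ≤ _ := mul_le_mul h1 h2 (by positivity) (by positivity)
  have h := norm_integral_le_of_norm_le (hint.const_mul _) (Filter.Eventually.of_forall hb)
  rw [integral_const_mul, ← hJ] at h
  calc _ ≤ (1 + ‖x‖) ^ K * ((2 ^ (K + (d + 1)) * schwartzNorm (K + (d + 1)) φ *
      (2 ^ K * schwartzNorm K g) / (1 + ‖x‖) ^ K) * J) := by gcongr
    _ = _ := by field_simp

theorem norm_timeFreqShift_apply (g : 𝓢(Eu d, ℂ)) (x ξ t : Eu d) :
    ‖timeFreqShift g x ξ t‖ = ‖g (t - x)‖ := by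
  rw [timeFreqShift_apply, norm_mul, norm_character, one_mul]

theorem norm_fourier_timeFreqShift_apply (g : 𝓢(Eu d, ℂ)) (x ξ η : Eu d) :
    ‖𝓕 (timeFreqShift g x ξ) η‖ = ‖𝓕 g (η - ξ)‖ := by
  rw [fourier_timeFreqShift, norm_mul, norm_character, one_mul]

/-- The short-time Fourier transform of a Schwartz function decays rapidly. -/
theorem exists_stft_decay (K : ℕ) (g : 𝓢(Eu d, ℂ)) :
    ∃ C : ℝ, 0 ≤ C ∧ ∃ M : ℕ, ∀ (φ : 𝓢(Eu d, ℂ)) (x ξ : Eu d),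
      (1 + ‖x‖) ^ K * (1 + ‖ξ‖) ^ K * ‖stft g (φ : 𝓢'(Eu d, ℂ)) x ξ‖ ≤
        C * (schwartzNorm M φ + schwartzNorm M (𝓕 φ)) := by
  obtain ⟨C₁, hC₁, M₁, h₁⟩ := exists_translate_integral_bound (2 * K) g
  obtain ⟨C₂, hC₂, M₂, h₂⟩ := exists_translate_integral_bound (2 * K) (𝓕 g)
  refine ⟨C₁ + C₂, by positivity, max M₁ M₂, fun φ x ξ => ?_⟩
  set X := ‖stft g (φ : 𝓢'(Eu d, ℂ)) x ξ‖ with hX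
  have hX0 : 0 ≤ X := norm_nonneg _
  -- Decay in `x` is read off the pairing in time, decay in `ξ` off its Parseval form in frequency.
  -- Each has `2 * K` powers, so that the larger factor can carry both weights.
  have a1 : (1 + ‖x‖) ^ (2 * K) * X ≤ C₁ * schwartzNorm M₁ φ := by
    rw [hX, stft_coe]
    refine h₁ φ x _ fun t => ?_
    rw [norm_mul, RCLike.norm_conj, norm_timeFreqShift_apply]
  have a2 : (1 + ‖ξ‖) ^ (2 * K) * X ≤ C₂ * schwartzNorm M₂ (𝓕 φ) := by
    rw [hX, stft_coe_fourier]
    refine h₂ (𝓕 φ) ξ _ fun t => ?_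
    rw [norm_mul, RCLike.norm_conj, norm_fourier_timeFreqShift_apply]
  have b1 := schwartzNorm_mono (le_max_left M₁ M₂) φ
  have b2 := schwartzNorm_mono (le_max_right M₁ M₂) (𝓕 φ)
  have c1 := schwartzNorm_nonneg (max M₁ M₂) φ
  have c2 := schwartzNorm_nonneg (max M₁ M₂) (𝓕 φ)
  set a := 1 + ‖x‖
  set b := 1 + ‖ξ‖
  have ha : 0 ≤ a := by positivity
  have hb : 0 ≤ b := by positivity
  rcases le_total a b with hab | hab
  · calc a ^ K * b ^ K * X ≤ b ^ K * b ^ K * X := by gcongr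
      _ = b ^ (2 * K) * X := by rw [two_mul, pow_add]
      _ ≤ C₂ * schwartzNorm (max M₁ M₂) (𝓕 φ) := a2.trans (by gcongr)
      _ ≤ _ := by nlinarith [mul_nonneg hC₁ c1, mul_nonneg hC₁ c2, mul_nonneg hC₂ c1]
  · calc a ^ K * b ^ K * X ≤ a ^ K * a ^ K * X := by gcongr
      _ = a ^ (2 * K) * X := by rw [two_mul, pow_add]
      _ ≤ C₁ * schwartzNorm (max M₁ M₂) φ := a1.trans (by gcongr)
      _ ≤ _ := by nlinarith [mul_nonneg hC₁ c2, mul_nonneg hC₂ c1, mul_nonneg hC₂ c2]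

theorem exists_enorm_stft_le (N : ℕ) (g : 𝓢(Eu d, ℂ)) :
    ∃ C : ℝ, 0 ≤ C ∧ ∃ M : ℕ, ∀ (φ : 𝓢(Eu d, ℂ)) (x ξ : Eu d),
      ‖stft g (φ : 𝓢'(Eu d, ℂ)) x ξ‖ₑ ≤
        ENNReal.ofReal (C * (schwartzNorm M φ + schwartzNorm M (𝓕 φ))) *
          (weight N x * weight N ξ) := by
  obtain ⟨C, hC, M, h⟩ := exists_stft_decay N g
  refine ⟨C, hC, M, fun φ x ξ => ?_⟩
  have h0 := schwartzNorm_nonneg M φ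
  have h1 := schwartzNorm_nonneg M (𝓕 φ)
  rw [weight, weight, ← ENNReal.ofReal_mul (by positivity), ← ENNReal.ofReal_mul (by positivity),
    ← ofReal_norm]
  refine ENNReal.ofReal_le_ofReal ?_
  rw [← mul_inv, ← div_eq_mul_inv, le_div_iff₀ (by positivity), mul_comm]
  exact h φ x ξ

theorem character_add_left (η η' t : Eu d) :
    character (η + η') t = character η t * character η' t := by
  simp only [character, ← Complex.exp_add, inner_add_left]
  congr 1; push_cast; ring

theorem character_add_right (η t t' : Eu d) :
    character η (t + t') = character η t * character η t' := by
  simp only [character, ← Complex.exp_add, inner_add_right]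
  congr 1; push_cast; ring

theorem conj_character (η t : Eu d) : (starRingEnd ℂ) (character η t) = character (-η) t := by
  rw [character, character, ← Complex.exp_conj]
  congr 1
  simp only [map_mul, map_ofNat, Complex.conj_ofReal, Complex.conj_I, inner_neg_left]
  push_cast; ring

/-- Covariance: up to a phase, shifting `h` translates its short-time Fourier transform, so a bound
for `h` becomes uniform over all its shifts. -/
theorem norm_stft_timeFreqShift (g h : 𝓢(Eu d, ℂ)) (x ξ x' ξ' : Eu d) :
    ‖stft g (timeFreqShift h x ξ : 𝓢'(Eu d, ℂ)) x' ξ'‖ =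
      ‖stft g (h : 𝓢'(Eu d, ℂ)) (x' - x) (ξ' - ξ)‖ := by
  rw [stft_coe, stft_coe, ← integral_add_right_eq_self _ x]
  have key : ∀ t, timeFreqShift h x ξ (t + x) *
      (starRingEnd ℂ) (timeFreqShift g x' ξ' (t + x)) = character (ξ - ξ') x *
        (h t * (starRingEnd ℂ) (timeFreqShift g (x' - x) (ξ' - ξ) t)) := by
    intro t
    simp only [timeFreqShift_apply, map_mul, conj_character, add_sub_cancel_right]
    rw [show t - (x' - x) = t + x - x' by abel, sub_eq_add_neg, neg_sub, sub_eq_add_neg]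
    simp only [character_add_left, character_add_right]
    ring
  simp_rw [key]
  rw [integral_const_mul, norm_mul, norm_character, one_mul]

end Decay

/-! ### The modulation norm: finiteness and norm inequalities -/

section ModNorm

variable {d : ℕ}

theorem modNorm_eq_mixedNorm (g : 𝓢(Eu d, ℂ)) (p q : ℝ≥0∞) (f : 𝓢'(Eu d, ℂ)) :
    modNorm g p q f = mixedNorm volume volume p q fun x ξ => ‖stft g f x ξ‖ₑ := by
  simp [modNorm, mixedNorm, eLpNorm_enorm]

theorem eLpNorm_weight_lt_top {N : ℕ} (hN : d < N) {p : ℝ≥0∞} (hp : 1 ≤ p) :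
    eLpNorm (weight (d := d) N) p volume < ⊤ := by
  rcases eq_or_ne p ⊤ with rfl | hp'
  · exact (eLpNorm_top_le_iff.2 (Filter.Eventually.of_forall (weight_le_one N))).trans_lt
      ENNReal.one_lt_top
  · have hp1 : 1 ≤ p.toReal := by
      rw [← ENNReal.toReal_one]; exact ENNReal.toReal_mono hp' hp
    rw [eLpNorm_ennreal_eq_lintegral (zero_lt_one.trans_le hp).ne' hp']
    refine ENNReal.rpow_lt_top_of_nonneg (by positivity) (ne_of_lt ?_)
    exact (lintegral_mono fun x => ENNReal.rpow_le_self_of_le_one (weight_le_one N x) hp1).trans_lt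
      (lintegral_weight_lt_top hN)

theorem eLpNorm_le_mul_ennreal {α : Type*} [MeasurableSpace α] {μ : Measure α} {p c : ℝ≥0∞}
    {f g : α → ℝ≥0∞} (hg : Measurable g) (h : ∀ x, f x ≤ c * g x) :
    eLpNorm f p μ ≤ c * eLpNorm g p μ :=
  eLpNorm_le_mul_eLpNorm_of_ae_le_mul'' p hg.aestronglyMeasurable
    (Filter.Eventually.of_forall (by simpa using h))

theorem modNorm_le_of_weight {g : 𝓢(Eu d, ℂ)} {f : 𝓢'(Eu d, ℂ)} {N : ℕ} {c : ℝ≥0∞}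
    {x₀ ξ₀ : Eu d} (h : ∀ x ξ, ‖stft g f x ξ‖ₑ ≤ c * (weight N (x - x₀) * weight N (ξ - ξ₀)))
    (p q : ℝ≥0∞) :
    modNorm g p q f ≤ c * (eLpNorm (weight (d := d) N) p volume *
      eLpNorm (weight (d := d) N) q volume) := by
  have hw : Measurable (weight (d := d) N) := (continuous_weight N).measurable
  have ht : ∀ (r : ℝ≥0∞) (a : Eu d), eLpNorm (fun x => weight N (x - a)) r volume =
      eLpNorm (weight N) r volume := fun r a =>
    eLpNorm_comp_measurePreserving hw.aestronglyMeasurable (measurePreserving_sub_right volume a)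
  rw [modNorm_eq_mixedNorm, mixedNorm]
  rw [← ht q ξ₀, ← ht p x₀, ← mul_assoc]
  refine eLpNorm_le_mul_ennreal (by fun_prop) fun ξ => ?_
  refine (eLpNorm_le_mul_ennreal (c := c * weight N (ξ - ξ₀))
    (g := fun x => weight N (x - x₀)) (by fun_prop) fun x => (h x ξ).trans_eq (by ring)).trans_eq ?_
  ring

theorem exists_modNorm_coe_le {N : ℕ} (g : 𝓢(Eu d, ℂ)) :
    ∃ C : ℝ, 0 ≤ C ∧ ∃ M : ℕ, ∀ (p q : ℝ≥0∞) (φ : 𝓢(Eu d, ℂ)),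
      modNorm g p q (φ : 𝓢'(Eu d, ℂ)) ≤
        ENNReal.ofReal (C * (schwartzNorm M φ + schwartzNorm M (𝓕 φ))) *
          (eLpNorm (weight (d := d) N) p volume * eLpNorm (weight (d := d) N) q volume) := by
  obtain ⟨C, hC, M, h⟩ := exists_enorm_stft_le N g
  exact ⟨C, hC, M, fun p q φ => modNorm_le_of_weight (x₀ := 0) (ξ₀ := 0)
    (fun x ξ => by simpa using h φ x ξ) p q⟩

/-- By covariance the norm of the translated weights does not depend on the shift. This bound later
dominates the errors of Riemann sums. -/
theorem exists_modNorm_timeFreqShift_le (g : 𝓢(Eu d, ℂ)) {p q : ℝ≥0∞} (hp : 1 ≤ p) (hq : 1 ≤ q) :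
    ∃ K : ℝ≥0∞, K < ⊤ ∧ ∀ x ξ, modNorm g p q (timeFreqShift g x ξ : 𝓢'(Eu d, ℂ)) ≤ K := by
  obtain ⟨C, hC, M, h⟩ := exists_enorm_stft_le (d + 1) g
  refine ⟨ENNReal.ofReal (C * (schwartzNorm M g + schwartzNorm M (𝓕 g))) *
      (eLpNorm (weight (d := d) (d + 1)) p volume * eLpNorm (weight (d := d) (d + 1)) q volume), ?_,
    fun x ξ => modNorm_le_of_weight (N := d + 1) (x₀ := x) (ξ₀ := ξ) (fun x' ξ' => ?_) p q⟩
  · exact ENNReal.mul_lt_top ENNReal.ofReal_lt_top (ENNReal.mul_lt_top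
      (eLpNorm_weight_lt_top (Nat.lt_succ_self d) hp) (eLpNorm_weight_lt_top (Nat.lt_succ_self d) hq))
  · rw [← ofReal_norm, norm_stft_timeFreqShift, ofReal_norm]
    exact h g _ _

theorem modNorm_coe_lt_top (g φ : 𝓢(Eu d, ℂ)) {p q : ℝ≥0∞} (hp : 1 ≤ p) (hq : 1 ≤ q) :
    modNorm g p q (φ : 𝓢'(Eu d, ℂ)) < ⊤ := by
  obtain ⟨C, hC, M, h⟩ := exists_modNorm_coe_le (N := d + 1) g
  exact (h p q φ).trans_lt (ENNReal.mul_lt_top ENNReal.ofReal_lt_top (ENNReal.mul_lt_top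
      (eLpNorm_weight_lt_top (Nat.lt_succ_self d) hp)
      (eLpNorm_weight_lt_top (Nat.lt_succ_self d) hq)))

theorem measurable_enorm_stft (g : 𝓢(Eu d, ℂ)) (f : 𝓢'(Eu d, ℂ)) :
    Measurable (Function.uncurry fun x ξ => ‖stft g f x ξ‖ₑ) :=
  (continuous_stft g f).measurable.enorm

theorem measurable_enorm_stft_left (g : 𝓢(Eu d, ℂ)) (f : 𝓢'(Eu d, ℂ)) (ξ : Eu d) :
    Measurable fun x => ‖stft g f x ξ‖ₑ := by
  have h : Measurable fun x : Eu d => (x, ξ) := by fun_prop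
  have h2 := (measurable_enorm_stft g f).comp h
  exact h2

theorem modNorm_add_le (g : 𝓢(Eu d, ℂ)) {p q : ℝ≥0∞} (hp : 1 ≤ p) (hq : 1 ≤ q)
    (f f' : 𝓢'(Eu d, ℂ)) : modNorm g p q (f + f') ≤ modNorm g p q f + modNorm g p q f' := by
  simp_rw [modNorm_eq_mixedNorm]
  have hm : ∀ f : 𝓢'(Eu d, ℂ), Measurable fun ξ => eLpNorm (fun x => ‖stft g f x ξ‖ₑ) p volume :=
    fun f => measurable_eLpNorm_right (measurable_enorm_stft g f) p
  have h1 : ∀ ξ, eLpNorm (fun x => ‖stft g (f + f') x ξ‖ₑ) p volume ≤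
      eLpNorm (fun x => ‖stft g f x ξ‖ₑ) p volume +
        eLpNorm (fun x => ‖stft g f' x ξ‖ₑ) p volume := by
    intro ξ
    have h2 := eLpNorm_add_le (μ := volume) (measurable_enorm_stft_left g f ξ).aestronglyMeasurable
      (measurable_enorm_stft_left g f' ξ).aestronglyMeasurable hp
    refine le_trans (eLpNorm_mono_ennreal fun x => ?_) h2
    rw [stft_add]
    exact enorm_add_le _ _
  have h3 := eLpNorm_add_le (μ := volume) (hm f).aestronglyMeasurable (hm f').aestronglyMeasurable hq
  exact le_trans (eLpNorm_mono_ennreal h1) h3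

theorem modNorm_smul_le (g : 𝓢(Eu d, ℂ)) (p q : ℝ≥0∞) (c : ℂ) (f : 𝓢'(Eu d, ℂ)) :
    modNorm g p q (c • f) ≤ ‖c‖ₑ * modNorm g p q f := by
  simp_rw [modNorm_eq_mixedNorm]
  refine eLpNorm_le_mul_ennreal (measurable_eLpNorm_right (measurable_enorm_stft g f) p) fun ξ => ?_
  refine eLpNorm_le_mul_ennreal (measurable_enorm_stft_left g f ξ) fun x => ?_
  exact (enorm_mul _ _).le

theorem modNorm_zero (g : 𝓢(Eu d, ℂ)) (p q : ℝ≥0∞) : modNorm g p q 0 = 0 := by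
  have h : ∀ x ξ, stft g 0 x ξ = 0 := fun _ _ => rfl
  simp [modNorm, h]

end ModNorm

/-! ### Inversion and reproducing formulas -/

section Inversion

variable {d : ℕ}

/-- The constant `∫ |g|²` of the inversion formula. -/
def windowEnergy (g : 𝓢(Eu d, ℂ)) : ℂ := ∫ t, g t * (starRingEnd ℂ) (g t)

theorem windowEnergy_eq (g : 𝓢(Eu d, ℂ)) : windowEnergy g = ((∫ t, ‖g t‖ ^ 2 : ℝ) : ℂ) := by
  rw [windowEnergy, ← integral_complex_ofReal]
  refine integral_congr_ae (Filter.Eventually.of_forall fun t => ?_)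
  simp [Complex.mul_conj, Complex.normSq_eq_norm_sq]

theorem conj_windowEnergy (g : 𝓢(Eu d, ℂ)) : (starRingEnd ℂ) (windowEnergy g) = windowEnergy g := by
  rw [windowEnergy_eq, Complex.conj_ofReal]

theorem windowEnergy_ne_zero {g : 𝓢(Eu d, ℂ)} (hg : g ≠ 0) : windowEnergy g ≠ 0 := by
  rw [windowEnergy_eq]
  intro h
  have h0 : ∫ t, ‖g t‖ ^ 2 = 0 := by exact_mod_cast h
  have hint : Integrable (fun t => ‖g t‖ ^ 2) volume := (g.memLp 2 volume).integrable_norm_pow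
    (by norm_num)
  rw [integral_eq_zero_iff_of_nonneg (fun t => by positivity) hint] at h0
  have hc : Continuous fun t => ‖g t‖ ^ 2 := by fun_prop
  have h1 := (hc.ae_eq_iff_eq volume (continuous_const (y := (0 : ℝ)))).1 h0
  refine hg (DFunLike.ext _ _ fun t => ?_)
  have := congrFun h1 t
  simpa using this

theorem stft_eq_fourier (g φ : 𝓢(Eu d, ℂ)) (x ξ : Eu d) :
    stft g (φ : 𝓢'(Eu d, ℂ)) x ξ =
      𝓕 (SchwartzMap.pairing (ContinuousLinearMap.mul ℂ ℂ) φ (conj (timeFreqShift g x 0))) ξ := by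
  rw [stft_coe, SchwartzMap.fourier_coe, Real.fourier_eq']
  refine integral_congr_ae (Filter.Eventually.of_forall fun t => ?_)
  simp only [SchwartzMap.pairing_apply_apply, ContinuousLinearMap.mul_apply', smul_eq_mul,
    conj_apply, timeFreqShift_apply, map_mul, conj_character, character_zero_left, one_mul]
  rw [← mul_assoc, mul_comm (φ t), mul_assoc]
  congr 1
  rw [character, inner_neg_left, real_inner_comm]
  congr 1
  push_cast
  ring

/-- For fixed `x` the short-time Fourier transform is the Fourier transform in `ξ` of `φ` times the
conjugate of the translated window; this is Fourier inversion. -/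
theorem integral_stft_mul_character (g φ : 𝓢(Eu d, ℂ)) (x t : Eu d) :
    ∫ ξ, stft g (φ : 𝓢'(Eu d, ℂ)) x ξ * character ξ t = φ t * (starRingEnd ℂ) (g (t - x)) := by
  set Ψ := SchwartzMap.pairing (ContinuousLinearMap.mul ℂ ℂ) φ (conj (timeFreqShift g x 0)) with hΨ
  have h1 : 𝓕⁻ (𝓕 Ψ) t = Ψ t := by rw [FourierTransform.fourierInv_fourier_eq]
  have h2 : Ψ t = φ t * (starRingEnd ℂ) (g (t - x)) := by
    simp [hΨ, conj_apply, timeFreqShift_apply, character_zero_left]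
  rw [← h2, ← h1, SchwartzMap.fourierInv_coe, Real.fourierInv_eq']
  refine integral_congr_ae (Filter.Eventually.of_forall fun ξ => ?_)
  simp only [stft_eq_fourier, smul_eq_mul, ← hΨ]
  rw [mul_comm, character]
  congr 2
  push_cast
  ring

theorem integrable_stft (g φ : 𝓢(Eu d, ℂ)) :
    Integrable (fun z : Eu d × Eu d => stft g (φ : 𝓢'(Eu d, ℂ)) z.1 z.2) volume := by
  refine ⟨(continuous_stft g _).aestronglyMeasurable, ?_⟩
  obtain ⟨C, hC, M, h⟩ := exists_enorm_stft_le (d + 1) g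
  rw [hasFiniteIntegral_iff_enorm]
  have hw : Measurable (weight (d := d) (d + 1)) := (continuous_weight _).measurable
  refine (lintegral_mono fun z : Eu d × Eu d => h φ z.1 z.2).trans_lt ?_
  rw [lintegral_const_mul _ (by fun_prop), Measure.volume_eq_prod,
    lintegral_prod_mul hw.aemeasurable hw.aemeasurable]
  exact ENNReal.mul_lt_top ENNReal.ofReal_lt_top
    (ENNReal.mul_lt_top (lintegral_weight_lt_top (Nat.lt_succ_self d))
      (lintegral_weight_lt_top (Nat.lt_succ_self d)))

theorem continuous_timeFreqShift_apply (g : 𝓢(Eu d, ℂ)) :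
    Continuous fun w : (Eu d × Eu d) × Eu d => timeFreqShift g w.1.1 w.1.2 w.2 := by
  simp_rw [timeFreqShift_apply]
  unfold character
  fun_prop

theorem exists_norm_timeFreqShift_apply_le (g : 𝓢(Eu d, ℂ)) :
    ∃ B : ℝ, 0 ≤ B ∧ ∀ x ξ t, ‖timeFreqShift g x ξ t‖ ≤ B := by
  have h0 := schwartzNorm_nonneg 0 g
  refine ⟨schwartzNorm 0 g, h0, fun x ξ t => ?_⟩
  rw [norm_timeFreqShift_apply]
  simpa using one_add_norm_pow_mul_norm_apply_le 0 g (t - x)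

/-- The pointwise inversion formula of the short-time Fourier transform. -/
theorem integral_stft_mul_timeFreqShift (g φ : 𝓢(Eu d, ℂ)) (t : Eu d) :
    ∫ z : Eu d × Eu d, stft g (φ : 𝓢'(Eu d, ℂ)) z.1 z.2 * timeFreqShift g z.1 z.2 t =
      windowEnergy g * φ t := by
  obtain ⟨B, hB, hb⟩ := exists_norm_timeFreqShift_apply_le g
  have hint : Integrable (fun z : Eu d × Eu d =>
      stft g (φ : 𝓢'(Eu d, ℂ)) z.1 z.2 * timeFreqShift g z.1 z.2 t) (volume.prod volume) := by
    refine (integrable_stft g φ).mul_bdd (c := B) ?_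
      (Filter.Eventually.of_forall fun z => hb z.1 z.2 t)
    have h : Continuous fun z : Eu d × Eu d => (z, t) := by fun_prop
    have h2 := (continuous_timeFreqShift_apply g).comp h
    exact Continuous.aestronglyMeasurable h2
  rw [Measure.volume_eq_prod, integral_prod _ hint]
  have h1 : ∀ x, ∫ ξ, stft g (φ : 𝓢'(Eu d, ℂ)) x ξ * timeFreqShift g x ξ t =
      φ t * (g (t - x) * (starRingEnd ℂ) (g (t - x))) := by
    intro x
    simp_rw [timeFreqShift_apply, ← mul_assoc]
    rw [integral_mul_const, integral_stft_mul_character]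
    ring
  simp only [h1]
  rw [integral_const_mul, integral_sub_left_eq_self (fun x => g x * (starRingEnd ℂ) (g x)),
    mul_comm, windowEnergy]

/-- Majorant |V_gφ(x,ξ)| B |g(t - x)|: integrating in `t` leaves a multiple of |V_gφ|, which is
integrable. This justifies Fubini in the tested inversion formula. -/
theorem integrable_stft_mul_timeFreqShift (g φ : 𝓢(Eu d, ℂ)) {u : Eu d → ℂ}
    (hu : AEStronglyMeasurable u volume) {B : ℝ} (hB : ∀ᵐ t, ‖u t‖ ≤ B) :
    Integrable (Function.uncurry fun (z : Eu d × Eu d) (t : Eu d) =>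
      stft g (φ : 𝓢'(Eu d, ℂ)) z.1 z.2 * (u t * timeFreqShift g z.1 z.2 t))
      ((volume : Measure (Eu d × Eu d)).prod volume) := by
  have hmV : AEStronglyMeasurable (fun w : (Eu d × Eu d) × Eu d =>
      stft g (φ : 𝓢'(Eu d, ℂ)) w.1.1 w.1.2) ((volume : Measure (Eu d × Eu d)).prod volume) :=
    (integrable_stft g φ).aestronglyMeasurable.comp_fst
  have hmu : AEStronglyMeasurable (fun w : (Eu d × Eu d) × Eu d => u w.2)
      ((volume : Measure (Eu d × Eu d)).prod volume) := hu.comp_snd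
  have hmπ : AEStronglyMeasurable (fun w : (Eu d × Eu d) × Eu d => timeFreqShift g w.1.1 w.1.2 w.2)
      ((volume : Measure (Eu d × Eu d)).prod volume) :=
    (continuous_timeFreqShift_apply g).aestronglyMeasurable
  have hm := hmV.mul (hmu.mul hmπ)
  have hae : ∀ᵐ w ∂((volume : Measure (Eu d × Eu d)).prod (volume : Measure (Eu d))),
      ‖u w.2‖ ≤ B := Measure.quasiMeasurePreserving_snd.ae hB
  have hg : Integrable g volume := g.integrable
  have hbound : Integrable (fun w : (Eu d × Eu d) × Eu d =>
      ‖stft g (φ : 𝓢'(Eu d, ℂ)) w.1.1 w.1.2‖ * (B * ‖g (w.2 - w.1.1)‖))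
      ((volume : Measure (Eu d × Eu d)).prod volume) := by
    have hm' : AEStronglyMeasurable (fun w : (Eu d × Eu d) × Eu d =>
        ‖stft g (φ : 𝓢'(Eu d, ℂ)) w.1.1 w.1.2‖ * (B * ‖g (w.2 - w.1.1)‖))
        ((volume : Measure (Eu d × Eu d)).prod volume) := by
      refine hmV.norm.mul (Continuous.aestronglyMeasurable ?_)
      fun_prop
    rw [integrable_prod_iff hm']
    refine ⟨Filter.Eventually.of_forall fun z =>
      (((hg.comp_sub_right z.1).norm).const_mul B).const_mul
        ‖stft g (φ : 𝓢'(Eu d, ℂ)) z.1 z.2‖, ?_⟩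
    have : ∀ z : Eu d × Eu d, ∫ t, ‖‖stft g (φ : 𝓢'(Eu d, ℂ)) z.1 z.2‖ * (B * ‖g (t - z.1)‖)‖ =
        ‖stft g (φ : 𝓢'(Eu d, ℂ)) z.1 z.2‖ * (|B| * ∫ t, ‖g t‖) := by
      intro z
      simp only [norm_mul, Real.norm_eq_abs, abs_norm]
      rw [integral_const_mul, integral_const_mul, integral_sub_right_eq_self (fun t => ‖g t‖)]
    simp only [this]
    exact (integrable_stft g φ).norm.mul_const _
  refine hbound.mono' hm ?_
  filter_upwards [hae] with w hw
  simp only [Function.uncurry, norm_mul, norm_timeFreqShift_apply]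
  gcongr

/-- The inversion formula of the short-time Fourier transform, tested against a bounded function. -/
theorem integral_stft_mul_integral (g φ : 𝓢(Eu d, ℂ)) {u : Eu d → ℂ}
    (hu : AEStronglyMeasurable u volume) {B : ℝ} (hB : ∀ᵐ t, ‖u t‖ ≤ B) :
    ∫ z : Eu d × Eu d, stft g (φ : 𝓢'(Eu d, ℂ)) z.1 z.2 * ∫ t, u t * timeFreqShift g z.1 z.2 t =
      windowEnergy g * ∫ t, u t * φ t := by
  have h := integral_integral_swap (integrable_stft_mul_timeFreqShift g φ hu hB)
  simp only [integral_const_mul] at h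
  rw [h, ← integral_const_mul]
  refine integral_congr_ae (Filter.Eventually.of_forall fun t => ?_)
  simp only
  rw [← mul_assoc, mul_comm (windowEnergy g), mul_assoc, ← integral_stft_mul_timeFreqShift g φ t,
    ← integral_const_mul]
  refine integral_congr_ae (Filter.Eventually.of_forall fun z => ?_)
  simp only
  ring

/-- A character is an admissible bounded test function, so inversion passes to Fourier transforms,
the form in which T sees its argument. -/
theorem integral_stft_mul_fourier (g φ : 𝓢(Eu d, ℂ)) (η : Eu d) :
    ∫ z : Eu d × Eu d, stft g (φ : 𝓢'(Eu d, ℂ)) z.1 z.2 * 𝓕 (timeFreqShift g z.1 z.2) η =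
      windowEnergy g * 𝓕 φ η := by
  have hc : Continuous fun t : Eu d =>
      Complex.exp (((-2 * Real.pi * inner ℝ t η : ℝ) : ℂ) * Complex.I) := by fun_prop
  have h := integral_stft_mul_integral g φ (u := fun t : Eu d =>
      Complex.exp (((-2 * Real.pi * inner ℝ t η : ℝ) : ℂ) * Complex.I)) (B := 1)
    hc.aestronglyMeasurable (Filter.Eventually.of_forall fun t => by
      rw [Complex.norm_exp_ofReal_mul_I])
  simpa only [SchwartzMap.fourier_coe, Real.fourier_eq', smul_eq_mul] using h

theorem conj_stft_timeFreqShift (g : 𝓢(Eu d, ℂ)) (x ξ x' ξ' : Eu d) :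
    (starRingEnd ℂ) (stft g (timeFreqShift g x' ξ' : 𝓢'(Eu d, ℂ)) x ξ) =
      stft g (timeFreqShift g x ξ : 𝓢'(Eu d, ℂ)) x' ξ' := by
  rw [stft_coe, stft_coe, ← integral_conj]
  refine integral_congr_ae (Filter.Eventually.of_forall fun t => ?_)
  simp [mul_comm]

/-- The reproducing formula for bounded functions. -/
theorem integral_stft_mul_stft (g : 𝓢(Eu d, ℂ)) {f : 𝓢'(Eu d, ℂ)} {u : Eu d → ℂ}
    (hu : AEStronglyMeasurable u volume) {B : ℝ} (hB : ∀ᵐ t, ‖u t‖ ≤ B) (hf : IsFunction f u)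
    (x' ξ' : Eu d) :
    ∫ z : Eu d × Eu d, stft g f z.1 z.2 * stft g (timeFreqShift g z.1 z.2 : 𝓢'(Eu d, ℂ)) x' ξ' =
      windowEnergy g * stft g f x' ξ' := by
  have hu' : AEStronglyMeasurable (fun t => (starRingEnd ℂ) (u t)) volume :=
    RCLike.continuous_conj.comp_aestronglyMeasurable hu
  -- Inversion is applied to the Schwartz function `timeFreqShift g x' ξ'`, tested against the
  -- conjugate of `u`, and conjugated; `u` itself enters only through pairings.
  have h := congrArg (starRingEnd ℂ) (integral_stft_mul_integral g (timeFreqShift g x' ξ') hu' (B := B)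
    (hB.mono fun t ht => by rwa [RCLike.norm_conj]))
  rw [map_mul, conj_windowEnergy, ← integral_conj, ← integral_conj] at h
  have h1 : ∀ x ξ, ∫ t, (starRingEnd ℂ) ((starRingEnd ℂ) (u t) * timeFreqShift g x ξ t) =
      stft g f x ξ := by
    intro x ξ
    rw [stft, (hf _).2]
    refine integral_congr_ae (Filter.Eventually.of_forall fun t => ?_)
    simp [conj_apply]
  rw [h1] at h
  rw [← h]
  refine integral_congr_ae (Filter.Eventually.of_forall fun z => ?_)
  simp only [map_mul]
  rw [conj_stft_timeFreqShift, ← integral_conj, h1, mul_comm]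

end Inversion

/-! ### Approximation by Riemann sums of time-frequency shifts -/

section Density

variable {d : ℕ}

theorem stft_sum {ι : Type*} (g : 𝓢(Eu d, ℂ)) (s : Finset ι) (f : ι → 𝓢'(Eu d, ℂ)) (x ξ : Eu d) :
    stft g (∑ i ∈ s, f i) x ξ = ∑ i ∈ s, stft g (f i) x ξ :=
  map_sum (AddMonoidHom.mk' (fun f => stft g f x ξ) fun f f' => stft_add g f f' x ξ) f s

theorem integral_mul_comp_simpleFunc {α β : Type*} [MeasurableSpace α] {μ : Measure α} {V : α → ℂ}
    (hV : Integrable V μ) (s : SimpleFunc α β) (G : β → ℂ) :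
    ∫ z, V z * G (s z) ∂μ = ∑ y ∈ s.range, (∫ z in s ⁻¹' {y}, V z ∂μ) * G y := by
  classical
  have h1 : ∀ z, V z * G (s z) = ∑ y ∈ s.range, (s ⁻¹' {y}).indicator V z * G y := by
    intro z
    rw [Finset.sum_eq_single (s z)]
    · rw [Set.indicator_of_mem (by simp)]
    · intro y _ hy
      rw [Set.indicator_of_notMem (by simpa using fun h => hy h.symm), zero_mul]
    · intro h
      exact absurd (s.mem_range_self z) h
  simp_rw [h1]
  rw [integral_finsetSum _ fun y _ =>
    (hV.indicator (s.measurableSet_preimage _)).mul_const _]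
  refine Finset.sum_congr rfl fun y _ => ?_
  rw [integral_mul_const, integral_indicator (s.measurableSet_preimage _)]

/-- The Riemann sums of the inversion formula. -/
def atomicSum (g : 𝓢(Eu d, ℂ)) (V : Eu d × Eu d → ℂ) (s : SimpleFunc (Eu d × Eu d) (Eu d × Eu d)) :
    𝓢(Eu d, ℂ) :=
  (windowEnergy g)⁻¹ • ∑ y ∈ s.range, (∫ z in s ⁻¹' {y}, V z) • timeFreqShift g y.1 y.2

theorem stft_atomicSum (g : 𝓢(Eu d, ℂ)) {V : Eu d × Eu d → ℂ} (hV : Integrable V volume)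
    (s : SimpleFunc (Eu d × Eu d) (Eu d × Eu d)) (x ξ : Eu d) :
    stft g (atomicSum g V s : 𝓢'(Eu d, ℂ)) x ξ = (windowEnergy g)⁻¹ *
      ∫ z, V z * stft g (timeFreqShift g (s z).1 (s z).2 : 𝓢'(Eu d, ℂ)) x ξ := by
  rw [integral_mul_comp_simpleFunc hV s
    (fun y => stft g (timeFreqShift g y.1 y.2 : 𝓢'(Eu d, ℂ)) x ξ), atomicSum, map_smul, stft_smul,
    map_sum, stft_sum]
  congr 1
  refine Finset.sum_congr rfl fun y _ => ?_
  rw [map_smul, stft_smul]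

theorem measurable_stft_timeFreqShift (g : 𝓢(Eu d, ℂ)) :
    Measurable fun w : (Eu d × Eu d) × (Eu d × Eu d) =>
      stft g (timeFreqShift g w.1.1 w.1.2 : 𝓢'(Eu d, ℂ)) w.2.1 w.2.2 := by
  simp_rw [stft_coe]
  have hc : Continuous fun v : ((Eu d × Eu d) × (Eu d × Eu d)) × Eu d =>
      timeFreqShift g v.1.1.1 v.1.1.2 v.2 *
        (starRingEnd ℂ) (timeFreqShift g v.1.2.1 v.1.2.2 v.2) := by
    simp_rw [timeFreqShift_apply]
    unfold character
    fun_prop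
  have hs : StronglyMeasurable fun v : ((Eu d × Eu d) × (Eu d × Eu d)) × Eu d =>
      timeFreqShift g v.1.1.1 v.1.1.2 v.2 *
        (starRingEnd ℂ) (timeFreqShift g v.1.2.1 v.1.2.2 v.2) := hc.stronglyMeasurable
  exact hs.integral_prod_right'.measurable

theorem _root_.Measurable.stft_timeFreqShift {α : Type*} [MeasurableSpace α] (g : 𝓢(Eu d, ℂ))
    {a b : α → Eu d × Eu d} (ha : Measurable a) (hb : Measurable b) :
    Measurable fun w => stft g (timeFreqShift g (a w).1 (a w).2 : 𝓢'(Eu d, ℂ)) (b w).1 (b w).2 := by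
  have h := (measurable_stft_timeFreqShift g).comp (ha.prodMk hb)
  exact h

theorem integrable_mul_stft_timeFreqShift (g : 𝓢(Eu d, ℂ)) {V : Eu d × Eu d → ℂ}
    (hV : Integrable V volume) {r : Eu d × Eu d → Eu d × Eu d} (hr : Measurable r) (x ξ : Eu d) :
    Integrable (fun z : Eu d × Eu d => V z *
      stft g (timeFreqShift g (r z).1 (r z).2 : 𝓢'(Eu d, ℂ)) x ξ) volume := by
  obtain ⟨C, hC, M, h⟩ := exists_stft_decay 0 g
  have hmeas : Measurable fun z : Eu d × Eu d =>
      stft g (timeFreqShift g (r z).1 (r z).2 : 𝓢'(Eu d, ℂ)) x ξ := by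
    have hc : Measurable fun _ : Eu d × Eu d => ((x, ξ) : Eu d × Eu d) := measurable_const
    have h := Measurable.stft_timeFreqShift g hr hc
    exact h
  have hb : ∀ z : Eu d × Eu d, ‖stft g (timeFreqShift g (r z).1 (r z).2 : 𝓢'(Eu d, ℂ)) x ξ‖ ≤
      C * (schwartzNorm M g + schwartzNorm M (𝓕 g)) := by
    intro z
    rw [norm_stft_timeFreqShift]
    simpa using h g (x - (r z).1) (ξ - (r z).2)
  exact hV.mul_bdd hmeas.aestronglyMeasurable (Filter.Eventually.of_forall hb)

/-- By the reproducing formula the error is, on the level of short-time Fourier transforms, an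
integral of differences of shifts; Minkowski takes the norm inside. -/
theorem modNorm_sub_atomicSum_le (g : 𝓢(Eu d, ℂ)) (hg : g ≠ 0) {f : 𝓢'(Eu d, ℂ)} {u : Eu d → ℂ}
    (hu : AEStronglyMeasurable u volume) {B : ℝ} (hB : ∀ᵐ t, ‖u t‖ ≤ B) (hf : IsFunction f u)
    (hV : Integrable (fun z : Eu d × Eu d => stft g f z.1 z.2) volume)
    (s : SimpleFunc (Eu d × Eu d) (Eu d × Eu d)) {p q : ℝ≥0∞} (hp : 1 ≤ p) (hq : 1 ≤ q) :
    modNorm g p q (f - (atomicSum g (fun z => stft g f z.1 z.2) s : 𝓢'(Eu d, ℂ))) ≤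
      ∫⁻ z : Eu d × Eu d, (‖(windowEnergy g)⁻¹‖ₑ * ‖stft g f z.1 z.2‖ₑ) * modNorm g p q
        ((timeFreqShift g z.1 z.2 - timeFreqShift g (s z).1 (s z).2 : 𝓢(Eu d, ℂ)) :
          𝓢'(Eu d, ℂ)) := by
  have hc := windowEnergy_ne_zero hg
  set D : Eu d × Eu d → 𝓢(Eu d, ℂ) := fun z =>
    timeFreqShift g z.1 z.2 - timeFreqShift g (s z).1 (s z).2 with hD
  have hDV : ∀ z x ξ, stft g (D z : 𝓢'(Eu d, ℂ)) x ξ =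
      stft g (timeFreqShift g z.1 z.2 : 𝓢'(Eu d, ℂ)) x ξ -
      stft g (timeFreqShift g (s z).1 (s z).2 : 𝓢'(Eu d, ℂ)) x ξ := by
    intro z x ξ
    rw [hD, map_sub, stft_sub]
  have hDm : Measurable fun w : Eu d × Eu d × (Eu d × Eu d) =>
      stft g (D w.2.2 : 𝓢'(Eu d, ℂ)) w.1 w.2.1 := by
    simp_rw [hDV]
    refine Measurable.sub ?_ ?_
    · exact Measurable.stft_timeFreqShift g (a := fun w : Eu d × Eu d × (Eu d × Eu d) => w.2.2)
        (b := fun w => (w.1, w.2.1)) (by fun_prop) (by fun_prop)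
    · have hs : Measurable s := s.measurable
      exact Measurable.stft_timeFreqShift g (a := fun w : Eu d × Eu d × (Eu d × Eu d) => s w.2.2)
        (b := fun w => (w.1, w.2.1)) (by fun_prop) (by fun_prop)
  have hVm : Measurable fun z : Eu d × Eu d => stft g f z.1 z.2 := (continuous_stft g f).measurable
  have hkey : ∀ x ξ, ‖stft g (f - (atomicSum g (fun z => stft g f z.1 z.2) s : 𝓢'(Eu d, ℂ))) x ξ‖ₑ ≤
      ∫⁻ z : Eu d × Eu d, (‖(windowEnergy g)⁻¹‖ₑ * ‖stft g f z.1 z.2‖ₑ) *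
        ‖stft g (D z : 𝓢'(Eu d, ℂ)) x ξ‖ₑ := by
    intro x ξ
    have h1 : stft g (f - (atomicSum g (fun z => stft g f z.1 z.2) s : 𝓢'(Eu d, ℂ))) x ξ =
        ∫ z : Eu d × Eu d, ((windowEnergy g)⁻¹ * stft g f z.1 z.2) *
          stft g (D z : 𝓢'(Eu d, ℂ)) x ξ := by
      rw [stft_sub, stft_atomicSum g hV]
      have h2 := integral_stft_mul_stft g hu hB hf x ξ
      have h3 : stft g f x ξ = (windowEnergy g)⁻¹ * ∫ z : Eu d × Eu d, stft g f z.1 z.2 *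
          stft g (timeFreqShift g z.1 z.2 : 𝓢'(Eu d, ℂ)) x ξ := by
        rw [h2, inv_mul_cancel_left₀ hc]
      conv_lhs => rw [h3]
      rw [← mul_sub, ← integral_sub (integrable_mul_stft_timeFreqShift g hV (r := fun z => z) measurable_id x ξ)
        (integrable_mul_stft_timeFreqShift g hV s.measurable x ξ),
        ← integral_const_mul]
      refine integral_congr_ae (Filter.Eventually.of_forall fun z => ?_)
      simp only [hDV]
      ring
    rw [h1]
    refine (enorm_integral_le_lintegral_enorm _).trans_eq ?_
    simp only [enorm_mul]
  rw [modNorm_eq_mixedNorm]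
  refine (mixedNorm_mono hkey).trans ?_
  refine (mixedNorm_lintegral_le (h := fun x ξ (z : Eu d × Eu d) =>
    (‖(windowEnergy g)⁻¹‖ₑ * ‖stft g f z.1 z.2‖ₑ) * ‖stft g (D z : 𝓢'(Eu d, ℂ)) x ξ‖ₑ) ?_ hp hq).trans ?_
  · have hw : Measurable fun w : Eu d × Eu d × (Eu d × Eu d) => w.2.2 := by fun_prop
    have := hVm.comp hw
    exact (measurable_const.mul this.enorm).mul hDm.enorm
  · refine lintegral_mono fun z => ?_
    rw [modNorm_eq_mixedNorm]
    unfold mixedNorm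
    exact eLpNorm_le_mul_ennreal (measurable_eLpNorm_right (measurable_enorm_stft g _) p)
      fun ξ => eLpNorm_le_mul_ennreal (measurable_enorm_stft_left g _ ξ) fun x => le_rfl

/-- A bounded function with integrable short-time Fourier transform is approximated by Schwartz
functions in all modulation spaces. -/
theorem mem_modSpaceClosure_of_integrable_stft (g : 𝓢(Eu d, ℂ)) (hg : g ≠ 0) {f : 𝓢'(Eu d, ℂ)}
    {u : Eu d → ℂ} (hu : AEStronglyMeasurable u volume) {B : ℝ} (hB : ∀ᵐ t, ‖u t‖ ≤ B)
    (hf : IsFunction f u)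
    (hV : Integrable (fun z : Eu d × Eu d => stft g f z.1 z.2) volume)
    {p q : ℝ≥0∞} (hp : 1 ≤ p) (hq : 1 ≤ q) : f ∈ modSpaceClosure g p q := by
  have happrox : ∀ ε : ℝ≥0∞, 0 < ε → ∃ φ : 𝓢(Eu d, ℂ),
      modNorm g p q (f - (φ : 𝓢'(Eu d, ℂ))) < ε := by
    intro ε hε
    obtain ⟨K, hK, hKb⟩ := exists_modNorm_timeFreqShift_le g hp hq
    obtain ⟨C, hC, M, hM⟩ := exists_modNorm_coe_le (N := d + 1) g
    set W := eLpNorm (weight (d := d) (d + 1)) p volume * eLpNorm (weight (d := d) (d + 1)) q volume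
      with hWdef
    have hW : W < ⊤ := ENNReal.mul_lt_top (eLpNorm_weight_lt_top (Nat.lt_succ_self d) hp)
      (eLpNorm_weight_lt_top (Nat.lt_succ_self d) hq)
    set D : (Eu d × Eu d) × (Eu d × Eu d) → 𝓢(Eu d, ℂ) := fun w =>
      timeFreqShift g w.1.1 w.1.2 - timeFreqShift g w.2.1 w.2.2 with hD
    have hDc : Continuous D := by
      have h1 := (continuous_timeFreqShift_left g).comp
        (continuous_fst (X := Eu d × Eu d) (Y := Eu d × Eu d))
      have h2 := (continuous_timeFreqShift_left g).comp
        (continuous_snd (X := Eu d × Eu d) (Y := Eu d × Eu d))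
      exact h1.sub h2
    -- A continuous majorant of the modulation norm of `D`: the cap `K + K` allows dominated
    -- convergence, and the bound by Schwartz norms forces it to vanish on the diagonal.
    set S : (Eu d × Eu d) × (Eu d × Eu d) → ℝ≥0∞ := fun w =>
      min (K + K) (ENNReal.ofReal (C * (schwartzNorm M (D w) + schwartzNorm M (𝓕 (D w)))) * W) with hS
    have hSc : Continuous S := by
      have h1 := (continuous_schwartzNorm (E := Eu d) M).comp hDc
      have h2 := (continuous_schwartzNorm (E := Eu d) M).comp
        ((FourierTransform.continuous_fourier (E := 𝓢(Eu d, ℂ)) (F := 𝓢(Eu d, ℂ))).comp hDc)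
      have h3 : Continuous fun w => C * (schwartzNorm M (D w) + schwartzNorm M (𝓕 (D w))) :=
        continuous_const.mul (h1.add h2)
      exact continuous_const.min
        ((ENNReal.continuous_mul_const hW.ne).comp (ENNReal.continuous_ofReal.comp h3))
    have hSle : ∀ w, modNorm g p q (D w : 𝓢'(Eu d, ℂ)) ≤ S w := by
      intro w
      refine le_min ?_ (hM p q (D w))
      have h1 : (D w : 𝓢'(Eu d, ℂ)) = (timeFreqShift g w.1.1 w.1.2 : 𝓢'(Eu d, ℂ)) +
          (-1 : ℂ) • (timeFreqShift g w.2.1 w.2.2 : 𝓢'(Eu d, ℂ)) := by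
        rw [hD, map_sub, neg_one_smul, sub_eq_add_neg]
      rw [h1]
      refine (modNorm_add_le g hp hq _ _).trans (add_le_add (hKb _ _) ?_)
      refine (modNorm_smul_le g p q _ _).trans ?_
      simpa using hKb _ _
    have hS0 : ∀ z, S (z, z) = 0 := by
      intro z
      have : D (z, z) = 0 := sub_self _
      simp [hS, this]
    set s : ℕ → SimpleFunc (Eu d × Eu d) (Eu d × Eu d) := fun n =>
      SimpleFunc.approxOn id measurable_id Set.univ 0 (Set.mem_univ _) n
    have hs : ∀ z, Filter.Tendsto (fun n => s n z) Filter.atTop (nhds z) := fun z =>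
      SimpleFunc.tendsto_approxOn measurable_id (Set.mem_univ _) (by simp)
    have hVm : Measurable fun z : Eu d × Eu d => stft g f z.1 z.2 :=
      (continuous_stft g f).measurable
    have hlim : Filter.Tendsto (fun n => ∫⁻ z : Eu d × Eu d,
        (‖(windowEnergy g)⁻¹‖ₑ * ‖stft g f z.1 z.2‖ₑ) * S (z, s n z)) Filter.atTop
        (nhds (∫⁻ _z : Eu d × Eu d, 0)) := by
      refine tendsto_lintegral_of_dominated_convergence
        (fun z : Eu d × Eu d => (‖(windowEnergy g)⁻¹‖ₑ * ‖stft g f z.1 z.2‖ₑ) * (K + K))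
        (fun n => ?_) (fun n => ?_) ?_ ?_
      · exact (measurable_const.mul hVm.enorm).mul
          (hSc.measurable.comp (measurable_id.prodMk (s n).measurable))
      · refine Filter.Eventually.of_forall fun z => ?_
        simp only [hS]
        gcongr
        exact min_le_left _ _
      · have hm : Measurable fun z : Eu d × Eu d => ‖(windowEnergy g)⁻¹‖ₑ * ‖stft g f z.1 z.2‖ₑ :=
          measurable_const.mul hVm.enorm
        rw [lintegral_mul_const _ hm, lintegral_const_mul _ hVm.enorm]
        exact (ENNReal.mul_lt_top (ENNReal.mul_lt_top enorm_lt_top hV.2)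
          (ENNReal.add_lt_top.2 ⟨hK, hK⟩)).ne
      · refine Filter.Eventually.of_forall fun z => ?_
        have h1 : Filter.Tendsto (fun n => S (z, s n z)) Filter.atTop (nhds (S (z, z))) :=
          (hSc.tendsto (z, z)).comp (tendsto_const_nhds.prodMk_nhds (hs z))
        rw [hS0] at h1
        have h2 := ENNReal.Tendsto.const_mul (a := ‖(windowEnergy g)⁻¹‖ₑ * ‖stft g f z.1 z.2‖ₑ) h1
          (Or.inr (ENNReal.mul_lt_top enorm_lt_top enorm_lt_top).ne)
        simpa using h2
    rw [lintegral_zero] at hlim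
    obtain ⟨n, hn⟩ := (hlim.eventually_lt_const hε).exists
    refine ⟨atomicSum g (fun z => stft g f z.1 z.2) (s n), lt_of_le_of_lt ?_ hn⟩
    refine (modNorm_sub_atomicSum_le g hg hu hB hf hV (s n) hp hq).trans (lintegral_mono fun z => ?_)
    gcongr
    exact hSle (z, s n z)
  refine ⟨?_, happrox⟩
  obtain ⟨φ, hφ⟩ := happrox 1 one_pos
  have h1 : f = (f - (φ : 𝓢'(Eu d, ℂ))) + (φ : 𝓢'(Eu d, ℂ)) := by abel
  change modNorm g p q f < ⊤
  rw [h1]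
  exact (modNorm_add_le g hp hq _ _).trans_lt
    (ENNReal.add_lt_top.2 ⟨hφ.trans ENNReal.one_lt_top, modNorm_coe_lt_top g φ hp hq⟩)

end Density

/-! ### Decoupling the kernel and bounding the dominating operator -/

section KernelEstimates

variable {d : ℕ}

theorem exists_ae_norm_le_of_memLp_top {α : Type*} [MeasurableSpace α] {μ : Measure α} {σ : α → ℂ}
    (hσ : MemLp σ ⊤ μ) : ∃ B : ℝ, 0 ≤ B ∧ ∀ᵐ w ∂μ, ‖σ w‖ ≤ B := by
  refine ⟨(eLpNormEssSup σ μ).toReal, ENNReal.toReal_nonneg, ?_⟩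
  have h : eLpNormEssSup σ μ ≠ ⊤ := by simpa [eLpNorm_exponent_top] using hσ.2.ne
  filter_upwards [ae_le_eLpNormEssSup (f := σ) (μ := μ)] with w hw
  rw [← toReal_enorm]
  exact ENNReal.toReal_mono h hw

/-- ∇_xΦ(x',ξ) and ∇_xΦ(0,ξ) differ by at most `C₁`, so the base point moves to 0 at the price `(1 +
C₁) ^ N`. The factor joining `ξ` and `ξ'` is then free of `x'`, as the mixed Schur test requires. -/
theorem exists_enorm_fioKernel_le {Φ : Eu d × Eu d → ℝ} (hΦ : IsPhase Φ) {σ : Eu d × Eu d → ℂ}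
    {N : ℕ} (hσ : IsSymbol (2 * N) σ)
    (hrange : ∃ C : ℝ, ∀ x x' η : Eu d,
      ‖∇ (fun y : Eu d => Φ (y, η)) x - ∇ (fun y : Eu d => Φ (y, η)) x'‖ ≤ C) (g : 𝓢(Eu d, ℂ)) :
    ∃ C : ℝ, 0 ≤ C ∧ ∃ M : ℕ, ∀ (h : 𝓢(Eu d, ℂ)) (x ξ x' ξ' : Eu d),
      ‖fioKernel Φ σ g x ξ (conj (timeFreqShift h x' ξ'))‖ₑ ≤
        ENNReal.ofReal (C * schwartzNorm M h) *
          (weight N (gradFst Φ (0, ξ) - ξ') * weight N (gradSnd Φ (x', ξ) - x)) := by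
  obtain ⟨C, hC, M, hM⟩ := exists_fioKernel_bound hΦ hσ g
  obtain ⟨C₁, hC₁⟩ := hrange
  have hC₁0 : 0 ≤ C₁ := (norm_nonneg _).trans (hC₁ 0 0 0)
  refine ⟨(1 + C₁) ^ N * C, by positivity, M, fun h x ξ x' ξ' => ?_⟩
  have h0 := schwartzNorm_nonneg M h
  rw [weight, weight, ← ENNReal.ofReal_mul (by positivity), ← ENNReal.ofReal_mul (by positivity),
    ← ofReal_norm]
  refine ENNReal.ofReal_le_ofReal ?_
  rw [← mul_inv, ← div_eq_mul_inv, le_div_iff₀ (by positivity), mul_comm]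
  have h1 : 1 + ‖gradFst Φ (0, ξ) - ξ'‖ ≤ (1 + C₁) * (1 + ‖gradFst Φ (x', ξ) - ξ'‖) := by
    have h2 := hC₁ 0 x' ξ
    rw [gradient_eq_gradFst hΦ.smooth, gradient_eq_gradFst hΦ.smooth] at h2
    have h3 : ‖gradFst Φ (0, ξ) - ξ'‖ ≤
        ‖gradFst Φ (0, ξ) - gradFst Φ (x', ξ)‖ + ‖gradFst Φ (x', ξ) - ξ'‖ := by
      simpa using norm_add_le (gradFst Φ (0, ξ) - gradFst Φ (x', ξ)) (gradFst Φ (x', ξ) - ξ')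
    nlinarith [norm_nonneg (gradFst Φ (x', ξ) - ξ')]
  calc _ ≤ ((1 + C₁) * (1 + ‖gradFst Φ (x', ξ) - ξ'‖)) ^ N *
        (1 + ‖gradSnd Φ (x', ξ) - x‖) ^ N *
        ‖fioKernel Φ σ g x ξ (conj (timeFreqShift h x' ξ'))‖ := by gcongr
    _ = (1 + C₁) ^ N * ((1 + ‖gradFst Φ (x', ξ) - ξ'‖) ^ N *
        (1 + ‖gradSnd Φ (x', ξ) - x‖) ^ N *
        ‖fioKernel Φ σ g x ξ (conj (timeFreqShift h x' ξ'))‖) := by rw [mul_pow]; ring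
    _ ≤ (1 + C₁) ^ N * (C * schwartzNorm M h) := by
        exact mul_le_mul_of_nonneg_left (hM h x ξ x' ξ') (by positivity)
    _ = _ := by ring

/-- The positive integral operator dominating the Fourier integral operator with phase `Φ` on the
level of short-time Fourier transforms. -/
def dominatingOp (Φ : Eu d × Eu d → ℝ) (N : ℕ) (F : Eu d → Eu d → ℝ≥0∞) (x' ξ' : Eu d) : ℝ≥0∞ :=
  ∫⁻ ξ, weight N (gradFst Φ (0, ξ) - ξ') * ∫⁻ x, weight N (gradSnd Φ (x', ξ) - x) * F x ξ

/-- Of the four Schur integrals, those in `ξ'` and `x` are translates of the integral of the weight;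
those in `ξ` and `x'` run along partial gradients and are bounded by expansion. -/
theorem exists_mixedNorm_dominatingOp_le {Φ : Eu d × Eu d → ℝ} (hΦ : IsPhase Φ) {N : ℕ}
    (hN : d < N) : ∃ K : ℝ≥0∞, K < ⊤ ∧ ∀ (F : Eu d → Eu d → ℝ≥0∞),
      Measurable (Function.uncurry F) → ∀ {p q : ℝ≥0∞}, 1 ≤ p → 1 ≤ q →
      mixedNorm volume volume p q (dominatingOp Φ N F) ≤ K * mixedNorm volume volume p q F := by
  obtain ⟨L₁, hL₁, h₁⟩ := exists_antilipschitz_gradFst hΦ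
  obtain ⟨L₂, hL₂, h₂⟩ := exists_antilipschitz_gradSnd hΦ
  set J := ∫⁻ v : Eu d, weight N v with hJ
  have hJtop : J < ⊤ := lintegral_weight_lt_top hN
  have c1 := continuous_gradFst hΦ.smooth
  have c2 := continuous_gradSnd hΦ.smooth
  have cw := continuous_weight (d := d) N
  have hle : ∀ L : ℝ, 0 < L → J ≤ ENNReal.ofReal ((1 + 2 * L) ^ N) * J := fun L hL => by
    refine le_mul_of_one_le_left zero_le ?_
    rw [ENNReal.one_le_ofReal]
    exact one_le_pow₀ (by linarith)
  refine ⟨ENNReal.ofReal ((1 + 2 * L₁) ^ N) * J * (ENNReal.ofReal ((1 + 2 * L₂) ^ N) * J),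
    ENNReal.mul_lt_top (ENNReal.mul_lt_top ENNReal.ofReal_lt_top hJtop)
      (ENNReal.mul_lt_top ENNReal.ofReal_lt_top hJtop), fun F hF p q hp hq => ?_⟩
  refine mixedNorm_kernel_le (a := fun ξ' ξ => weight N (gradFst Φ (0, ξ) - ξ'))
    (b := fun ξ x' x => weight N (gradSnd Φ (x', ξ) - x)) ?_ ?_ hF ?_ ?_ ?_ ?_ hp hq
  · exact Continuous.measurable (by unfold Function.uncurry; fun_prop)
  · exact Continuous.measurable (by fun_prop)
  · exact fun ξ' => lintegral_weight_le_of_antilipschitz N hL₁ (h₁ 0) ξ'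
  · intro ξ
    rw [lintegral_weight_sub]
    exact hle L₁ hL₁
  · intro ξ x'
    rw [lintegral_weight_sub]
    exact hle L₂ hL₂
  · exact fun ξ x => lintegral_weight_le_of_antilipschitz N hL₂ (h₂ ξ) x

/-- Moving the output point changes either weight by a factor bounded uniformly in the integration
variables, so the values at any two points are comparable. -/
theorem dominatingOp_eq_top_of_eq_top {Φ : Eu d × Eu d → ℝ} (hΦ : IsPhase Φ) {N : ℕ}
    {F : Eu d → Eu d → ℝ≥0∞} (hF : Measurable (Function.uncurry F)) {x' ξ' : Eu d}
    (h : dominatingOp Φ N F x' ξ' = ⊤) (x'' ξ'' : Eu d) : dominatingOp Φ N F x'' ξ'' = ⊤ := by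
  obtain ⟨L, hL, hLip⟩ := exists_lipschitz_gradSnd hΦ
  have c1 := continuous_gradFst hΦ.smooth
  have c2 := continuous_gradSnd hΦ.smooth
  have cw := continuous_weight (d := d) N
  set R₁ := ENNReal.ofReal ((1 + ‖ξ'' - ξ'‖) ^ N)
  set R₂ := ENNReal.ofReal ((1 + L * ‖x'' - x'‖) ^ N)
  have h1 : ∀ ξ, weight N (gradFst Φ (0, ξ) - ξ') ≤ R₁ * weight N (gradFst Φ (0, ξ) - ξ'') := by
    intro ξ
    refine weight_le_mul (by positivity) ?_
    have : ‖gradFst Φ (0, ξ) - ξ''‖ ≤ ‖gradFst Φ (0, ξ) - ξ'‖ + ‖ξ'' - ξ'‖ := by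
      simpa using norm_sub_le (gradFst Φ (0, ξ) - ξ') (ξ'' - ξ')
    nlinarith [norm_nonneg (gradFst Φ (0, ξ) - ξ'), norm_nonneg (ξ'' - ξ')]
  have h2 : ∀ ξ x, weight N (gradSnd Φ (x', ξ) - x) ≤ R₂ * weight N (gradSnd Φ (x'', ξ) - x) := by
    intro ξ x
    refine weight_le_mul (by positivity) ?_
    have h3 : ‖gradSnd Φ (x'', ξ) - x‖ ≤
        ‖gradSnd Φ (x'', ξ) - gradSnd Φ (x', ξ)‖ + ‖gradSnd Φ (x', ξ) - x‖ := by
      simpa using norm_add_le (gradSnd Φ (x'', ξ) - gradSnd Φ (x', ξ)) (gradSnd Φ (x', ξ) - x)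
    have h4 := hLip ξ x'' x'
    have h5 : 0 ≤ L * ‖x'' - x'‖ := by positivity
    nlinarith [norm_nonneg (gradSnd Φ (x', ξ) - x)]
  have hmx : ∀ ξ, Measurable fun x => weight N (gradSnd Φ (x'', ξ) - x) * F x ξ := by
    intro ξ
    have a1 : Measurable fun x => weight N (gradSnd Φ (x'', ξ) - x) :=
      Continuous.measurable (by fun_prop)
    have a2 : Measurable fun x : Eu d => (x, ξ) := by fun_prop
    have a3 := hF.comp a2
    exact a1.mul a3
  have hm : Measurable fun ξ => weight N (gradFst Φ (0, ξ) - ξ'') *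
      ∫⁻ x, weight N (gradSnd Φ (x'', ξ) - x) * F x ξ := by
    have a1 : Measurable fun ξ => weight N (gradFst Φ (0, ξ) - ξ'') :=
      Continuous.measurable (by fun_prop)
    have a2 : Measurable fun z : Eu d × Eu d => weight N (gradSnd Φ (x'', z.1) - z.2) :=
      Continuous.measurable (by fun_prop)
    have a3 : Measurable fun z : Eu d × Eu d => F z.2 z.1 := hF.comp measurable_swap
    exact a1.mul (a2.mul a3).lintegral_prod_right'
  have key : dominatingOp Φ N F x' ξ' ≤ R₁ * R₂ * dominatingOp Φ N F x'' ξ'' := by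
    unfold dominatingOp
    rw [← lintegral_const_mul _ hm]
    refine lintegral_mono fun ξ => ?_
    calc _ ≤ (R₁ * weight N (gradFst Φ (0, ξ) - ξ'')) *
          (R₂ * ∫⁻ x, weight N (gradSnd Φ (x'', ξ) - x) * F x ξ) := by
          refine mul_le_mul' (h1 ξ) ?_
          rw [← lintegral_const_mul _ (hmx ξ)]
          refine lintegral_mono fun x => ?_
          rw [← mul_assoc]
          exact mul_le_mul' (h2 ξ x) le_rfl
      _ = _ := by ring
  by_contra hne
  rw [h, top_le_iff] at key
  exact ENNReal.mul_ne_top (ENNReal.mul_ne_top ENNReal.ofReal_ne_top ENNReal.ofReal_ne_top) hne key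

theorem mixedNorm_top {p q : ℝ≥0∞} (hp : 1 ≤ p) (hq : 1 ≤ q) :
    mixedNorm (volume : Measure (Eu d)) (volume : Measure (Eu d)) p q (fun _ _ => ⊤) = ⊤ := by
  have h : ∀ r : ℝ≥0∞, 1 ≤ r → eLpNorm (fun _ : Eu d => (⊤ : ℝ≥0∞)) r volume = ⊤ := by
    intro r hr
    rw [eLpNorm_const _ (zero_lt_one.trans_le hr).ne' (NeZero.ne _)]
    rw [enorm_eq_self]
    refine ENNReal.top_mul fun h0 => ?_
    rcases ENNReal.rpow_eq_zero_iff.1 h0 with h1 | h1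
    · exact (NeZero.ne (volume : Measure (Eu d))) (Measure.measure_univ_eq_zero.1 h1.1)
    · have : 0 ≤ 1 / r.toReal := by positivity
      linarith [h1.2]
  simp [mixedNorm, h p hp, h q hq]

/-- One infinite value would make all values infinite, against the mixed norm bound. Finiteness at
every point, not just almost everywhere, is what lets the superposition converge against every test
function. -/
theorem dominatingOp_lt_top {Φ : Eu d × Eu d → ℝ} (hΦ : IsPhase Φ) {N : ℕ} (hN : d < N)
    {F : Eu d → Eu d → ℝ≥0∞} (hF : Measurable (Function.uncurry F)) {p q : ℝ≥0∞} (hp : 1 ≤ p)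
    (hq : 1 ≤ q) (h : mixedNorm volume volume p q F < ⊤) (x' ξ' : Eu d) :
    dominatingOp Φ N F x' ξ' < ⊤ := by
  obtain ⟨K, hK, hKb⟩ := exists_mixedNorm_dominatingOp_le hΦ hN
  by_contra htop
  have h1 : dominatingOp Φ N F = fun _ _ => ⊤ := by
    funext x ξ
    exact dominatingOp_eq_top_of_eq_top hΦ hF (not_lt_top_iff.1 htop) x ξ
  have h2 := (hKb F hF hp hq).trans_lt (ENNReal.mul_lt_top hK h)
  rw [h1, mixedNorm_top hp hq] at h2
  exact lt_irrefl _ h2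

end KernelEstimates

/-! ### The extension by superposition -/

section Operator

variable {d : ℕ}

theorem integrable_symbol_mul_osc_mul {Φ : Eu d × Eu d → ℝ} (hΦ : Continuous Φ)
    {σ : Eu d × Eu d → ℂ} (hσ : MemLp σ ⊤ (volume : Measure (Eu d × Eu d))) (ψ k : 𝓢(Eu d, ℂ)) :
    Integrable (fun w : Eu d × Eu d => σ w * (osc Φ w * (ψ w.1 * k w.2))) volume := by
  obtain ⟨B, -, hB⟩ := exists_ae_norm_le_of_memLp_top hσ
  have h1 : Integrable (fun w : Eu d × Eu d => ψ w.1 * k w.2) (volume.prod volume) :=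
    ψ.integrable.mul_prod k.integrable
  have h2 : Integrable (fun w : Eu d × Eu d => osc Φ w * (ψ w.1 * k w.2)) volume :=
    h1.bdd_mul (c := 1) (continuous_osc hΦ).aestronglyMeasurable
      (Filter.Eventually.of_forall fun w => (norm_osc Φ w).le)
  exact h2.bdd_mul hσ.1 hB

theorem fioKernel_add {Φ : Eu d × Eu d → ℝ} (hΦ : Continuous Φ) {σ : Eu d × Eu d → ℂ}
    (hσ : MemLp σ ⊤ (volume : Measure (Eu d × Eu d))) (g : 𝓢(Eu d, ℂ)) (x ξ : Eu d)
    (ψ ψ' : 𝓢(Eu d, ℂ)) :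
    fioKernel Φ σ g x ξ (ψ + ψ') = fioKernel Φ σ g x ξ ψ + fioKernel Φ σ g x ξ ψ' := by
  unfold fioKernel
  rw [← integral_add (integrable_symbol_mul_osc_mul hΦ hσ ψ _)
    (integrable_symbol_mul_osc_mul hΦ hσ ψ' _)]
  refine integral_congr_ae (Filter.Eventually.of_forall fun w => ?_)
  simp only [add_apply]
  ring

theorem fioKernel_smul (Φ : Eu d × Eu d → ℝ) (σ : Eu d × Eu d → ℂ) (g : 𝓢(Eu d, ℂ)) (x ξ : Eu d)
    (c : ℂ) (ψ : 𝓢(Eu d, ℂ)) :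
    fioKernel Φ σ g x ξ (c • ψ) = c * fioKernel Φ σ g x ξ ψ := by
  unfold fioKernel
  rw [← integral_const_mul]
  refine integral_congr_ae (Filter.Eventually.of_forall fun w => ?_)
  simp only [smul_apply, smul_eq_mul]
  ring

theorem continuous_fourier_timeFreqShift_apply (g : 𝓢(Eu d, ℂ)) :
    Continuous fun v : (Eu d × Eu d) × Eu d => 𝓕 (timeFreqShift g v.1.1 v.1.2) v.2 := by
  simp_rw [fourier_timeFreqShift]
  unfold character
  fun_prop

theorem aestronglyMeasurable_fioKernel_integrand {Φ : Eu d × Eu d → ℝ} (hΦ : Continuous Φ)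
    {σ : Eu d × Eu d → ℂ} (hσ : MemLp σ ⊤ (volume : Measure (Eu d × Eu d))) (g ψ : 𝓢(Eu d, ℂ)) :
    AEStronglyMeasurable (fun v : (Eu d × Eu d) × (Eu d × Eu d) =>
      σ v.2 * (osc Φ v.2 * (ψ v.2.1 * 𝓕 (timeFreqShift g v.1.1 v.1.2) v.2.2)))
      ((volume : Measure (Eu d × Eu d)).prod volume) := by
  refine hσ.1.comp_snd.mul (Continuous.aestronglyMeasurable ?_)
  have h1 := continuous_osc hΦ
  have h2 : Continuous fun v : (Eu d × Eu d) × (Eu d × Eu d) => (v.1, v.2.2) := by fun_prop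
  have h3 := (continuous_fourier_timeFreqShift_apply g).comp h2
  have h4 : Continuous fun v : (Eu d × Eu d) × (Eu d × Eu d) => ψ v.2.1 := by fun_prop
  exact (h1.comp continuous_snd).mul (h4.mul h3)

theorem aestronglyMeasurable_fioKernel {Φ : Eu d × Eu d → ℝ} (hΦ : Continuous Φ)
    {σ : Eu d × Eu d → ℂ} (hσ : MemLp σ ⊤ (volume : Measure (Eu d × Eu d))) (g ψ : 𝓢(Eu d, ℂ)) :
    AEStronglyMeasurable (fun z : Eu d × Eu d => fioKernel Φ σ g z.1 z.2 ψ) volume :=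
  (aestronglyMeasurable_fioKernel_integrand hΦ hσ g ψ).integral_prod_right'

/-- The value on `ψ` of the extension of the Fourier integral operator to the tempered
distribution `f`, by superposition of its values on time-frequency shifts. -/
def fioExtension (Φ : Eu d × Eu d → ℝ) (σ : Eu d × Eu d → ℂ) (g : 𝓢(Eu d, ℂ)) (f : 𝓢'(Eu d, ℂ))
    (ψ : 𝓢(Eu d, ℂ)) : ℂ :=
  (windowEnergy g)⁻¹ * ∫ z : Eu d × Eu d, stft g f z.1 z.2 * fioKernel Φ σ g z.1 z.2 ψ

theorem lintegral_stft_mul_fioKernel_le {Φ : Eu d × Eu d → ℝ} (hΦ : ContDiff ℝ ∞ Φ)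
    {σ : Eu d × Eu d → ℂ} {g : 𝓢(Eu d, ℂ)} {N : ℕ} {ψ : 𝓢(Eu d, ℂ)} {x' ξ' : Eu d} {c : ℝ≥0∞}
    (h : ∀ x ξ, ‖fioKernel Φ σ g x ξ ψ‖ₑ ≤
      c * (weight N (gradFst Φ (0, ξ) - ξ') * weight N (gradSnd Φ (x', ξ) - x)))
    (f : 𝓢'(Eu d, ℂ)) :
    ∫⁻ z : Eu d × Eu d, ‖stft g f z.1 z.2 * fioKernel Φ σ g z.1 z.2 ψ‖ₑ ≤
      c * dominatingOp Φ N (fun x ξ => ‖stft g f x ξ‖ₑ) x' ξ' := by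
  have c1 := continuous_gradFst hΦ
  have c2 := continuous_gradSnd hΦ
  have cw := continuous_weight (d := d) N
  have a1 : Measurable fun z : Eu d × Eu d => weight N (gradFst Φ (0, z.2) - ξ') :=
    Continuous.measurable (by fun_prop)
  have a2 : Measurable fun z : Eu d × Eu d => weight N (gradSnd Φ (x', z.2) - z.1) :=
    Continuous.measurable (by fun_prop)
  have a3 := measurable_enorm_stft g f
  have hm : Measurable fun z : Eu d × Eu d => weight N (gradFst Φ (0, z.2) - ξ') *
      (weight N (gradSnd Φ (x', z.2) - z.1) * ‖stft g f z.1 z.2‖ₑ) := a1.mul (a2.mul a3)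
  calc _ ≤ ∫⁻ z : Eu d × Eu d, c * (weight N (gradFst Φ (0, z.2) - ξ') *
        (weight N (gradSnd Φ (x', z.2) - z.1) * ‖stft g f z.1 z.2‖ₑ)) := by
        refine lintegral_mono fun z => ?_
        rw [enorm_mul]
        calc _ ≤ ‖stft g f z.1 z.2‖ₑ * (c * (weight N (gradFst Φ (0, z.2) - ξ') *
              weight N (gradSnd Φ (x', z.2) - z.1))) := mul_le_mul' le_rfl (h z.1 z.2)
          _ = _ := by ring
    _ = c * ∫⁻ z : Eu d × Eu d, weight N (gradFst Φ (0, z.2) - ξ') *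
        (weight N (gradSnd Φ (x', z.2) - z.1) * ‖stft g f z.1 z.2‖ₑ) := lintegral_const_mul _ hm
    _ = _ := by
        rw [Measure.volume_eq_prod, lintegral_prod_symm _ hm.aemeasurable, dominatingOp]
        congr 1
        refine lintegral_congr fun ξ => ?_
        have a4 : Measurable fun x : Eu d => weight N (gradSnd Φ (x', ξ) - x) :=
          Continuous.measurable (by fun_prop)
        have a5 : Measurable fun x : Eu d => weight N (gradSnd Φ (x', ξ) - x) * ‖stft g f x ξ‖ₑ :=
          a4.mul (measurable_enorm_stft_left g f ξ)
        exact lintegral_const_mul (weight N (gradFst Φ (0, ξ) - ξ')) a5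

theorem eLpNorm_le_mul_of_ne_top {α : Type*} [MeasurableSpace α] {μ : Measure α} {p c : ℝ≥0∞}
    {f g : α → ℝ≥0∞} (hc : c ≠ ⊤) (h : ∀ x, f x ≤ c * g x) :
    eLpNorm f p μ ≤ c * eLpNorm g p μ := by
  lift c to ℝ≥0 using hc
  exact eLpNorm_le_mul_eLpNorm_of_ae_le_mul' (Filter.Eventually.of_forall (by simpa using h)) p

theorem mixedNorm_le_mul {α β : Type*} [MeasurableSpace α] [MeasurableSpace β] {μ : Measure α}
    {ν : Measure β} {p q c : ℝ≥0∞} {F G : α → β → ℝ≥0∞} (hc : c ≠ ⊤)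
    (h : ∀ x y, F x y ≤ c * G x y) : mixedNorm μ ν p q F ≤ c * mixedNorm μ ν p q G :=
  eLpNorm_le_mul_of_ne_top hc fun y => eLpNorm_le_mul_of_ne_top hc fun x => h x y

/-- The extension of a Fourier integral operator to modulation spaces. -/
theorem exists_fioExtension {Φ : Eu d × Eu d → ℝ} (hΦ : IsPhase Φ) {σ : Eu d × Eu d → ℂ}
    {N : ℕ} (hN : d < N) (hσ : IsSymbol (2 * N) σ)
    (hrange : ∃ C : ℝ, ∀ x x' η : Eu d,
      ‖∇ (fun y : Eu d => Φ (y, η)) x - ∇ (fun y : Eu d => Φ (y, η)) x'‖ ≤ C) (g : 𝓢(Eu d, ℂ)) :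
    ∃ K : ℝ≥0, ∀ {p q : ℝ≥0∞}, 1 ≤ p → 1 ≤ q → ∀ f ∈ modSpace g p q,
      (∀ ψ, Integrable (fun z : Eu d × Eu d => stft g f z.1 z.2 * fioKernel Φ σ g z.1 z.2 ψ)
        volume) ∧
      ∃ u : 𝓢'(Eu d, ℂ), (∀ ψ, u ψ = fioExtension Φ σ g f ψ) ∧
        modNorm g p q u ≤ K * modNorm g p q f := by
  obtain ⟨C, hC, M, hM⟩ := exists_enorm_fioKernel_le hΦ hσ hrange g
  obtain ⟨K, hK, hKb⟩ := exists_mixedNorm_dominatingOp_le hΦ hN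
  have hσ' : MemLp σ ⊤ (volume : Measure (Eu d × Eu d)) := hσ.1
  have hKtop : ‖(windowEnergy g)⁻¹‖ₑ * ENNReal.ofReal (C * schwartzNorm M g) * K < ⊤ :=
    ENNReal.mul_lt_top (ENNReal.mul_lt_top enorm_lt_top ENNReal.ofReal_lt_top) hK
  -- One constant serves all exponents, because the Schur constants do not involve them.
  refine ⟨(‖(windowEnergy g)⁻¹‖ₑ * ENNReal.ofReal (C * schwartzNorm M g) * K).toNNReal,
    fun {p q} hp hq f hf => ?_⟩
  rw [ENNReal.coe_toNNReal hKtop.ne]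
  set G := dominatingOp Φ N (fun x ξ => ‖stft g f x ξ‖ₑ) with hG
  have hGtop : ∀ x' ξ', G x' ξ' < ⊤ := dominatingOp_lt_top hΦ hN (measurable_enorm_stft g f) hp hq
    (by rw [← modNorm_eq_mixedNorm]; exact hf)
  have hbound : ∀ (h : 𝓢(Eu d, ℂ)) (x' ξ' : Eu d), ∫⁻ z : Eu d × Eu d,
      ‖stft g f z.1 z.2 * fioKernel Φ σ g z.1 z.2 (conj (timeFreqShift h x' ξ'))‖ₑ ≤
      ENNReal.ofReal (C * schwartzNorm M h) * G x' ξ' := fun h x' ξ' =>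
    lintegral_stft_mul_fioKernel_le hΦ.smooth (fun x ξ => hM h x ξ x' ξ') f
  -- Every test function is a conjugated shift at the origin of the window `conj ψ`, so the kernel
  -- bound with variable window also yields continuity of the extension in `ψ`.
  have hconj : ∀ ψ : 𝓢(Eu d, ℂ), conj (timeFreqShift (conj ψ) 0 0) = ψ := by
    intro ψ
    rw [timeFreqShift_zero]
    ext t
    simp [conj_apply]
  have hbound' : ∀ ψ : 𝓢(Eu d, ℂ), ∫⁻ z : Eu d × Eu d,
      ‖stft g f z.1 z.2 * fioKernel Φ σ g z.1 z.2 ψ‖ₑ ≤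
      ENNReal.ofReal (C * schwartzNorm M ψ) * G 0 0 := by
    intro ψ
    have h1 := hbound (conj ψ) 0 0
    rw [hconj] at h1
    refine h1.trans ?_
    gcongr
    exact schwartzNorm_conj_le M ψ
  have hint : ∀ ψ, Integrable (fun z : Eu d × Eu d =>
      stft g f z.1 z.2 * fioKernel Φ σ g z.1 z.2 ψ) volume := fun ψ =>
    ⟨(continuous_stft g f).aestronglyMeasurable.mul
      (aestronglyMeasurable_fioKernel hΦ.smooth.continuous hσ' g ψ),
      (hbound' ψ).trans_lt (ENNReal.mul_lt_top ENNReal.ofReal_lt_top (hGtop 0 0))⟩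
  refine ⟨hint, ?_⟩
  let L : 𝓢(Eu d, ℂ) →L[ℂ] ℂ := SchwartzMap.mkCLMtoNormedSpace (fioExtension Φ σ g f)
    (fun ψ ψ' => by
      unfold fioExtension
      rw [← mul_add, ← integral_add (hint ψ) (hint ψ')]
      simp_rw [fioKernel_add hΦ.smooth.continuous hσ', mul_add])
    (fun c ψ => by
      unfold fioExtension
      rw [RingHom.id_apply, smul_eq_mul, mul_left_comm c, ← integral_const_mul c]
      simp_rw [fioKernel_smul, mul_left_comm c])
    ⟨Finset.Iic (M, M), ‖(windowEnergy g)⁻¹‖ * (C * (G 0 0).toReal), by positivity, fun ψ => by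
      have h0 := schwartzNorm_nonneg M ψ
      have h1 : ‖∫ z : Eu d × Eu d, stft g f z.1 z.2 * fioKernel Φ σ g z.1 z.2 ψ‖ ≤
          C * schwartzNorm M ψ * (G 0 0).toReal := by
        rw [← toReal_enorm, ← ENNReal.toReal_ofReal (r := C * schwartzNorm M ψ) (by positivity),
          ← ENNReal.toReal_mul]
        refine ENNReal.toReal_mono (ENNReal.mul_lt_top ENNReal.ofReal_lt_top (hGtop 0 0)).ne ?_
        exact (enorm_integral_le_lintegral_enorm _).trans (hbound' ψ)
      change ‖fioExtension Φ σ g f ψ‖ ≤ _ * schwartzNorm M ψ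
      rw [fioExtension, norm_mul]
      calc _ ≤ ‖(windowEnergy g)⁻¹‖ * (C * schwartzNorm M ψ * (G 0 0).toReal) := by gcongr
        _ = _ := by ring⟩
  refine ⟨ContinuousLinearMap.toPointwiseConvergenceCLM _ _ _ _ L, fun ψ => rfl, ?_⟩
  set u : 𝓢'(Eu d, ℂ) := ContinuousLinearMap.toPointwiseConvergenceCLM _ _ _ _ L with hu
  -- With the window `g` the same bound dominates the short-time Fourier transform of `u` pointwise
  -- by the positive operator.
  have hstft : ∀ x' ξ', ‖stft g u x' ξ'‖ₑ ≤
      ‖(windowEnergy g)⁻¹‖ₑ * ENNReal.ofReal (C * schwartzNorm M g) * G x' ξ' := by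
    intro x' ξ'
    have h1 : stft g u x' ξ' = fioExtension Φ σ g f (conj (timeFreqShift g x' ξ')) := rfl
    rw [h1, fioExtension, enorm_mul, mul_assoc]
    gcongr
    exact (enorm_integral_le_lintegral_enorm _).trans (hbound g x' ξ')
  rw [modNorm_eq_mixedNorm g p q u, modNorm_eq_mixedNorm g p q f]
  calc _ ≤ ‖(windowEnergy g)⁻¹‖ₑ * ENNReal.ofReal (C * schwartzNorm M g) *
        mixedNorm volume volume p q G := by
        exact mixedNorm_le_mul (ENNReal.mul_lt_top enorm_lt_top ENNReal.ofReal_lt_top).ne hstft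
    _ ≤ _ := by
        rw [mul_assoc _ K]
        gcongr
        exact hKb _ (measurable_enorm_stft g f) hp hq

end Operator

/-! ### Agreement with the oscillatory integral on Schwartz functions -/

section SchwartzClass

variable {d : ℕ}

theorem integrable_stft_mul_fioKernel_integrand {Φ : Eu d × Eu d → ℝ} (hΦ : Continuous Φ)
    {σ : Eu d × Eu d → ℂ} (hσ : MemLp σ ⊤ (volume : Measure (Eu d × Eu d))) (g φ ψ : 𝓢(Eu d, ℂ)) :
    Integrable (Function.uncurry fun z w : Eu d × Eu d => stft g (φ : 𝓢'(Eu d, ℂ)) z.1 z.2 *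
      (σ w * (osc Φ w * (ψ w.1 * 𝓕 (timeFreqShift g z.1 z.2) w.2))))
      ((volume : Measure (Eu d × Eu d)).prod volume) := by
  obtain ⟨B, hB0, hB⟩ := exists_ae_norm_le_of_memLp_top hσ
  have hmV : AEStronglyMeasurable (fun v : (Eu d × Eu d) × (Eu d × Eu d) =>
      stft g (φ : 𝓢'(Eu d, ℂ)) v.1.1 v.1.2) ((volume : Measure (Eu d × Eu d)).prod volume) :=
    (integrable_stft g φ).aestronglyMeasurable.comp_fst
  have hm := hmV.mul (aestronglyMeasurable_fioKernel_integrand hΦ hσ g ψ)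
  have hae : ∀ᵐ v ∂((volume : Measure (Eu d × Eu d)).prod (volume : Measure (Eu d × Eu d))),
      ‖σ v.2‖ ≤ B := Measure.quasiMeasurePreserving_snd.ae hB
  have hbound : Integrable (fun v : (Eu d × Eu d) × (Eu d × Eu d) =>
      ‖stft g (φ : 𝓢'(Eu d, ℂ)) v.1.1 v.1.2‖ * (B * (‖ψ v.2.1‖ * ‖𝓕 g (v.2.2 - v.1.2)‖)))
      ((volume : Measure (Eu d × Eu d)).prod volume) := by
    have hm' : AEStronglyMeasurable (fun v : (Eu d × Eu d) × (Eu d × Eu d) =>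
        ‖stft g (φ : 𝓢'(Eu d, ℂ)) v.1.1 v.1.2‖ * (B * (‖ψ v.2.1‖ * ‖𝓕 g (v.2.2 - v.1.2)‖)))
        ((volume : Measure (Eu d × Eu d)).prod volume) := by
      refine hmV.norm.mul (Continuous.aestronglyMeasurable ?_)
      fun_prop
    have hprod : ∀ ξ : Eu d, Integrable (fun w : Eu d × Eu d => ‖ψ w.1‖ * ‖𝓕 g (w.2 - ξ)‖)
        volume := fun ξ => by
      rw [Measure.volume_eq_prod]
      have h1 : Integrable ψ (volume : Measure (Eu d)) := ψ.integrable
      have h2 : Integrable (⇑(𝓕 g : 𝓢(Eu d, ℂ))) (volume : Measure (Eu d)) := (𝓕 g).integrable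
      exact h1.norm.mul_prod (h2.comp_sub_right ξ).norm
    rw [integrable_prod_iff hm']
    refine ⟨Filter.Eventually.of_forall fun z => ((hprod z.2).const_mul B).const_mul
      ‖stft g (φ : 𝓢'(Eu d, ℂ)) z.1 z.2‖, ?_⟩
    have : ∀ z : Eu d × Eu d, ∫ w : Eu d × Eu d, ‖‖stft g (φ : 𝓢'(Eu d, ℂ)) z.1 z.2‖ *
        (B * (‖ψ w.1‖ * ‖𝓕 g (w.2 - z.2)‖))‖ =
        ‖stft g (φ : 𝓢'(Eu d, ℂ)) z.1 z.2‖ * (|B| * ((∫ t, ‖ψ t‖) * ∫ η, ‖𝓕 g η‖)) := by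
      intro z
      simp only [norm_mul, Real.norm_eq_abs, abs_norm]
      rw [integral_const_mul, integral_const_mul, Measure.volume_eq_prod,
        integral_prod_mul (fun t => ‖ψ t‖) fun η => ‖𝓕 g (η - z.2)‖,
        integral_sub_right_eq_self (fun η => ‖𝓕 g η‖)]
    simp only [this]
    exact (integrable_stft g φ).norm.mul_const _
  refine hbound.mono' hm ?_
  filter_upwards [hae] with v hv
  simp only [Function.uncurry, norm_mul, norm_osc, one_mul, norm_fourier_timeFreqShift_apply]
  gcongr

theorem fio_eq (Φ : Eu d × Eu d → ℝ) (σ : Eu d × Eu d → ℂ) (φ : 𝓢(Eu d, ℂ)) (x : Eu d) :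
    fio Φ σ φ x = ∫ η, σ (x, η) * (osc Φ (x, η) * 𝓕 φ η) := by
  unfold fio osc
  refine integral_congr_ae (Filter.Eventually.of_forall fun η => ?_)
  simp only
  ring

/-- Fubini exchanges the superposition with the integral over phase space; inversion on the Fourier
side then restores `windowEnergy g` times the transform of `φ`, cancelling the normalisation. -/
theorem fioExtension_coe {Φ : Eu d × Eu d → ℝ} (hΦ : Continuous Φ)
    {σ : Eu d × Eu d → ℂ} (hσ : MemLp σ ⊤ (volume : Measure (Eu d × Eu d))) {g : 𝓢(Eu d, ℂ)}
    (hg : g ≠ 0) (φ ψ : 𝓢(Eu d, ℂ)) :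
    Integrable (fun x => fio Φ σ φ x * ψ x) volume ∧
      fioExtension Φ σ g φ ψ = ∫ x, fio Φ σ φ x * ψ x := by
  have hint := integrable_symbol_mul_osc_mul hΦ hσ ψ (𝓕 φ)
  have hslice : ∀ x, ∫ η, σ (x, η) * (osc Φ (x, η) * (ψ x * 𝓕 φ η)) = fio Φ σ φ x * ψ x := by
    intro x
    rw [fio_eq, ← integral_mul_const]
    refine integral_congr_ae (Filter.Eventually.of_forall fun η => ?_)
    simp only
    ring
  rw [Measure.volume_eq_prod] at hint
  constructor
  · have := hint.integral_prod_left
    simpa only [hslice] using this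
  · have h1 := integral_integral_swap (integrable_stft_mul_fioKernel_integrand hΦ hσ g φ ψ)
    simp only [integral_const_mul] at h1
    rw [fioExtension]
    unfold fioKernel
    rw [h1]
    have h2 : ∀ w : Eu d × Eu d, ∫ z : Eu d × Eu d, stft g (φ : 𝓢'(Eu d, ℂ)) z.1 z.2 *
        (σ w * (osc Φ w * (ψ w.1 * 𝓕 (timeFreqShift g z.1 z.2) w.2))) =
        windowEnergy g * (σ w * (osc Φ w * (ψ w.1 * 𝓕 φ w.2))) := by
      intro w
      rw [show windowEnergy g * (σ w * (osc Φ w * (ψ w.1 * 𝓕 φ w.2))) =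
        σ w * osc Φ w * ψ w.1 * (windowEnergy g * 𝓕 φ w.2) by ring,
        ← integral_stft_mul_fourier, ← integral_const_mul]
      refine integral_congr_ae (Filter.Eventually.of_forall fun z => ?_)
      simp only
      ring
    simp only [h2]
    rw [integral_const_mul, inv_mul_cancel_left₀ (windowEnergy_ne_zero hg),
      Measure.volume_eq_prod, integral_prod _ hint]
    simp only [hslice]

/-- The symbol is bounded only almost everywhere in both variables together; by Fubini almost every
slice in `η` is bounded. -/
theorem exists_ae_norm_fio_le {Φ : Eu d × Eu d → ℝ} {σ : Eu d × Eu d → ℂ}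
    (hσ : MemLp σ ⊤ (volume : Measure (Eu d × Eu d))) (φ : 𝓢(Eu d, ℂ)) :
    ∃ B : ℝ, ∀ᵐ x, ‖fio Φ σ φ x‖ ≤ B := by
  obtain ⟨B, hB0, hB⟩ := exists_ae_norm_le_of_memLp_top hσ
  refine ⟨B * ∫ η, ‖𝓕 φ η‖, ?_⟩
  rw [Measure.volume_eq_prod] at hB
  filter_upwards [Measure.ae_ae_of_ae_prod hB] with x hx
  rw [fio_eq, ← integral_const_mul]
  refine norm_integral_le_of_norm_le ((𝓕 φ).integrable.norm.const_mul B) ?_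
  filter_upwards [hx] with η hη
  rw [norm_mul, norm_mul, norm_osc, one_mul]
  gcongr

theorem aestronglyMeasurable_fio {Φ : Eu d × Eu d → ℝ} (hΦ : Continuous Φ) {σ : Eu d × Eu d → ℂ}
    (hσ : MemLp σ ⊤ (volume : Measure (Eu d × Eu d))) (φ : 𝓢(Eu d, ℂ)) :
    AEStronglyMeasurable (fio Φ σ φ) volume := by
  have h : AEStronglyMeasurable (fun w : Eu d × Eu d => σ w * (osc Φ w * 𝓕 φ w.2))
      (volume.prod volume) := by
    refine hσ.1.mul (Continuous.aestronglyMeasurable ?_)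
    have := continuous_osc hΦ
    fun_prop
  have h2 := h.integral_prod_right'
  refine h2.congr (Filter.Eventually.of_forall fun x => ?_)
  exact (fio_eq Φ σ φ x).symm

end SchwartzClass

/-! ### Invariant subspaces and the bounded extensions -/

section Conclusion

variable {d : ℕ}

theorem coe_mem_modSpaceClosure (g φ : 𝓢(Eu d, ℂ)) {p q : ℝ≥0∞} (hp : 1 ≤ p) (hq : 1 ≤ q) :
    (φ : 𝓢'(Eu d, ℂ)) ∈ modSpaceClosure g p q :=
  ⟨modNorm_coe_lt_top g φ hp hq, fun ε hε => ⟨φ, by rwa [sub_self, modNorm_zero]⟩⟩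

/-- The modulation space as a linear subspace of the tempered distributions. -/
def modSubmodule (g : 𝓢(Eu d, ℂ)) {p q : ℝ≥0∞} (hp : 1 ≤ p) (hq : 1 ≤ q) :
    Submodule ℂ 𝓢'(Eu d, ℂ) where
  carrier := modSpace g p q
  add_mem' {f f'} hf hf' :=
    (modNorm_add_le g hp hq f f').trans_lt (ENNReal.add_lt_top.2 ⟨hf, hf'⟩)
  zero_mem' := by
    change modNorm g p q 0 < ⊤
    rw [modNorm_zero]
    exact ENNReal.zero_lt_top
  smul_mem' c f hf :=
    (modNorm_smul_le g p q c f).trans_lt (ENNReal.mul_lt_top enorm_lt_top hf)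

/-- The closure of the Schwartz class as a linear subspace of the tempered distributions. -/
def modClosureSubmodule (g : 𝓢(Eu d, ℂ)) {p q : ℝ≥0∞} (hp : 1 ≤ p) (hq : 1 ≤ q) :
    Submodule ℂ 𝓢'(Eu d, ℂ) where
  carrier := modSpaceClosure g p q
  add_mem' {f f'} hf hf' := by
    refine ⟨(modSubmodule g hp hq).add_mem hf.1 hf'.1, fun ε hε => ?_⟩
    obtain ⟨φ, hφ⟩ := hf.2 (ε / 2) (ENNReal.half_pos hε.ne')
    obtain ⟨φ', hφ'⟩ := hf'.2 (ε / 2) (ENNReal.half_pos hε.ne')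
    refine ⟨φ + φ', ?_⟩
    rw [map_add, add_sub_add_comm]
    refine (modNorm_add_le g hp hq _ _).trans_lt ?_
    rw [← ENNReal.add_halves ε]
    exact ENNReal.add_lt_add hφ hφ'
  zero_mem' := by
    simpa using coe_mem_modSpaceClosure g (0 : 𝓢(Eu d, ℂ)) hp hq
  smul_mem' c f hf := by
    refine ⟨(modSubmodule g hp hq).smul_mem c hf.1, fun ε hε => ?_⟩
    obtain ⟨φ, hφ⟩ := hf.2 (ε / (‖c‖ₑ + 1)) (ENNReal.div_pos hε.ne' (by simp))
    refine ⟨c • φ, ?_⟩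
    rw [map_smul, ← smul_sub]
    refine (modNorm_smul_le g p q c _).trans_lt ?_
    rw [ENNReal.lt_div_iff_mul_lt (by simp) (by simp), mul_comm] at hφ
    exact lt_of_le_of_lt (mul_le_mul' le_self_add le_rfl) hφ

theorem fioExtension_add {Φ : Eu d × Eu d → ℝ} {σ : Eu d × Eu d → ℂ} {g : 𝓢(Eu d, ℂ)}
    {f f' : 𝓢'(Eu d, ℂ)} {ψ : 𝓢(Eu d, ℂ)}
    (h : Integrable (fun z : Eu d × Eu d => stft g f z.1 z.2 * fioKernel Φ σ g z.1 z.2 ψ) volume)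
    (h' : Integrable (fun z : Eu d × Eu d => stft g f' z.1 z.2 * fioKernel Φ σ g z.1 z.2 ψ)
      volume) :
    fioExtension Φ σ g (f + f') ψ = fioExtension Φ σ g f ψ + fioExtension Φ σ g f' ψ := by
  unfold fioExtension
  rw [← mul_add, ← integral_add h h']
  simp_rw [stft_add, add_mul]

theorem fioExtension_sub {Φ : Eu d × Eu d → ℝ} {σ : Eu d × Eu d → ℂ} {g : 𝓢(Eu d, ℂ)}
    {f f' : 𝓢'(Eu d, ℂ)} {ψ : 𝓢(Eu d, ℂ)}
    (h : Integrable (fun z : Eu d × Eu d => stft g f z.1 z.2 * fioKernel Φ σ g z.1 z.2 ψ) volume)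
    (h' : Integrable (fun z : Eu d × Eu d => stft g f' z.1 z.2 * fioKernel Φ σ g z.1 z.2 ψ)
      volume) :
    fioExtension Φ σ g (f - f') ψ = fioExtension Φ σ g f ψ - fioExtension Φ σ g f' ψ := by
  unfold fioExtension
  rw [← mul_sub, ← integral_sub h h']
  simp_rw [stft_sub, sub_mul]

theorem fioExtension_smul (Φ : Eu d × Eu d → ℝ) (σ : Eu d × Eu d → ℂ) (g : 𝓢(Eu d, ℂ)) (c : ℂ)
    (f : 𝓢'(Eu d, ℂ)) (ψ : 𝓢(Eu d, ℂ)) :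
    fioExtension Φ σ g (c • f) ψ = c * fioExtension Φ σ g f ψ := by
  unfold fioExtension
  rw [mul_left_comm c, ← integral_const_mul c]
  simp_rw [stft_smul, mul_assoc]

/-- A subspace of a modulation space that contains the Schwartz class and is invariant under the
extension of the Fourier integral operator carries a bounded extension. -/
theorem extendsBoundedly_of_submodule {Φ : Eu d × Eu d → ℝ} {σ : Eu d × Eu d → ℂ}
    {g : 𝓢(Eu d, ℂ)} (X : Submodule ℂ 𝓢'(Eu d, ℂ)) {n : 𝓢'(Eu d, ℂ) → ℝ≥0∞} {K : ℝ≥0}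
    (hX : ∀ f ∈ X, (∀ ψ, Integrable (fun z : Eu d × Eu d =>
        stft g f z.1 z.2 * fioKernel Φ σ g z.1 z.2 ψ) volume) ∧
      ∃ u ∈ X, (∀ ψ, u ψ = fioExtension Φ σ g f ψ) ∧ n u ≤ K * n f)
    (hS : ∀ φ : 𝓢(Eu d, ℂ), (φ : 𝓢'(Eu d, ℂ)) ∈ X)
    (hfio : ∀ φ ψ : 𝓢(Eu d, ℂ), Integrable (fun x => fio Φ σ φ x * ψ x) volume ∧
      fioExtension Φ σ g φ ψ = ∫ x, fio Φ σ φ x * ψ x) :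
    ExtendsBoundedly Φ σ X n := by
  choose hint A hAX hA hAn using hX
  let T : 𝓢'(Eu d, ℂ) →ₗ.[ℂ] 𝓢'(Eu d, ℂ) :=
    { domain := X
      toFun :=
        { toFun := fun f => A f.1 f.2
          map_add' := fun f f' => by
            refine DFunLike.ext _ _ fun ψ => ?_
            change A (f + f').1 (f + f').2 ψ = A f.1 f.2 ψ + A f'.1 f'.2 ψ
            rw [hA, hA, hA]
            exact fioExtension_add (hint f.1 f.2 ψ) (hint f'.1 f'.2 ψ)
          map_smul' := fun c f => by
            refine DFunLike.ext _ _ fun ψ => ?_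
            change A (c • f).1 (c • f).2 ψ = c * A f.1 f.2 ψ
            rw [hA, hA]
            exact fioExtension_smul Φ σ g c f.1 ψ } }
  refine ⟨T, rfl, fun f => hAX f.1 f.2, ⟨K, fun f => hAn f.1 f.2⟩, fun φ => ⟨hS φ, fun ψ => ?_⟩⟩
  refine ⟨(hfio φ ψ).1, ?_⟩
  rw [← (hfio φ ψ).2]
  exact hA _ (hS φ) ψ

theorem extendsBoundedly_modSpace {Φ : Eu d × Eu d → ℝ} (hΦ : IsPhase Φ) {σ : Eu d × Eu d → ℂ}
    {N : ℕ} (hN : d < N) (hσ : IsSymbol (2 * N) σ)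
    (hrange : ∃ C : ℝ, ∀ x x' η : Eu d,
      ‖∇ (fun y : Eu d => Φ (y, η)) x - ∇ (fun y : Eu d => Φ (y, η)) x'‖ ≤ C)
    {g : 𝓢(Eu d, ℂ)} (hg : g ≠ 0) {p q : ℝ≥0∞} (hp : 1 ≤ p) (hq : 1 ≤ q) :
    ExtendsBoundedly Φ σ (modSpace g p q) (modNorm g p q) := by
  obtain ⟨K, hK⟩ := exists_fioExtension hΦ hN hσ hrange g
  have hσ' : MemLp σ ⊤ (volume : Measure (Eu d × Eu d)) := hσ.1
  refine extendsBoundedly_of_submodule (modSubmodule g hp hq) (K := K) (fun f hf => ?_)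
    (fun φ => modNorm_coe_lt_top g φ hp hq)
    (fun φ ψ => fioExtension_coe hΦ.smooth.continuous hσ' hg φ ψ)
  obtain ⟨hint, u, hu, hun⟩ := hK hp hq f hf
  exact ⟨hint, u, hun.trans_lt (ENNReal.mul_lt_top ENNReal.coe_lt_top hf), hu, hun⟩

/-- Boundedness alone does not give invariance of the closure: the images of Schwartz functions must
first be shown to lie in it, after which approximation does the rest. -/
theorem extendsBoundedly_modSpaceClosure {Φ : Eu d × Eu d → ℝ} (hΦ : IsPhase Φ)
    {σ : Eu d × Eu d → ℂ} {N : ℕ} (hN : d < N) (hσ : IsSymbol (2 * N) σ)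
    (hrange : ∃ C : ℝ, ∀ x x' η : Eu d,
      ‖∇ (fun y : Eu d => Φ (y, η)) x - ∇ (fun y : Eu d => Φ (y, η)) x'‖ ≤ C)
    {g : 𝓢(Eu d, ℂ)} (hg : g ≠ 0) {p q : ℝ≥0∞} (hp : 1 ≤ p) (hq : 1 ≤ q) :
    ExtendsBoundedly Φ σ (modSpaceClosure g p q) (modNorm g p q) := by
  obtain ⟨K, hK⟩ := exists_fioExtension hΦ hN hσ hrange g
  have hσ' : MemLp σ ⊤ (volume : Measure (Eu d × Eu d)) := hσ.1
  have hfio := fioExtension_coe hΦ.smooth.continuous hσ' hg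
  -- The image of `φ` is a bounded function, and boundedness at `p = q = 1` makes its short-time
  -- Fourier transform integrable; Riemann sums then approximate it for all exponents.
  have hclos : ∀ (φ : 𝓢(Eu d, ℂ)) (v : 𝓢'(Eu d, ℂ)), (∀ ψ, v ψ = fioExtension Φ σ g φ ψ) →
      v ∈ modSpaceClosure g p q := by
    intro φ v hv
    obtain ⟨B, hB⟩ := exists_ae_norm_fio_le (Φ := Φ) hσ' φ
    have hfun : IsFunction v (fio Φ σ φ) := fun ψ => ⟨(hfio φ ψ).1, by rw [hv, (hfio φ ψ).2]⟩
    obtain ⟨-, u, hu, hun⟩ := hK le_rfl le_rfl (φ : 𝓢'(Eu d, ℂ))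
      (modNorm_coe_lt_top g φ le_rfl le_rfl)
    have huv : u = v := DFunLike.ext _ _ fun ψ => by rw [hu, hv]
    rw [huv] at hun
    have hfin : modNorm g 1 1 v < ⊤ := hun.trans_lt
      (ENNReal.mul_lt_top ENNReal.coe_lt_top (modNorm_coe_lt_top g φ le_rfl le_rfl))
    refine mem_modSpaceClosure_of_integrable_stft g hg
      (aestronglyMeasurable_fio hΦ.smooth.continuous hσ' φ) hB hfun
      ⟨(continuous_stft g v).aestronglyMeasurable, ?_⟩ hp hq
    rw [hasFiniteIntegral_iff_enorm, Measure.volume_eq_prod,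
      lintegral_prod_symm (fun z : Eu d × Eu d => ‖stft g v z.1 z.2‖ₑ)
        (measurable_enorm_stft g v).aemeasurable]
    rw [modNorm_eq_mixedNorm, mixedNorm] at hfin
    simpa [eLpNorm_one_eq_lintegral_enorm] using hfin
  refine extendsBoundedly_of_submodule (modClosureSubmodule g hp hq) (K := K) (fun f hf => ?_)
    (fun φ => coe_mem_modSpaceClosure g φ hp hq) hfio
  obtain ⟨hint, u, hu, hun⟩ := hK hp hq f hf.1
  refine ⟨hint, u, ⟨hun.trans_lt (ENNReal.mul_lt_top ENNReal.coe_lt_top hf.1), fun ε hε => ?_⟩,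
    hu, hun⟩
  -- The error splits into the image `w` of `f - φ`, at most `K` times a small norm, and `v - φ'`
  -- with `v` the image of `φ`. The `+ 1` avoids division by zero.
  obtain ⟨φ, hφ⟩ := hf.2 (ε / 2 / (K + 1))
    (ENNReal.div_pos (ENNReal.half_pos hε.ne').ne' (by simp))
  obtain ⟨hintφ, v, hv, -⟩ := hK hp hq (φ : 𝓢'(Eu d, ℂ)) (modNorm_coe_lt_top g φ hp hq)
  obtain ⟨φ', hφ'⟩ := (hclos φ v hv).2 (ε / 2) (ENNReal.half_pos hε.ne')
  have hmem : f - (φ : 𝓢'(Eu d, ℂ)) ∈ modSpace g p q :=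
    (modSubmodule g hp hq).sub_mem hf.1 (modNorm_coe_lt_top g φ hp hq)
  obtain ⟨-, w, hw, hwn⟩ := hK hp hq _ hmem
  have hsub : u - v = w := by
    refine DFunLike.ext _ _ fun ψ => ?_
    change u ψ - v ψ = w ψ
    rw [hu, hv, hw, fioExtension_sub (hint ψ) (hintφ ψ)]
  refine ⟨φ', ?_⟩
  have h1 : u - (φ' : 𝓢'(Eu d, ℂ)) = w + (v - (φ' : 𝓢'(Eu d, ℂ))) := by rw [← hsub]; abel
  rw [h1]
  refine (modNorm_add_le g hp hq _ _).trans_lt ?_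
  rw [← ENNReal.add_halves ε]
  refine ENNReal.add_lt_add ?_ hφ'
  rw [ENNReal.lt_div_iff_mul_lt (by simp) (by simp), mul_comm] at hφ
  exact lt_of_le_of_lt (hwn.trans (mul_le_mul' le_self_add le_rfl)) hφ

end Conclusion

end FourierIntegral

end

theorem theorem5p2 (d N : ℕ) (hN : d < N)
    (Φ : Eu d × Eu d → ℝ) (hΦ : IsPhase Φ)
    (σ : Eu d × Eu d → ℂ) (hσ : IsSymbol (2 * N) σ)
    (hrange : ∃ C : ℝ, ∀ x x' η : Eu d,
      ‖∇ (fun y : Eu d => Φ (y, η)) x - ∇ (fun y : Eu d => Φ (y, η)) x'‖ ≤ C)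
    (g : 𝓢(Eu d, ℂ)) (hg : g ≠ 0) (p q : ℝ≥0∞) (hp : 1 ≤ p) (hq : 1 ≤ q) :
    (p ≠ ⊤ → q ≠ ⊤ → ExtendsBoundedly Φ σ (modSpace g p q) (modNorm g p q)) ∧
    (p = ⊤ ∨ q = ⊤ → ExtendsBoundedly Φ σ (modSpaceClosure g p q) (modNorm g p q)) := by
  exact ⟨fun _ _ => extendsBoundedly_modSpace hΦ hN hσ hrange hg hp hq,
    fun _ => extendsBoundedly_modSpaceClosure hΦ hN hσ hrange hg hp hq⟩
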